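/- Conventions. The alphabet $\Sigma_L$ of a language $L$ consists of the letters that occur in words of $L$. The quotients of $L$ are the languages $w^{-1}L=\{x\mid wx\in L\}$ with $w\in\Sigma_L^*$, and the complexity $\kappa(L)$ is the number of distinct quotients. A left ideal is a non-empty language $L$ with $L=\Sigma_L^*L$. The syntactic semigroup of $L$ is $\Sigma_L^+/{\approx_L}$, where $x\approx_L y$ iff $wxz\in L\Leftrightarrow wyz\in L$ for all $w,z\in\Sigma_L^*$. The atoms of $L$ are the classes of the relation on $\Sigma_L^*$ that relates $x$ and $y$ iff $ux\in L\Leftrightarrow uy\in L$ for all $u\in\Sigma_L^*$; equivalently, they are the non-empty sets $A_S=\bigcap_{K\in S}K\cap\bigcap_{K\notin S}\overline{K}$, where $S$ is a set of quotients of $L$. A DFA is minimal if all its states are reachable and no two distinct states accept the same language. For $n\ge 4$ let $\mathcal E_n$ be the DFA with states $Q_n=\{0,\dots,n-1\}$, alphabet $\{a,b,c,d,e\}$, initial state $0$, final states $\{1,\dots,n-1\}$, and transitions $a\colon(1,\dots,n-1)$ (a cycle), $b\colon(1,2)$ (a transposition), $c\colon(n-1\to1)$, $d\colon(n-1\to0)$,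 $e\colon(Q_n\to1)$ (a constant map); all states that are not mentioned are fixed. Let $M_n=M_n(a,b,c,d,e)$ be its language. The dialect $M_n(x_1,\dots,x_5)$ is obtained by replacing the letters $a,b,c,d,e$ by $x_1,\dots,x_5$ in all words; if $x_i$ is "$-$", the words that contain the $i$-th letter are deleted. Theorem (Nearly Most Complex Left Ideals). For each $n\ge4$ the DFA $\mathcal E_n$ is minimal, and $M_n$ is a left ideal of complexity $n$; so are the dialects used below. The stream $(M_n\mid n\ge4)$, together with some dialects, meets all the complexity bounds for left ideals except those for product. Precisely, for all $m,n\ge4$: 1. The syntactic semigroup of $M_n$ has cardinality $n^{n-1}+n-1$. 2. Each quotient of $M_n(a,-,-,d,e)$ has complexity $n$. 3. The reverse of $M_n(a,-,-,d,e)$ has complexity $2^{n-1}+1$, and $M_n(a,-,-,d,e)$ has $2^{n-1}+1$ atoms. 4. Each atom $A_S$ of $M_n$ has complexity $n$ if $S$ is the set of all quotients, $2^{n-1}$ if $S=\emptyset$, and $1+\sum_{x=1}^{|S|}\sum_{y=1}^{n-|S|}\binom{n-1}{x}\binom{n-x-1}{y-1}$ otherwise. 5. The star of $M_n(a,-,-,d,e)$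 has complexity $n+1$. 6. Restricted boolean operations: $\kappa(M_m(a,b,-,d,e)\circ M_n(a,e,-,d,b))=mn$ for $\circ\in\{\cup,\oplus,\setminus,\cap\}$. 7. Unrestricted boolean operations: $\kappa(M_m(a,b,c,d,e)\circ M_n(a,e,f,d,b))$ is $(m+1)(n+1)$ for $\circ\in\{\cup,\oplus\}$, $mn+m$ for $\circ=\setminus$, and $mn$ for $\circ=\cap$. These values are the largest possible for left ideals over finite alphabets: for every left ideal $L$ of complexity $n\ge4$ the measures in 1--5 are at most the stated values (in 4, for each atom $A_S$ of $L$, at most the value for $|S|$), and for all left ideals $L'$, $L$ of complexities $m,n\ge4$ the complexity of $L'\circ L$ is at most the value in 7, and at most $mn$ if $L'$ and $L$ have the same alphabet. -/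

import Mathlib

open scoped Computability symmDiff

namespace SuffixConvex

variable {α β σ : Type*}

/-! ### Languages and their complexity -/

/-- The alphabet `Σ` of a language: the letters that appear in some word of the language.  A language
is always regarded as a language over this alphabet. -/
def letters (L : Language α) : Set α := {a | ∃ w ∈ L, a ∈ w}

/-- `Σ*`, the set of all words over the alphabet of `L`. -/
def words (L : Language α) : Language α := {w | ∀ a ∈ w, a ∈ letters L}

/-- The set of all (left) quotients `w⁻¹L = {x | wx ∈ L}`, with `w ∈ Σ*`. -/
def quotients (L : Language α) : Set (Language α) := {K | ∃ w ∈ words L, K = L.leftQuotient w}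

/-- The quotient complexity of `L`: the number of distinct quotients (infinite if `L` is not
regular). -/
noncomputable def complexity (L : Language α) : ℕ∞ := (quotients L).encard

/-- A left ideal is a non-empty language `L` with `L = Σ*L`. -/
def IsLeftIdeal (L : Language α) : Prop := L ≠ 0 ∧ L = words L * L

/-! ### Syntactic semigroup -/

/-- `Σ⁺`, the non-empty words over the alphabet of `L`. -/
abbrev NonemptyWord (L : Language α) : Type _ := {w : List α // w ≠ [] ∧ w ∈ words L}

/-- The Myhill (syntactic) congruence of `L` on `Σ⁺`. -/
def myhill (L : Language α) : Setoid (NonemptyWord L) where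
  r x y := ∀ w ∈ words L, ∀ z ∈ words L, (w ++ x.1 ++ z ∈ L ↔ w ++ y.1 ++ z ∈ L)
  iseqv :=
    { refl := fun _ _ _ _ _ => Iff.rfl
      symm := fun h w hw z hz => (h w hw z hz).symm
      trans := fun h k w hw z hz => (h w hw z hz).trans (k w hw z hz) }

/-- The underlying type `Σ⁺/≈` of the syntactic semigroup of `L`. -/
def SyntacticSemigroup (L : Language α) : Type _ := Quotient (myhill L)

theorem append_mem_words {L : Language α} {x y : List α} (hx : x ∈ words L) (hy : y ∈ words L) :
    x ++ y ∈ words L := by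
  intro a ha
  rcases List.mem_append.1 ha with h | h
  · exact hx a h
  · exact hy a h

/-- Concatenation of non-empty words. -/
def NonemptyWord.append {L : Language α} (x y : NonemptyWord L) : NonemptyWord L :=
  ⟨x.1 ++ y.1, by simp [x.2.1], append_mem_words x.2.2 y.2.2⟩

theorem append_congr {L : Language α} (x x' : NonemptyWord L) (hx : (myhill L).r x x')
    (y y' : NonemptyWord L) (hy : (myhill L).r y y') :
    (myhill L).r (x.append y) (x'.append y') := by
  intro w hw z hz
  have h1 := hx w hw (y.1 ++ z) (append_mem_words y.2.2 hz)
  have h2 := hy (w ++ x'.1) (append_mem_words hw x'.2.2) z hz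
  simp only [NonemptyWord.append, List.append_assoc] at h1 h2 ⊢
  exact h1.trans h2

/-- Multiplication of classes is induced by concatenation. -/
instance (L : Language α) : Semigroup (SyntacticSemigroup L) where
  mul := Quotient.map₂ NonemptyWord.append
    (fun x x' hx y y' hy => append_congr x x' hx y y' hy)
  mul_assoc := by
    rintro ⟨x⟩ ⟨y⟩ ⟨z⟩
    exact congrArg (Quotient.mk (myhill L)) (Subtype.ext (List.append_assoc x.1 y.1 z.1))

/-! ### Atoms -/

/-- The atoms of `L`: the classes of the left congruence on `Σ*` that relates `x` and `y` when
`ux ∈ L ↔ uy ∈ L` for all `u ∈ Σ*`. -/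
def atoms (L : Language α) : Set (Language α) :=
  {A | ∃ x ∈ words L, A = {y | y ∈ words L ∧ ∀ u ∈ words L, (u ++ x ∈ L ↔ u ++ y ∈ L)}}

/-- `A_S`, for a set `S` of quotients of `L`: the intersection (within `Σ*`) of the quotients in `S`
and of the complements of the quotients not in `S`. -/
def atomOf (L : Language α) (S : Set (Language α)) : Language α :=
  {x | x ∈ words L ∧ ∀ K ∈ quotients L, (x ∈ K ↔ K ∈ S)}

/-- The bound for the complexity of an atom `A_S` of a left ideal of complexity `n`, with
`s = |S|`. -/
def atomBound (n s : ℕ) : ℕ :=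
  if s = n then n
  else if s = 0 then 2 ^ (n - 1)
  else 1 + ∑ x ∈ Finset.Icc 1 s, ∑ y ∈ Finset.Icc 1 (n - s),
    (n - 1).choose x * (n - x - 1).choose (y - 1)

/-! ### Automata -/

/-- A DFA is minimal if all its states are reachable and no two distinct states are equivalent. -/
def IsMinimal (A : DFA α σ) : Prop :=
  (∀ q, ∃ w, A.eval w = q) ∧ ∀ p q, A.acceptsFrom p = A.acceptsFrom q → p = q

/-- The input alphabet `{a, b, c, d, e}` of the witnesses. -/
inductive Input
  | a | b | c | d | e

/-- The transformations of `Q_n = {0, …, n - 1}` that the letters induce: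
`a : (1, …, n - 1)`, `b : (1, 2)`, `c : (n - 1 → 1)`, `d : (n - 1 → 0)`, `e : (Q_n → 1)`. -/
def transition (n : ℕ) (hn : 4 ≤ n) (q : Fin n) : Input → Fin n
  | .a => if q.val = 0 then q
      else if h : q.val + 1 < n then ⟨q.val + 1, h⟩ else ⟨1, by omega⟩
  | .b => Equiv.swap ⟨1, by omega⟩ ⟨2, by omega⟩ q
  | .c => if q.val = n - 1 then ⟨1, by omega⟩ else q
  | .d => if q.val = n - 1 then ⟨0, by omega⟩ else q
  | .e => ⟨1, by omega⟩

/-- The DFA `D_n` of the most complex left ideal, with the single final state `n - 1`. -/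
def D (n : ℕ) (hn : 4 ≤ n) : DFA Input (Fin n) where
  step := transition n hn
  start := ⟨0, by omega⟩
  accept := {q | q.val = n - 1}

/-- The DFA `E_n`: it is `D_n` with the set of final states changed to `{1, …, n - 1}`. -/
def E (n : ℕ) (hn : 4 ≤ n) : DFA Input (Fin n) :=
  { D n hn with accept := {q | 1 ≤ q.val} }

/-- The language `M_n = M_n(a, b, c, d, e)` accepted by `E_n`. -/
def M (n : ℕ) (hn : 4 ≤ n) : Language Input := (E n hn).accepts

/-! ### Dialects -/

/-- The dialect of `L` given by a partial map `π` (which is meant to be injective where it is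
defined): each letter `x` is replaced by `π x`, and the words that contain a letter at which `π` is
undefined are deleted. -/
def dialect (π : α → Option β) (L : Language α) : Language β :=
  {v | ∃ w ∈ L, w.map π = v.map some}

/-- The letters that occur in the dialects of the witnesses. -/
inductive Letter
  | a | b | c | d | e | f

/-- The dialect `M_n(x₁, x₂, x₃, x₄, x₅)`, where `none` stands for "undefined". -/
def Mdialect (n : ℕ) (hn : 4 ≤ n) (x₁ x₂ x₃ x₄ x₅ : Option Letter) : Language Letter :=
  dialect (fun
    | Input.a => x₁
    | Input.b => x₂
    | Input.c => x₃
    | Input.d => x₄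
    | Input.e => x₅) (M n hn)

/-- `M_n(a, -, -, d, e)` -/
def Made (n : ℕ) (hn : 4 ≤ n) : Language Letter :=
  Mdialect n hn (some .a) none none (some .d) (some .e)

/-- `M_n(a, b, -, d, e)` -/
def Mabde (n : ℕ) (hn : 4 ≤ n) : Language Letter :=
  Mdialect n hn (some .a) (some .b) none (some .d) (some .e)

/-- `M_n(a, e, -, d, b)` -/
def Maedb (n : ℕ) (hn : 4 ≤ n) : Language Letter :=
  Mdialect n hn (some .a) (some .e) none (some .d) (some .b)

/-- `M_n(a, b, c, d, e)`, over the larger set of letters -/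
def Mabcde (n : ℕ) (hn : 4 ≤ n) : Language Letter :=
  Mdialect n hn (some .a) (some .b) (some .c) (some .d) (some .e)

/-- `M_n(a, e, f, d, b)` -/
def Maefdb (n : ℕ) (hn : 4 ≤ n) : Language Letter :=
  Mdialect n hn (some .a) (some .e) (some .f) (some .d) (some .b)

end SuffixConvex

/-! Upper bounds. Every quotient of a left ideal `L` contains `L`, so the quotients ordered by
inclusion form a poset with least element `L`, on which words act by monotone maps. The semigroup
bound is thus a bound on monotone self-maps of an `n`-element poset with bottom
(`ncard_monotone_le`). If the other elements form an antichain, such a map either fixes the bottom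
or is constant, which gives n^(n-1) + (n-1). Otherwise a pair x < y above the bottom must go to a
comparable pair, which costs about a factor 2, and an estimate of power sums shows that the bound
still holds.

Both the atoms and the quotients of the reverse are counted by the sets of quotients that contain a
given word (`encard_atoms`, `complexity_reverse`). Such a set either avoids `L` or is everything,
hence 2^(n-1) + 1. The star only adds the empty word to `L`. A quotient of an atom consists of the
words lying in all members of a set X of quotients and in none of a set Y. Either it is empty, or X
and Y are disjoint and X avoids `L`; one member of Y carries no information, because some element of
Y lies above L or above the least member of Y. When Y is a single quotient a separate coding by
`decodeTop` is needed. For boolean operations, a quotient is determined by a pair of quotients, each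
possibly empty when a letter is foreign to one operand.

Lower bounds. In E_n a word fixes 0 or is constant (`evalFrom_zeroState_or_const`), which makes M_n
a left ideal. The letters a and d alone send any chosen set of states to 0 and fix the rest
(`realized_restrict`). With e this yields reachability and distinguishability, and so the claims
about quotients, reverse, atom count and star. The letters a, b, c, d induce every map that fixes 0
(`realized_of_zeroState_fixed`); the constants come from e and a. This settles the semigroup, and it
realizes every admissible pair (X, Y) for the atoms.

For boolean operations the two dialects exchange the roles of b and e, so a letter that resets one
automaton permutes the nonzero states of the other. One component can therefore be frozen at a
chosen acceptance value while the other stays separated (`IsDialectPair.exists_word_separating`). In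
the unrestricted case the private letters c and f send the opposite component to a sink without
changing acceptance in their own. -/

namespace SuffixConvex

/-! ### Quotients, alphabets and complexity -/

section Quotients

variable {α : Type*} {L : Language α}

theorem nil_mem_words : [] ∈ words L := fun _ h => absurd h List.not_mem_nil

theorem mem_words_iff {w : List α} : w ∈ words L ↔ ∀ a ∈ w, a ∈ letters L := Iff.rfl

theorem append_mem_words_iff {x y : List α} : x ++ y ∈ words L ↔ x ∈ words L ∧ y ∈ words L := by
  simp only [mem_words_iff, List.mem_append]
  exact ⟨fun h => ⟨fun a ha => h a (.inl ha), fun a ha => h a (.inr ha)⟩,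
    fun h a ha => ha.elim (h.1 a) (h.2 a)⟩

theorem mem_words_of_mem {w : List α} (h : w ∈ L) : w ∈ words L := fun _ ha => ⟨w, h, ha⟩

theorem words_mono {K : Language α} (h : letters K ⊆ letters L) {w : List α} (hw : w ∈ words K) :
    w ∈ words L := fun a ha => h (hw a ha)

theorem mem_words_of_mem_leftQuotient {w v : List α} (h : v ∈ L.leftQuotient w) : v ∈ words L :=
  (append_mem_words_iff.1 (mem_words_of_mem h)).2

theorem self_mem_quotients : L ∈ quotients L := ⟨[], nil_mem_words, rfl⟩

theorem leftQuotient_mem_quotients {K : Language α} (hK : K ∈ quotients L) {w : List α}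
    (hw : w ∈ words L) : K.leftQuotient w ∈ quotients L := by
  obtain ⟨u, hu, rfl⟩ := hK
  exact ⟨u ++ w, append_mem_words hu hw, (Language.leftQuotient_append L u w).symm⟩

theorem letters_subset_of_mem_quotients {K : Language α} (hK : K ∈ quotients L) :
    letters K ⊆ letters L := by
  obtain ⟨u, _, rfl⟩ := hK
  rintro a ⟨w, hw, ha⟩
  exact ⟨u ++ w, hw, List.mem_append_right _ ha⟩

/-- Complexity is the number of states of an accessible and reduced automaton, where only the words
over the alphabet of the language are used. -/
theorem complexity_eq_encard {X : Type*} (A : DFA α X) (R : Set X)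
    (hL : ∀ w ∈ words L, (w ∈ L ↔ A.eval w ∈ A.accept))
    (hmaps : ∀ w ∈ words L, A.eval w ∈ R)
    (hreach : ∀ x ∈ R, ∃ w ∈ words L, A.eval w = x)
    (hdist : ∀ x ∈ R, ∀ y ∈ R, (∀ v ∈ words L,
      (A.evalFrom x v ∈ A.accept ↔ A.evalFrom y v ∈ A.accept)) → x = y) :
    complexity L = R.encard := by
  -- The language accepted from a state, cut down to the alphabet of `L`: quotients are its values
  -- on `R`, and `hdist` makes it injective there.
  let g : X → Language α := fun x => {v | v ∈ words L ∧ A.evalFrom x v ∈ A.accept}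
  have hg : ∀ w ∈ words L, L.leftQuotient w = g (A.eval w) := by
    intro w hw
    ext v
    change w ++ v ∈ L ↔ v ∈ words L ∧ A.evalFrom (A.eval w) v ∈ A.accept
    constructor
    · intro h
      have hv := mem_words_of_mem_leftQuotient h
      refine ⟨hv, ?_⟩
      have := (hL _ (append_mem_words hw hv)).1 h
      rwa [DFA.eval, DFA.evalFrom_of_append] at this
    · rintro ⟨hv, h⟩
      refine (hL _ (append_mem_words hw hv)).2 ?_
      rwa [DFA.eval, DFA.evalFrom_of_append]
  have himage : quotients L = g '' R := by
    ext K
    constructor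
    · rintro ⟨w, hw, rfl⟩
      exact ⟨_, hmaps w hw, (hg w hw).symm⟩
    · rintro ⟨x, hx, rfl⟩
      obtain ⟨w, hw, rfl⟩ := hreach x hx
      exact ⟨w, hw, (hg w hw).symm⟩
  rw [complexity, himage]
  refine Set.InjOn.encard_image ?_
  intro x hx y hy hxy
  refine hdist x hx y hy fun v hv => ?_
  have : v ∈ g x ↔ v ∈ g y := by rw [hxy]
  exact ⟨fun h => (this.1 ⟨hv, h⟩).2, fun h => (this.2 ⟨hv, h⟩).2⟩

theorem complexity_quotient_le {K : Language α} (hK : K ∈ quotients L) :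
    complexity K ≤ complexity L := by
  refine Set.encard_le_encard ?_
  rintro J ⟨w, hw, rfl⟩
  exact leftQuotient_mem_quotients hK (words_mono (letters_subset_of_mem_quotients hK) hw)

end Quotients

/-! ### Upper bounds for boolean operations -/

section Boolean

variable {α : Type*} {L' L : Language α}

theorem leftQuotient_eq_zero_of_notMem_words {w : List α} (hw : w ∉ words L) :
    L.leftQuotient w = 0 := by
  ext v
  simp only [Language.mem_leftQuotient, Language.notMem_zero, iff_false]
  exact fun h => hw (append_mem_words_iff.1 (mem_words_of_mem h)).1

/-- A word over the alphabet of a combination may leave the alphabet of one operand. The empty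
language that results is the source of every "+1" in the unrestricted bounds. -/
theorem leftQuotient_mem_insert_zero (w : List α) :
    L.leftQuotient w ∈ insert 0 (quotients L) := by
  by_cases hw : w ∈ words L
  · exact .inr ⟨w, hw, rfl⟩
  · exact .inl (leftQuotient_eq_zero_of_notMem_words hw)

theorem encard_le_mul_of_subset_image2 {α β γ : Type*} {m n : ℕ} {f : α → β → γ} {A : Set α}
    {B : Set β} {C : Set γ} (hC : ∀ c ∈ C, ∃ a ∈ A, ∃ b ∈ B, f a b = c) (hA : A.encard ≤ m)
    (hB : B.encard ≤ n) : C.encard ≤ ((m * n : ℕ) : ℕ∞) := by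
  have h : C ⊆ (fun p : α × β => f p.1 p.2) '' (A ×ˢ B) := by
    intro c hc
    obtain ⟨a, ha, b, hb, rfl⟩ := hC c hc
    exact ⟨(a, b), ⟨ha, hb⟩, rfl⟩
  calc C.encard ≤ (A ×ˢ B).encard := (Set.encard_le_encard h).trans (Set.encard_image_le _ _)
    _ = A.encard * B.encard := Set.encard_prod
    _ ≤ m * n := mul_le_mul' hA hB
    _ = _ := by push_cast; rfl

theorem encard_insert_le_succ {β : Type*} {s : Set β} {n : ℕ} (x : β) (h : s.encard = n) :
    (insert x s).encard ≤ ((n + 1 : ℕ) : ℕ∞) := by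
  refine (Set.encard_insert_le s x).trans ?_
  rw [h]; push_cast; rfl

variable {op : Language α → Language α → Language α} {m n : ℕ}

theorem complexity_op_le (hop : ∀ w, (op L' L).leftQuotient w =
      op (L'.leftQuotient w) (L.leftQuotient w))
    (hm : complexity L' = m) (hn : complexity L = n) :
    complexity (op L' L) ≤ (((m + 1) * (n + 1) : ℕ) : ℕ∞) := by
  refine encard_le_mul_of_subset_image2 (f := op) ?_ (encard_insert_le_succ 0 hm)
    (encard_insert_le_succ 0 hn)
  rintro _ ⟨w, _, rfl⟩
  exact ⟨_, leftQuotient_mem_insert_zero w, _, leftQuotient_mem_insert_zero w, (hop w).symm⟩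

theorem complexity_op_le_of_letters_left (hop : ∀ w, (op L' L).leftQuotient w =
      op (L'.leftQuotient w) (L.leftQuotient w)) (hl : letters (op L' L) ⊆ letters L')
    (hm : complexity L' = m) (hn : complexity L = n) :
    complexity (op L' L) ≤ ((m * (n + 1) : ℕ) : ℕ∞) := by
  refine encard_le_mul_of_subset_image2 (f := op) ?_ hm.le (encard_insert_le_succ 0 hn)
  rintro _ ⟨w, hw, rfl⟩
  exact ⟨_, ⟨w, words_mono hl hw, rfl⟩, _, leftQuotient_mem_insert_zero w, (hop w).symm⟩

theorem complexity_op_le_of_letters (hop : ∀ w, (op L' L).leftQuotient w =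
      op (L'.leftQuotient w) (L.leftQuotient w)) (hl' : letters (op L' L) ⊆ letters L')
    (hl : letters (op L' L) ⊆ letters L)
    (hm : complexity L' = m) (hn : complexity L = n) :
    complexity (op L' L) ≤ ((m * n : ℕ) : ℕ∞) := by
  refine encard_le_mul_of_subset_image2 (f := op) ?_ hm.le hn.le
  rintro _ ⟨w, hw, rfl⟩
  exact ⟨_, ⟨w, words_mono hl' hw, rfl⟩, _, ⟨w, words_mono hl hw, rfl⟩, (hop w).symm⟩

theorem mem_sup_iff {x : List α} : x ∈ L' ⊔ L ↔ x ∈ L' ∨ x ∈ L := Iff.rfl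
theorem mem_inf_iff {x : List α} : x ∈ L' ⊓ L ↔ x ∈ L' ∧ x ∈ L := Iff.rfl
theorem mem_sdiff_iff {x : List α} : x ∈ L' \ L ↔ x ∈ L' ∧ x ∉ L := Iff.rfl
theorem mem_symmDiff_iff {x : List α} :
    x ∈ L' ∆ L ↔ (x ∈ L' ∧ x ∉ L) ∨ (x ∈ L ∧ x ∉ L') := Iff.rfl

theorem letters_op_subset (hop : ∀ x ∈ op L' L, x ∈ L' ∨ x ∈ L) :
    letters (op L' L) ⊆ letters L' ∪ letters L := by
  rintro a ⟨w, hw, ha⟩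
  exact (hop w hw).imp (fun h => ⟨w, h, ha⟩) (fun h => ⟨w, h, ha⟩)

theorem letters_mono {K : Language α} (h : ∀ x ∈ K, x ∈ L) : letters K ⊆ letters L := by
  rintro a ⟨w, hw, ha⟩
  exact ⟨w, h w hw, ha⟩

/-- The bounds differ only in which alphabets are forced. Words of an intersection use letters of
both operands, words of a difference use letters of `L'`, and words of a union or symmetric
difference may leave either alphabet. -/
theorem boolean_upper_bounds (hm : complexity L' = m) (hn : complexity L = n) :
    (letters L' = letters L →
      complexity (L' ⊔ L) ≤ ((m * n : ℕ) : ℕ∞) ∧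
      complexity (L' ∆ L) ≤ ((m * n : ℕ) : ℕ∞) ∧
      complexity (L' \ L) ≤ ((m * n : ℕ) : ℕ∞) ∧
      complexity (L' ⊓ L) ≤ ((m * n : ℕ) : ℕ∞)) ∧
    complexity (L' ⊔ L) ≤ (((m + 1) * (n + 1) : ℕ) : ℕ∞) ∧
    complexity (L' ∆ L) ≤ (((m + 1) * (n + 1) : ℕ) : ℕ∞) ∧
    complexity (L' \ L) ≤ ((m * n + m : ℕ) : ℕ∞) ∧
    complexity (L' ⊓ L) ≤ ((m * n : ℕ) : ℕ∞) := by
  have hinf : complexity (L' ⊓ L) ≤ ((m * n : ℕ) : ℕ∞) :=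
    complexity_op_le_of_letters (op := (· ⊓ ·)) (fun _ => rfl) (letters_mono fun _ h => h.1)
      (letters_mono fun _ h => h.2) hm hn
  refine ⟨fun hl => ?_, complexity_op_le (op := (· ⊔ ·)) (fun _ => rfl) hm hn,
    complexity_op_le (op := (· ∆ ·)) (fun _ => rfl) hm hn, ?_, hinf⟩
  · have key : ∀ op : Language α → Language α → Language α, (∀ x ∈ op L' L, x ∈ L' ∨ x ∈ L) →
        (∀ w, (op L' L).leftQuotient w = op (L'.leftQuotient w) (L.leftQuotient w)) →
        complexity (op L' L) ≤ ((m * n : ℕ) : ℕ∞) := by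
      intro op h1 h2
      have h := letters_op_subset h1
      refine complexity_op_le_of_letters h2 ?_ ?_ hm hn
      · rwa [← hl, Set.union_self] at h
      · rwa [hl, Set.union_self] at h
    exact ⟨key (· ⊔ ·) (fun _ h => h) fun _ => rfl,
      key (· ∆ ·) (fun _ h => h.imp And.left And.left) fun _ => rfl,
      key (· \ ·) (fun _ h => .inl h.1) fun _ => rfl, hinf⟩
  · have := complexity_op_le_of_letters_left (op := (· \ ·)) (fun _ => rfl)
      (letters_mono fun _ h => h.1) hm hn
    rwa [mul_add, mul_one] at this

end Boolean

/-! ### Left ideals: star, reverse and number of atoms -/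

section LeftIdeal

variable {α : Type*} {L : Language α} {n : ℕ}

theorem IsLeftIdeal.append_mem (h : IsLeftIdeal L) {u x : List α} (hu : u ∈ words L)
    (hx : x ∈ L) : u ++ x ∈ L := by
  rw [h.2]
  exact Language.append_mem_mul hu hx

theorem IsLeftIdeal.subset_quotient (h : IsLeftIdeal L) {K : Language α} (hK : K ∈ quotients L)
    {x : List α} (hx : x ∈ L) : x ∈ K := by
  obtain ⟨w, hw, rfl⟩ := hK
  exact h.append_mem hw hx

theorem isLeftIdeal_of_append_mem (h0 : ∃ x, x ∈ L)
    (h : ∀ u ∈ words L, ∀ x ∈ L, u ++ x ∈ L) : IsLeftIdeal L := by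
  refine ⟨?_, ?_⟩
  · rintro rfl
    obtain ⟨x, hx⟩ := h0
    exact hx
  · ext x
    rw [Language.mem_mul]
    constructor
    · exact fun hx => ⟨[], nil_mem_words, x, hx, rfl⟩
    · rintro ⟨u, hu, v, hv, rfl⟩
      exact h u hu v hv

/-- In a product of words of `L`, the factors in front of a word of `L` are merely a prefix over the
alphabet, which a left ideal absorbs. -/
theorem IsLeftIdeal.mem_kstar_iff (h : IsLeftIdeal L) {x : List α} :
    x ∈ L∗ ↔ x = [] ∨ x ∈ L := by
  rw [Language.mem_kstar]
  constructor
  · rintro ⟨l, rfl, hl⟩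
    induction l with
    | nil => exact .inl rfl
    | cons y l ih =>
      right
      rw [List.flatten_cons]
      have hy := hl y (by simp)
      rcases ih fun z hz => hl z (by simp [hz]) with h1 | h1
      · rwa [h1, List.append_nil]
      · exact h.append_mem (mem_words_of_mem hy) h1
  · rintro (rfl | hx)
    · exact ⟨[], rfl, by simp⟩
    · exact ⟨[x], by simp, by simpa using hx⟩

theorem IsLeftIdeal.letters_kstar (h : IsLeftIdeal L) : letters L∗ = letters L := by
  ext a
  constructor
  · rintro ⟨w, hw, ha⟩
    rcases h.mem_kstar_iff.1 hw with rfl | hw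
    · exact absurd ha List.not_mem_nil
    · exact ⟨w, hw, ha⟩
  · rintro ⟨w, hw, ha⟩
    exact ⟨w, h.mem_kstar_iff.2 (.inr hw), ha⟩

theorem IsLeftIdeal.words_kstar (h : IsLeftIdeal L) : words L∗ = words L := by
  ext w
  rw [mem_words_iff, mem_words_iff, h.letters_kstar]

theorem IsLeftIdeal.leftQuotient_kstar (h : IsLeftIdeal L) {w : List α} (hw : w ≠ []) :
    L∗.leftQuotient w = L.leftQuotient w := by
  ext x
  rw [Language.mem_leftQuotient, Language.mem_leftQuotient, h.mem_kstar_iff]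
  simp [hw]

theorem IsLeftIdeal.complexity_kstar_le (h : IsLeftIdeal L) (hn : complexity L = n) :
    complexity L∗ ≤ ((n + 1 : ℕ) : ℕ∞) := by
  refine le_trans (Set.encard_le_encard ?_) (encard_insert_le_succ L∗ hn)
  rintro _ ⟨w, hw, rfl⟩
  rcases eq_or_ne w [] with rfl | hw0
  · exact .inl rfl
  · rw [h.words_kstar] at hw
    exact .inr ⟨w, hw, h.leftQuotient_kstar hw0⟩

/-- The sets of quotients of `L` that contain a given word. -/
def containingSets (L : Language α) : Set (Set (Language α)) :=
  {S | ∃ w ∈ words L, S = {K | K ∈ quotients L ∧ w ∈ K}}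

/-- The left congruence only records in which quotients a word lies, so an atom and its set of
quotients determine each other. -/
theorem encard_atoms (L : Language α) : (atoms L).encard = (containingSets L).encard := by
  let g : Set (Language α) → Language α := fun S => {y | y ∈ words L ∧
    {K | K ∈ quotients L ∧ y ∈ K} = S}
  have hg : ∀ w ∈ words L, g {K | K ∈ quotients L ∧ w ∈ K} =
      {y | y ∈ words L ∧ ∀ u ∈ words L, (u ++ w ∈ L ↔ u ++ y ∈ L)} := by
    intro w _
    ext y
    refine and_congr_right fun _ => ⟨fun h u hu => ?_, fun h => ?_⟩
    · have := (Set.ext_iff.1 h) (L.leftQuotient u)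
      have hq : L.leftQuotient u ∈ quotients L := ⟨u, hu, rfl⟩
      exact (by simpa [hq] using this : y ∈ L.leftQuotient u ↔ w ∈ L.leftQuotient u).symm
    · ext K
      refine and_congr_right ?_
      rintro ⟨u, hu, rfl⟩
      exact (h u hu).symm
  have himage : atoms L = g '' containingSets L := by
    ext A
    constructor
    · rintro ⟨w, hw, rfl⟩
      exact ⟨_, ⟨w, hw, rfl⟩, hg w hw⟩
    · rintro ⟨_, ⟨w, hw, rfl⟩, rfl⟩
      exact ⟨w, hw, hg w hw⟩
  rw [himage]
  refine Set.InjOn.encard_image ?_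
  rintro _ ⟨w, hw, rfl⟩ S _ h
  have : w ∈ g {K | K ∈ quotients L ∧ w ∈ K} := ⟨hw, rfl⟩
  rw [h] at this
  exact this.2

theorem letters_reverse : letters L.reverse = letters L := by
  ext a
  constructor
  · rintro ⟨w, hw, ha⟩
    exact ⟨w.reverse, hw, by simpa using ha⟩
  · rintro ⟨w, hw, ha⟩
    exact ⟨w.reverse, by simpa [Language.mem_reverse] using hw, by simpa using ha⟩

theorem reverse_mem_words {w : List α} : w.reverse ∈ words L ↔ w ∈ words L := by
  simp [mem_words_iff]

/-- A word `y` lies in the quotient of the reverse by the reversal of `w` iff `w` lies in the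
quotient of `L` by the reversal of `y`. Hence that quotient amounts to the set of quotients of `L`
containing `w`. -/
theorem complexity_reverse (L : Language α) :
    complexity L.reverse = (containingSets L).encard := by
  let g : Set (Language α) → Language α := fun S => {y | y ∈ words L ∧
    L.leftQuotient y.reverse ∈ S}
  have hword : ∀ w, w ∈ words L.reverse ↔ w ∈ words L := fun w => by
    rw [mem_words_iff, mem_words_iff, letters_reverse]
  have hg : ∀ w ∈ words L, g {K | K ∈ quotients L ∧ w ∈ K} =
      L.reverse.leftQuotient w.reverse := by
    intro w _
    ext y
    rw [Language.mem_leftQuotient, Language.mem_reverse, List.reverse_append, List.reverse_reverse]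
    constructor
    · rintro ⟨_, _, h⟩
      exact h
    · intro h
      have hy := (append_mem_words_iff.1 (mem_words_of_mem h)).1
      exact ⟨reverse_mem_words.1 hy, ⟨_, hy, rfl⟩, h⟩
  have himage : quotients L.reverse = g '' containingSets L := by
    ext A
    constructor
    · rintro ⟨w, hw, rfl⟩
      have hw' := reverse_mem_words.2 ((hword w).1 hw)
      exact ⟨_, ⟨_, hw', rfl⟩, by rw [hg _ hw', List.reverse_reverse]⟩
    · rintro ⟨_, ⟨w, hw, rfl⟩, rfl⟩
      exact ⟨w.reverse, (hword _).2 (reverse_mem_words.2 hw), hg w hw⟩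
  rw [complexity, himage]
  refine Set.InjOn.encard_image ?_
  rintro _ ⟨w, hw, rfl⟩ _ ⟨v, hv, rfl⟩ h
  ext K
  refine and_congr_right ?_
  rintro ⟨u, hu, rfl⟩
  have hq : L.leftQuotient u ∈ quotients L := ⟨u, hu, rfl⟩
  have : u.reverse ∈ g {K | K ∈ quotients L ∧ w ∈ K} ↔
      u.reverse ∈ g {K | K ∈ quotients L ∧ v ∈ K} := by rw [h]
  have key : ∀ z, (u.reverse ∈ g {K | K ∈ quotients L ∧ z ∈ K} ↔ z ∈ L.leftQuotient u) := by
    intro z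
    change (u.reverse ∈ words L ∧ L.leftQuotient u.reverse.reverse ∈ quotients L ∧
      z ∈ L.leftQuotient u.reverse.reverse) ↔ _
    rw [List.reverse_reverse]
    exact ⟨fun h => h.2.2, fun h => ⟨reverse_mem_words.2 hu, hq, h⟩⟩
  rwa [key, key] at this

theorem IsLeftIdeal.encard_containingSets_le (h : IsLeftIdeal L) (hn : complexity L = n) :
    (containingSets L).encard ≤ ((2 ^ (n - 1) + 1 : ℕ) : ℕ∞) := by
  have hfin : (quotients L).Finite := Set.finite_of_encard_eq_coe hn
  have hcard : (quotients L).ncard = n := by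
    have := hfin.cast_ncard_eq
    rw [complexity] at hn
    rw [hn] at this
    exact_mod_cast this
  -- A set that contains `L` must contain all quotients, since `L` is the least one.
  have hsub : containingSets L ⊆ insert (quotients L) (𝒫 (quotients L \ {L})) := by
    rintro _ ⟨w, hw, rfl⟩
    by_cases hwL : w ∈ L
    · left
      ext K
      exact ⟨fun hK => hK.1, fun hK => ⟨hK, h.subset_quotient hK hwL⟩⟩
    · right
      rintro K ⟨hK, hwK⟩
      refine ⟨hK, ?_⟩
      rintro rfl
      exact hwL hwK
  have hpow : (𝒫 (quotients L \ {L})).encard = ((2 ^ (n - 1) : ℕ) : ℕ∞) := by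
    have hfin' : (𝒫 (quotients L \ {L})).Finite := hfin.sdiff.finite_subsets
    rw [← hfin'.cast_ncard_eq, Set.ncard_powerset _ hfin.sdiff,
      Set.ncard_sdiff_singleton_of_mem self_mem_quotients, hcard]
  refine (Set.encard_le_encard hsub).trans ((Set.encard_insert_le _ _).trans ?_)
  rw [hpow]
  push_cast
  rfl

end LeftIdeal

/-! ### Counting monotone self-maps of a finite poset -/

section MonotoneMaps

/-- The first three terms of the binomial expansion of (u+1)^m, multiplied by 2u² to avoid fractions
and the exponent m-2. -/
theorem two_mul_sq_mul_succ_pow_ge (u m : ℕ) :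
    u ^ m * (2 * u ^ 2 + 2 * m * u + m * (m - 1 : ℕ)) ≤ 2 * u ^ 2 * (u + 1) ^ m := by
  induction m with
  | zero => simp
  | succ m ih =>
    have h1 : u ^ m * (2 * u ^ 2 + 2 * m * u + m * (m - 1 : ℕ)) * (u + 1) ≤
        2 * u ^ 2 * (u + 1) ^ (m + 1) := by
      rw [pow_succ (u + 1), ← mul_assoc]
      exact Nat.mul_le_mul_right _ ih
    refine le_trans ?_ h1
    have h2 : m * (m - 1) + m = m * m := by
      cases m with
      | zero => rfl
      | succ k => simp; ring
    rw [pow_succ, mul_assoc, mul_assoc (u ^ m)]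
    refine Nat.mul_le_mul_left _ ?_
    rw [Nat.add_sub_cancel]
    nlinarith [h2, Nat.zero_le (m * (m - 1)), congrArg (· * u) h2]

/-- By the three-term estimate it suffices that 2u² ≤ 2mu + m(m-1). For u ≤ m+1 this follows from
2(m+1) ≤ m(m-1), which holds from m = 4 on. -/
theorem two_mul_pow_le_succ_pow {u m : ℕ} (hm : 4 ≤ m) (hu : u ≤ m + 1) :
    2 * u ^ m ≤ (u + 1) ^ m := by
  rcases Nat.eq_zero_or_pos u with rfl | hpos
  · simp [show m ≠ 0 by omega]
  have h := two_mul_sq_mul_succ_pow_ge u m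
  obtain ⟨k, rfl⟩ : ∃ k, m = k + 4 := ⟨m - 4, by omega⟩
  have h2 : 2 * u ^ 2 * (2 * u ^ (k + 4)) ≤ 2 * u ^ 2 * (u + 1) ^ (k + 4) := by
    refine le_trans ?_ h
    have h3 : 4 * u ^ 2 ≤ 2 * u ^ 2 + 2 * (k + 4) * u + (k + 4) * (k + 4 - 1 : ℕ) := by
      have : k + 4 - 1 = k + 3 := by omega
      rw [this]
      nlinarith [Nat.mul_le_mul_left u hu]
    calc 2 * u ^ 2 * (2 * u ^ (k + 4)) = u ^ (k + 4) * (4 * u ^ 2) := by ring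
      _ ≤ _ := Nat.mul_le_mul_left _ (by exact_mod_cast h3)
  exact Nat.le_of_mul_le_mul_left h2 (by positivity)

theorem sum_succ_mul_pow_le {m k : ℕ} (hm : 4 ≤ m) (hk : k ≤ m + 1) :
    ∑ i ∈ Finset.range k, (i + 2) * (i + 1) ^ m ≤ k * (k + 1) ^ m := by
  induction k with
  | zero => simp
  | succ k ih =>
    rw [Finset.sum_range_succ]
    have h1 := ih (by omega)
    have h2 := Nat.mul_le_mul_left (k + 1) (two_mul_pow_le_succ_pow (u := k + 1) hm hk)
    calc _ ≤ k * (k + 1) ^ m + (k + 2) * (k + 1) ^ m := Nat.add_le_add_right h1 _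
      _ = (k + 1) * (2 * (k + 1) ^ m) := by ring
      _ ≤ _ := h2

theorem sum_succ_mul_pow_le_two_mul {n : ℕ} (hn : 4 ≤ n) :
    ∑ i ∈ Finset.range n, (i + 2) * (i + 1) ^ (n - 2) ≤ 2 * (n ^ (n - 1) + n - 1) := by
  -- The general estimate needs n-2 ≥ 4. For n = 4 the sum is 130, which exceeds 2·4³ = 128, so the
  -- summand n-1 on the right is really used there.
  rcases Nat.lt_or_ge n 6 with h | h
  · interval_cases n <;> decide
  · obtain ⟨m, rfl⟩ : ∃ m, n = m + 2 := ⟨n - 2, by omega⟩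
    have h1 := sum_succ_mul_pow_le (m := m) (k := m + 1) (by omega) le_rfl
    rw [Nat.add_sub_cancel, Finset.sum_range_succ]
    have h2 : m + 2 - 1 = m + 1 := by omega
    rw [h2]
    have h3 : (m + 1) * (m + 1 + 1) ^ m + (m + 1 + 2) * (m + 1 + 1) ^ m =
      2 * (m + 2) ^ (m + 1) := by ring
    omega

/-- Swapping turns the pairs with `≤` into those with `≥`. The two sets together have at most |S|²
elements and meet only in the diagonal, by antisymmetry. -/
theorem two_mul_card_le_pairs {P : Type*} [PartialOrder P] (S : Finset P) [DecidableEq P]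
    [DecidableLE P] :
    2 * ((S ×ˢ S).filter fun x => x.1 ≤ x.2).card ≤ (S.card + 1) * S.card := by
  set A := (S ×ˢ S).filter fun x => x.1 ≤ x.2 with hA
  set B := (S ×ˢ S).filter fun x => x.2 ≤ x.1 with hB
  have hAB : A.card = B.card := by
    refine Finset.card_bij (fun x _ => x.swap) ?_ (fun x _ y _ h => Prod.swap_injective h) ?_
    · intro x hx
      simp only [hA, hB, Finset.mem_filter, Finset.mem_product, Prod.fst_swap, Prod.snd_swap]
        at hx ⊢
      tauto
    · intro x hx
      refine ⟨x.swap, ?_, Prod.swap_swap x⟩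
      simp only [hA, hB, Finset.mem_filter, Finset.mem_product, Prod.fst_swap, Prod.snd_swap]
        at hx ⊢
      tauto
  have h1 : (A ∪ B).card ≤ S.card * S.card := by
    rw [← Finset.card_product]
    exact Finset.card_le_card
      (Finset.union_subset (Finset.filter_subset _ _) (Finset.filter_subset _ _))
  have h2 : (A ∩ B).card ≤ S.card := by
    refine Finset.card_le_card_of_injOn Prod.fst ?_ ?_
    · intro x hx
      simp only [hA, hB, Finset.coe_inter, Finset.coe_filter, Finset.mem_product, Set.mem_inter_iff,
        Set.mem_ofPred_eq] at hx
      exact hx.1.1.1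
    · intro x hx y hy hxy
      simp only [hA, hB, Finset.coe_inter, Finset.coe_filter, Finset.mem_product, Set.mem_inter_iff,
        Set.mem_ofPred_eq] at hx hy
      have ex := le_antisymm hx.1.2 hx.2.2
      have ey := le_antisymm hy.1.2 hy.2.2
      exact Prod.ext hxy (by rw [← ex, ← ey, hxy])
  have h3 := Finset.card_union_add_card_inter A B
  nlinarith

variable {P : Type*} [Fintype P]

theorem ncard_setOf_apply_eq (b c : P) :
    {f : P → P | f b = c}.ncard = Fintype.card P ^ (Fintype.card P - 1) := by
  classical
  have : {f : P → P | f b = c} =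
      ↑(Fintype.piFinset fun x : P => if x = b then {c} else (Finset.univ : Finset P)) := by
    ext f
    simp only [Set.mem_ofPred_eq, Finset.mem_coe, Fintype.mem_piFinset]
    constructor
    · rintro h x
      split_ifs with hx
      · simp [hx, h]
      · simp
    · intro h
      simpa using h b
  rw [this, Set.ncard_coe_finset, Fintype.card_piFinset,
    ← Finset.mul_prod_erase _ _ (Finset.mem_univ b)]
  rw [Finset.prod_congr rfl (g := fun _ => Fintype.card P)]
  · simp [Finset.card_erase_of_mem]
  · intro x hx
    simp [(Finset.mem_erase.1 hx).1]

/-- This is the extremal family. It bounds the monotone maps of a poset that is an antichain above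
its bottom, and it equals the set of maps induced by words in E_n. -/
theorem ncard_fixing_or_const (b : P) (h1 : 1 < Fintype.card P) :
    ({f : P → P | f b = b} ∪ Function.const P '' {b}ᶜ).ncard =
      Fintype.card P ^ (Fintype.card P - 1) + Fintype.card P - 1 := by
  classical
  rw [Set.ncard_union_eq, ncard_setOf_apply_eq, Set.ncard_image_of_injective, Set.ncard_compl]
  · simp
    omega
  · have : Nonempty P := ⟨b⟩
    exact Function.const_injective
  · rw [Set.disjoint_left]
    rintro f hf ⟨q, hq, rfl⟩
    exact hq hf

variable [PartialOrder P]

-- All values of such a map lie in the up-set of `p`. It is determined by the comparable pair of its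
-- values at `x < y` and by its values at the remaining n-3 elements; comparability saves almost a
-- factor 2.
open Classical in
theorem two_mul_card_monotone_bot_eq_le [OrderBot P] {x y : P} (hx : x ≠ ⊥) (hxy : x < y) (p : P)
    (F : Finset (P → P)) (hF : ∀ f ∈ F, Monotone f ∧ f ⊥ = p) :
    2 * F.card ≤ ((Finset.univ.filter (p ≤ ·)).card + 1) *
      (Finset.univ.filter (p ≤ ·)).card ^ (Fintype.card P - 2) := by
  set U := Finset.univ.filter (p ≤ ·) with hU
  have hT : ({⊥, x, y} : Finset P).card = 3 :=
    Finset.card_eq_three.2 ⟨⊥, x, y, hx.symm, (bot_le.trans_lt hxy).ne, hxy.ne, rfl⟩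
  have h3 : 3 ≤ Fintype.card P := hT ▸ Finset.card_le_univ _
  have hcard : F.card ≤ (((U ×ˢ U).filter fun z => z.1 ≤ z.2) ×ˢ
      Fintype.piFinset fun z : P => if z ∈ ({⊥, x, y} : Finset P) then {p} else U).card := by
    refine Finset.card_le_card_of_injOn
      (fun f => ((f x, f y), fun z => if z ∈ ({⊥, x, y} : Finset P) then p else f z)) ?_ ?_
    · intro f hf
      obtain ⟨hm, hb⟩ := hF f hf
      have hp : ∀ z, f z ∈ U := fun z => by
        simpa [hU, ← hb] using hm bot_le
      simp only [Finset.coe_product, Set.mem_prod, Finset.mem_coe, Finset.mem_filter,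
        Finset.mem_product, Fintype.mem_piFinset]
      refine ⟨⟨⟨hp x, hp y⟩, hm hxy.le⟩, fun z => ?_⟩
      split_ifs
      · simp
      · exact hp z
    · intro f hf g hg hfg
      simp only [Prod.mk.injEq] at hfg
      funext z
      by_cases hz : z ∈ ({⊥, x, y} : Finset P)
      · simp only [Finset.mem_insert, Finset.mem_singleton] at hz
        rcases hz with rfl | rfl | rfl
        · rw [(hF f hf).2, (hF g hg).2]
        · exact hfg.1.1
        · exact hfg.1.2
      · have := congrFun hfg.2 z
        simpa [hz] using this
  have hprod : (Fintype.piFinset fun z : P =>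
      if z ∈ ({⊥, x, y} : Finset P) then {p} else U).card = U.card ^ (Fintype.card P - 3) := by
    rw [Fintype.card_piFinset]
    simp only [apply_ite Finset.card, Finset.card_singleton]
    rw [Finset.prod_ite, Finset.prod_const_one, one_mul, Finset.prod_const,
      Finset.filter_not, Finset.filter_mem_eq_inter, Finset.univ_inter,
      Finset.card_sdiff_of_subset (Finset.subset_univ _), hT, Finset.card_univ]
  rw [Finset.card_product, hprod] at hcard
  have hpairs := two_mul_card_le_pairs U
  calc 2 * F.card ≤ (2 * ((U ×ˢ U).filter fun z => z.1 ≤ z.2).card) *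
        U.card ^ (Fintype.card P - 3) := by rw [mul_assoc]; exact Nat.mul_le_mul_left 2 hcard
    _ ≤ ((U.card + 1) * U.card) * U.card ^ (Fintype.card P - 3) := Nat.mul_le_mul_right _ hpairs
    _ = _ := by
      rw [mul_assoc, ← pow_succ', show Fintype.card P - 3 + 1 = Fintype.card P - 2 by omega]

-- Number the elements along a linear extension: the up-set of the element at position i lies within
-- the positions from i on.
open Classical in
theorem sum_card_Ici_le {g : ℕ → ℕ} (hg : Monotone g) :
    ∑ p : P, g (Finset.univ.filter (p ≤ ·)).card ≤
      ∑ i ∈ Finset.range (Fintype.card P), g (i + 1) := by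
  let _ : Fintype (LinearExtension P) := inferInstanceAs (Fintype P)
  let e : P ≃ Fin (Fintype.card P) :=
    (Equiv.refl P : P ≃ LinearExtension P).trans
      (monoEquivOfFin (LinearExtension P) (k := Fintype.card P) rfl).symm.toEquiv
  have he : Monotone e := fun a b hab =>
    (monoEquivOfFin (LinearExtension P) (k := Fintype.card P) rfl).symm.monotone
      ((toLinearExtension (α := P)).monotone hab)
  have h1 : ∀ p, (Finset.univ.filter (p ≤ ·)).card ≤ Fintype.card P - (e p : ℕ) := by
    intro p
    rw [← Fin.card_Ici]
    refine Finset.card_le_card_of_injOn e ?_ e.injective.injOn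
    intro q hq
    simp only [Finset.coe_filter, Finset.mem_univ, true_and, Set.mem_ofPred_eq] at hq
    simpa using he hq
  calc ∑ p : P, g (Finset.univ.filter (p ≤ ·)).card
      ≤ ∑ p : P, g (Fintype.card P - (e p : ℕ)) := Finset.sum_le_sum fun p _ => hg (h1 p)
    _ = ∑ i : Fin (Fintype.card P), g (Fintype.card P - (i : ℕ)) :=
        Equiv.sum_comp e fun i => g (Fintype.card P - (i : ℕ))
    _ = ∑ i ∈ Finset.range (Fintype.card P), g (Fintype.card P - i) :=
        Fin.sum_univ_eq_sum_range (fun i => g (Fintype.card P - i)) _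
    _ = ∑ i ∈ Finset.range (Fintype.card P), g (i + 1) := by
        rw [← Finset.sum_range_reflect]
        refine Finset.sum_congr rfl fun i hi => ?_
        rw [Finset.mem_range] at hi
        congr 1
        omega

/-- A finite poset with a least element and `n ≥ 4` elements has at most `n ^ (n - 1) + n - 1`
monotone self-maps. -/
theorem ncard_monotone_le [OrderBot P] (h4 : 4 ≤ Fintype.card P) :
    {f : P → P | Monotone f}.ncard ≤
      Fintype.card P ^ (Fintype.card P - 1) + Fintype.card P - 1 := by
  classical
  -- In the antichain case f ⊥ ≠ ⊥ forces f to be constant, as nothing lies strictly above f ⊥.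
  by_cases hanti : ∀ x y : P, x ≠ ⊥ → x ≤ y → x = y
  · rw [← ncard_fixing_or_const (⊥ : P) (by omega)]
    refine Set.ncard_le_ncard ?_ (Set.toFinite _)
    intro f hf
    by_cases hb : f ⊥ = ⊥
    · exact .inl hb
    · exact .inr ⟨f ⊥, hb, funext fun x => hanti _ _ hb (hf bot_le)⟩
  · push Not at hanti
    obtain ⟨x, y, hx, hxy, hne⟩ := hanti
    have hlt := lt_of_le_of_ne hxy hne
    set F : Finset (P → P) := Finset.univ.filter Monotone with hF
    have hFc : {f : P → P | Monotone f}.ncard = F.card := by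
      rw [← Set.ncard_coe_finset]
      congr 1
      ext f
      simp [hF]
    rw [hFc]
    have hsum : F.card = ∑ p : P, (F.filter fun f => f ⊥ = p).card :=
      Finset.card_eq_sum_card_fiberwise fun f _ => Finset.mem_coe.2 (Finset.mem_univ (f ⊥))
    have h2 : 2 * F.card ≤ ∑ p : P, ((Finset.univ.filter (p ≤ ·)).card + 1) *
        (Finset.univ.filter (p ≤ ·)).card ^ (Fintype.card P - 2) := by
      rw [hsum, Finset.mul_sum]
      refine Finset.sum_le_sum fun p _ => two_mul_card_monotone_bot_eq_le hx hlt p _ ?_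
      intro f hf
      simpa [hF] using hf
    have h3 := sum_card_Ici_le (P := P) (g := fun u => (u + 1) * u ^ (Fintype.card P - 2))
      (fun a b hab => Nat.mul_le_mul (by omega) (Nat.pow_le_pow_left hab _))
    have h4 := sum_succ_mul_pow_le_two_mul h4
    simp only [add_assoc, Nat.reduceAdd] at h3
    omega

end MonotoneMaps

/-! ### The bound for the syntactic semigroup -/

section SyntacticSemigroup

variable {α : Type*} {L : Language α} {n : ℕ}

/-- The transformation of the set of quotients that is induced by a word. -/
def quotientMap (w : NonemptyWord L) (K : quotients L) : quotients L :=
  ⟨K.1.leftQuotient w.1, leftQuotient_mem_quotients K.2 w.2.2⟩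

/-- The syntactic semigroup acts faithfully on the quotients, so it can be counted as a set of
transformations. -/
theorem quotientMap_eq_iff {x y : NonemptyWord L} :
    quotientMap x = quotientMap y ↔ (myhill L).r x y := by
  constructor
  · intro h w hw z _
    have h1 : (L.leftQuotient w).leftQuotient x.1 = (L.leftQuotient w).leftQuotient y.1 :=
      congrArg Subtype.val (congrFun h ⟨L.leftQuotient w, w, hw, rfl⟩)
    rw [← Language.leftQuotient_append, ← Language.leftQuotient_append] at h1
    exact Set.ext_iff.1 h1 z
  · intro h
    funext K
    obtain ⟨_, w, hw, rfl⟩ := K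
    refine Subtype.ext ?_
    change (L.leftQuotient w).leftQuotient x.1 = (L.leftQuotient w).leftQuotient y.1
    rw [← Language.leftQuotient_append, ← Language.leftQuotient_append]
    ext z
    exact ⟨fun hz => (h w hw z (mem_words_of_mem_leftQuotient hz)).1 hz,
      fun hz => (h w hw z (mem_words_of_mem_leftQuotient hz)).2 hz⟩

theorem card_syntacticSemigroup (L : Language α) :
    ENat.card (SyntacticSemigroup L) =
      (Set.range (quotientMap : NonemptyWord L → quotients L → quotients L)).encard := by
  let f : SyntacticSemigroup L → quotients L → quotients L :=
    Quotient.lift quotientMap fun _ _ h => quotientMap_eq_iff.2 h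
  have hf : Function.Injective f := by
    rintro ⟨x⟩ ⟨y⟩ h
    exact Quotient.sound (quotientMap_eq_iff.1 h)
  have hr : Set.range f = Set.range (quotientMap : NonemptyWord L → _) := by
    ext t
    constructor
    · rintro ⟨⟨x⟩, rfl⟩
      exact ⟨x, rfl⟩
    · rintro ⟨x, rfl⟩
      exact ⟨Quotient.mk _ x, rfl⟩
  rw [← hr, ← Set.image_univ, hf.encard_image, Set.encard_univ]

theorem IsLeftIdeal.card_syntacticSemigroup_le (h : IsLeftIdeal L) (hn : complexity L = n)
    (h4 : 4 ≤ n) : ENat.card (SyntacticSemigroup L) ≤ ((n ^ (n - 1) + n - 1 : ℕ) : ℕ∞) := by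
  have hfin : (quotients L).Finite := Set.finite_of_encard_eq_coe hn
  have : Fintype (quotients L) := hfin.fintype
  have hcard : Fintype.card (quotients L) = n := by
    have h1 := Set.coe_fintypeCard (quotients L)
    rw [← complexity, hn] at h1
    exact_mod_cast h1
  let _ : OrderBot (quotients L) :=
    { bot := ⟨L, self_mem_quotients⟩
      bot_le := fun K _ hx => h.subset_quotient K.2 hx }
  rw [card_syntacticSemigroup]
  have hmono : Set.range (quotientMap : NonemptyWord L → quotients L → quotients L) ⊆
      {f | Monotone f} := by
    rintro _ ⟨w, rfl⟩ K K' hK x hx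
    exact hK hx
  refine (Set.encard_le_encard hmono).trans ?_
  rw [← Set.Finite.cast_ncard_eq (Set.toFinite _)]
  have := ncard_monotone_le (P := quotients L) (by omega)
  rw [hcard] at this
  exact_mod_cast this

end SyntacticSemigroup

/-! ### The combinatorial form of the atom bound -/

section DisjointPairs

variable {γ : Type*} [DecidableEq γ]

/-- The pairs of disjoint subsets of `T`, the first one of size between `1` and `s`, the second one
of size at most `t`. -/
def disjointPairs (T : Finset γ) (s t : ℕ) : Finset (Finset γ × Finset γ) :=
  (T.powerset ×ˢ T.powerset).filter fun p =>
    Disjoint p.1 p.2 ∧ (1 ≤ p.1.card ∧ p.1.card ≤ s) ∧ p.2.card ≤ t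

theorem mem_disjointPairs {T : Finset γ} {s t : ℕ} {p : Finset γ × Finset γ} :
    p ∈ disjointPairs T s t ↔ (p.1 ⊆ T ∧ p.2 ⊆ T) ∧
      Disjoint p.1 p.2 ∧ (1 ≤ p.1.card ∧ p.1.card ≤ s) ∧ p.2.card ≤ t := by
  simp [disjointPairs]

theorem card_filter_disjoint_pairs (T : Finset γ) (x y : ℕ) :
    ((T.powerset ×ˢ T.powerset).filter fun p =>
      Disjoint p.1 p.2 ∧ p.1.card = x ∧ p.2.card = y).card =
      T.card.choose x * (T.card - x).choose y := by
  have h : ((T.powerset ×ˢ T.powerset).filter fun p =>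
      Disjoint p.1 p.2 ∧ p.1.card = x ∧ p.2.card = y).card =
      ((T.powersetCard x).sigma fun X => (T \ X).powersetCard y).card := by
    refine Finset.card_nbij' (fun p => ⟨p.1, p.2⟩) (fun p => (p.1, p.2)) ?_ ?_ ?_ ?_
    · rintro ⟨X, Y⟩ h
      simp only [Finset.coe_filter, Finset.mem_product, Finset.mem_powerset,
        Set.mem_ofPred_eq] at h
      simp only [Finset.coe_sigma, Set.mem_sigma_iff, Finset.mem_coe, Finset.mem_powersetCard]
      exact ⟨⟨h.1.1, h.2.2.1⟩, Finset.subset_sdiff.2 ⟨h.1.2, h.2.1.symm⟩, h.2.2.2⟩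
    · rintro ⟨X, Y⟩ h
      simp only [Finset.coe_sigma, Set.mem_sigma_iff, Finset.mem_coe, Finset.mem_powersetCard,
        Finset.subset_sdiff] at h
      simp only [Finset.coe_filter, Finset.mem_product, Finset.mem_powerset,
        Set.mem_ofPred_eq]
      exact ⟨⟨h.1.1, h.2.1.1⟩, h.2.1.2.symm, h.1.2, h.2.2⟩
    · rintro ⟨X, Y⟩ _; rfl
    · rintro ⟨X, Y⟩ _; rfl
  rw [h, Finset.card_sigma, Finset.sum_congr rfl (g := fun _ => (T.card - x).choose y)]
  · simp
  · intro X hX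
    rw [Finset.mem_powersetCard] at hX
    rw [Finset.card_powersetCard, Finset.card_sdiff_of_subset hX.1, hX.2]

theorem card_disjointPairs (T : Finset γ) (s t : ℕ) :
    (disjointPairs T s t).card = ∑ x ∈ Finset.Icc 1 s, ∑ y ∈ Finset.Icc 1 (t + 1),
      T.card.choose x * (T.card - x).choose (y - 1) := by
  rw [← Finset.sum_product', Finset.card_eq_sum_card_fiberwise
    (f := fun p => (p.1.card, p.2.card + 1)) (t := Finset.Icc 1 s ×ˢ Finset.Icc 1 (t + 1))]
  · refine Finset.sum_congr rfl ?_
    rintro ⟨x, y⟩ hxy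
    simp only [Finset.mem_product, Finset.mem_Icc] at hxy
    rw [← card_filter_disjoint_pairs]
    congr 1
    ext p
    simp only [Finset.mem_filter, mem_disjointPairs, Finset.mem_product, Finset.mem_powerset,
      Prod.mk.injEq]
    constructor
    · rintro ⟨⟨h1, h2, h3, h4⟩, h5, h6⟩
      exact ⟨h1, h2, h5, by omega⟩
    · rintro ⟨h1, h2, h5, h6⟩
      exact ⟨⟨h1, h2, by omega, by omega⟩, h5, by omega⟩
  · intro p hp
    rw [Finset.mem_coe, mem_disjointPairs] at hp
    simp only [Finset.coe_product, Set.mem_prod, Finset.mem_coe, Finset.mem_Icc]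
    omega

/-- In the sum, y counts the second set together with one element that it need not store, whence y -
1. The leading 1 stands for the empty quotient. -/
theorem atomBound_eq_card {T : Finset γ} {n s : ℕ} (hT : T.card = n - 1) (h0 : s ≠ 0)
    (hs : s < n) : atomBound n s = 1 + (disjointPairs T s (n - s - 1)).card := by
  rw [atomBound, if_neg hs.ne, if_neg h0, card_disjointPairs, hT,
    show n - s - 1 + 1 = n - s by omega]
  congr 1
  refine Finset.sum_congr rfl fun x _ => Finset.sum_congr rfl fun y _ => ?_
  rw [Nat.sub_right_comm]

end DisjointPairs

/-! ### Upper bounds for the complexity of atoms -/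

section AtomUpperBound

variable {α : Type*} {L : Language α} {n : ℕ}

/-- The words over the alphabet of `L` that are in all languages of `X` and in none of `Y`. -/
def separated (L : Language α) (X Y : Finset (Language α)) : Language α :=
  {x | x ∈ words L ∧ (∀ K ∈ X, x ∈ K) ∧ ∀ K ∈ Y, x ∉ K}

theorem mem_separated {X Y : Finset (Language α)} {x : List α} :
    x ∈ separated L X Y ↔ x ∈ words L ∧ (∀ K ∈ X, x ∈ K) ∧ ∀ K ∈ Y, x ∉ K := Iff.rfl

theorem mem_atomOf {S : Set (Language α)} {x : List α} :
    x ∈ atomOf L S ↔ x ∈ words L ∧ ∀ K ∈ quotients L, (x ∈ K ↔ K ∈ S) := Iff.rfl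

theorem letters_atomOf_subset (S : Set (Language α)) : letters (atomOf L S) ⊆ letters L := by
  rintro a ⟨w, hw, ha⟩
  exact hw.1 a ha

theorem exists_mem_of_mem_atoms {A : Language α} (h : A ∈ atoms L) : ∃ x, x ∈ A := by
  obtain ⟨x, hx, rfl⟩ := h
  exact ⟨x, hx, fun _ _ => Iff.rfl⟩

theorem IsLeftIdeal.atomOf_quotients (h : IsLeftIdeal L) : atomOf L (quotients L) = L := by
  ext x
  rw [mem_atomOf]
  exact ⟨fun hx => (hx.2 L self_mem_quotients).2 self_mem_quotients,
    fun hx => ⟨mem_words_of_mem hx, fun K hK => ⟨fun _ => hK, fun _ => h.subset_quotient hK hx⟩⟩⟩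

theorem IsLeftIdeal.eq_quotients_of_self_mem (h : IsLeftIdeal L) {S : Set (Language α)}
    (hS : S ⊆ quotients L) (hA : atomOf L S ∈ atoms L) (hL : L ∈ S) : S = quotients L := by
  obtain ⟨x, hx⟩ := exists_mem_of_mem_atoms hA
  refine hS.antisymm fun K hK => (hx.2 K hK).1 (h.subset_quotient hK ?_)
  exact (hx.2 L self_mem_quotients).2 hL

theorem IsLeftIdeal.leftQuotient_subset (h : IsLeftIdeal L) {w : List α} {K : Language α}
    (hK : K ∈ quotients L) {x : List α} (hx : x ∈ L.leftQuotient w) : x ∈ K.leftQuotient w :=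
  h.subset_quotient hK (x := w ++ x) hx

open Classical in
theorem leftQuotient_atomOf {Q S : Finset (Language α)} (hQ : (Q : Set (Language α)) = quotients L)
    (hS : S ⊆ Q) {w : List α} (hw : w ∈ words L) :
    (atomOf L S).leftQuotient w =
      separated L (S.image (·.leftQuotient w)) ((Q \ S).image (·.leftQuotient w)) := by
  have hQ' : ∀ K, K ∈ Q ↔ K ∈ quotients L := fun K => by rw [← hQ, Finset.mem_coe]
  ext x
  rw [Language.mem_leftQuotient, mem_atomOf, mem_separated, append_mem_words_iff]
  simp only [Finset.forall_mem_image, Finset.mem_sdiff, Language.mem_leftQuotient, Finset.mem_coe,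
    ← hQ']
  constructor
  · rintro ⟨⟨_, hx⟩, h⟩
    exact ⟨hx, fun K hK => (h K (hS hK)).2 hK, fun K hK hxK => hK.2 ((h K hK.1).1 hxK)⟩
  · rintro ⟨hx, h1, h2⟩
    refine ⟨⟨hw, hx⟩, fun K hK => ⟨fun hxK => ?_, fun hxK => h1 hxK⟩⟩
    by_contra hKS
    exact h2 ⟨hK, hKS⟩ hxK

theorem complexity_le_card_of_subset_image {A : Language α} {ι : Type*} (F : Finset ι)
    (dec : ι → Language α) (h : ∀ w ∈ words A, ∃ i ∈ F, A.leftQuotient w = dec i) :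
    complexity A ≤ (F.card : ℕ∞) := by
  have hsub : quotients A ⊆ dec '' F := by
    rintro _ ⟨w, hw, rfl⟩
    obtain ⟨i, hi, e⟩ := h w hw
    exact ⟨i, hi, e.symm⟩
  refine (Set.encard_le_encard hsub).trans ((Set.encard_image_le _ _).trans ?_)
  rw [Set.encard_coe_eq_coe_finsetCard]

open Classical in
theorem complexity_le_card_add_one {A : Language α} {ι : Type*} (F : Finset ι)
    (dec : ι → Language α)
    (h : ∀ w ∈ words A, (∃ x, x ∈ A.leftQuotient w) → ∃ i ∈ F, A.leftQuotient w = dec i) :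
    complexity A ≤ ((1 + F.card : ℕ) : ℕ∞) := by
  have := complexity_le_card_of_subset_image (A := A) (Finset.insertNone F)
    (fun i : Option ι => i.elim 0 dec) fun w hw => by
      by_cases he : ∃ x, x ∈ A.leftQuotient w
      · obtain ⟨i, hi, e⟩ := h w hw he
        exact ⟨some i, by simpa using hi, e⟩
      · refine ⟨none, by simp, ?_⟩
        push Not at he
        ext x
        exact ⟨fun hx => absurd hx (he x), fun hx => absurd hx (Language.notMem_zero x)⟩
  rwa [Finset.card_insertNone, add_comm] at this

-- Here only the set of quotients to be avoided matters. It contains the quotient of `L` by `w`,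
-- which includes `L`; so adding or removing `L` changes nothing, and subsets of the other quotients
-- suffice as codes.
open Classical in
theorem IsLeftIdeal.complexity_atomOf_empty_le (h : IsLeftIdeal L) {Q : Finset (Language α)}
    (hQ : (Q : Set (Language α)) = quotients L) :
    complexity (atomOf L ∅) ≤ ((2 ^ (Q.card - 1) : ℕ) : ℕ∞) := by
  have hQ' : ∀ K, K ∈ Q ↔ K ∈ quotients L := fun K => by rw [← hQ, Finset.mem_coe]
  have hLQ : L ∈ Q := (hQ' L).2 self_mem_quotients
  rw [← Finset.card_erase_of_mem hLQ, ← Finset.card_powerset]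
  refine complexity_le_card_of_subset_image _ (fun Y => separated L ∅ (insert L Y)) ?_
  intro w hw
  replace hw := words_mono (letters_atomOf_subset _) hw
  refine ⟨(Q.image (·.leftQuotient w)).erase L, ?_, ?_⟩
  · rw [Finset.mem_powerset]
    refine Finset.erase_subset_erase _ fun K hK => ?_
    obtain ⟨J, hJ, rfl⟩ := Finset.mem_image.1 hK
    exact (hQ' _).2 (leftQuotient_mem_quotients ((hQ' J).1 hJ) hw)
  · have := leftQuotient_atomOf hQ (Finset.empty_subset Q) hw
    rw [Finset.coe_empty] at this
    rw [this, Finset.image_empty, Finset.sdiff_empty]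
    ext x
    rw [mem_separated, mem_separated]
    refine and_congr_right fun _ => and_congr_right fun _ => ⟨fun hx K hK hxK => ?_,
      fun hx K hK => ?_⟩
    · rcases Finset.mem_insert.1 hK with rfl | hK
      · exact hx (K.leftQuotient w) (Finset.mem_image_of_mem _ hLQ) (h.append_mem hw hxK)
      · exact hx K (Finset.mem_of_mem_erase hK) hxK
    · by_cases e : K = L
      · exact e ▸ hx L (Finset.mem_insert_self _ _)
      · exact hx K (Finset.mem_insert_of_mem (Finset.mem_erase.2 ⟨e, hK⟩))

-- A nonempty quotient makes X and Y disjoint and keeps `L` out of X. It remains to store Y by at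
-- most n-s-1 quotients other than `L`, where s = |S|.
open Classical in
theorem IsLeftIdeal.complexity_atomOf_le_of_card_add_two_le (h : IsLeftIdeal L)
    {Q S : Finset (Language α)} (hQ : (Q : Set (Language α)) = quotients L)
    (hS : S ⊆ Q) (hL : L ∉ S) (h0 : S.Nonempty) (hcard : S.card + 2 ≤ Q.card) :
    complexity (atomOf L S) ≤
      ((1 + (disjointPairs (Q.erase L) S.card (Q.card - S.card - 1)).card : ℕ) : ℕ∞) := by
  have hQ' : ∀ K, K ∈ Q ↔ K ∈ quotients L := fun K => by rw [← hQ, Finset.mem_coe]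
  have hLQ : L ∈ Q := (hQ' L).2 self_mem_quotients
  refine complexity_le_card_add_one _ (fun p => separated L p.1 (insert L p.2)) ?_
  intro w hw hne
  replace hw := words_mono (letters_atomOf_subset _) hw
  rw [leftQuotient_atomOf hQ hS hw] at hne ⊢
  set X := S.image (·.leftQuotient w) with hX
  set Y := (Q \ S).image (·.leftQuotient w) with hY
  obtain ⟨x₀, -, hx₀, hy₀⟩ := hne
  have himage : ∀ T ⊆ Q, T.image (·.leftQuotient w) ⊆ Q := fun T hT K hK => by
    obtain ⟨J, hJ, rfl⟩ := Finset.mem_image.1 hK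
    exact (hQ' _).2 (leftQuotient_mem_quotients ((hQ' J).1 (hT hJ)) hw)
  have hpY : L.leftQuotient w ∈ Y :=
    Finset.mem_image_of_mem _ (Finset.mem_sdiff.2 ⟨hLQ, hL⟩)
  have hLp : ∀ x ∈ L, x ∈ L.leftQuotient w := fun x hx => h.append_mem hw hx
  have hpmin : ∀ K ∈ Y, ∀ x ∈ L.leftQuotient w, x ∈ K := fun K hK x hx => by
    obtain ⟨J, hJ, rfl⟩ := Finset.mem_image.1 hK
    exact h.leftQuotient_subset ((hQ' J).1 (Finset.sdiff_subset hJ)) hx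
  have hLX : L ∉ X := fun hLX => hy₀ _ hpY (hLp _ (hx₀ L hLX))
  have hXT : X ⊆ Q.erase L := fun K hK =>
    Finset.mem_erase.2 ⟨fun e => hLX (e ▸ hK), himage S hS hK⟩
  have hYT : Y.erase L ⊆ Q.erase L :=
    Finset.erase_subset_erase _ (himage _ Finset.sdiff_subset)
  have hdisj : Disjoint X Y := Finset.disjoint_left.2 fun K hKX hKY => hy₀ K hKY (hx₀ K hKX)
  have hXcard : 1 ≤ X.card ∧ X.card ≤ S.card := ⟨(h0.image _).card_pos, Finset.card_image_le⟩
  have hYcard : Y.card ≤ Q.card - S.card := by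
    rw [← Finset.card_sdiff_of_subset hS]
    exact Finset.card_image_le
  by_cases hsmall : (Y.erase L).card ≤ Q.card - S.card - 1
  · refine ⟨(X, Y.erase L), mem_disjointPairs.2 ⟨⟨hXT, hYT⟩,
      hdisj.mono_right (Finset.erase_subset _ _), hXcard, hsmall⟩, ?_⟩
    ext x
    rw [mem_separated, mem_separated]
    refine and_congr_right fun _ => and_congr_right fun _ => ⟨fun hx K hK hxK => ?_,
      fun hx K hK => ?_⟩
    · rcases Finset.mem_insert.1 hK with rfl | hK
      · exact hx _ hpY (hLp x hxK)
      · exact hx K (Finset.mem_of_mem_erase hK) hxK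
    · by_cases e : K = L
      · exact e ▸ hx L (Finset.mem_insert_self _ _)
      · exact hx K (Finset.mem_insert_of_mem (Finset.mem_erase.2 ⟨e, hK⟩))
  -- Now Y has the full size n-s ≥ 2 and omits `L`. Its least member, the quotient of `L` by `w`,
  -- can be dropped, because avoiding another member `K'` already implies avoiding it.
  · have hLY : L ∉ Y := fun hLY => hsmall (by rw [Finset.card_erase_of_mem hLY]; omega)
    rw [Finset.erase_eq_of_notMem hLY] at hsmall hYT
    have h2 : 1 < Y.card := by omega
    obtain ⟨K', hK', hne⟩ := Finset.exists_mem_ne h2 (L.leftQuotient w)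
    refine ⟨(X, Y.erase (L.leftQuotient w)), mem_disjointPairs.2
      ⟨⟨hXT, (Finset.erase_subset _ _).trans hYT⟩,
      hdisj.mono_right (Finset.erase_subset _ _), hXcard, ?_⟩, ?_⟩
    · dsimp only
      rw [Finset.card_erase_of_mem hpY]
      omega
    · ext x
      rw [mem_separated, mem_separated]
      refine and_congr_right fun _ => and_congr_right fun _ => ⟨fun hx K hK hxK => ?_,
        fun hx K hK => ?_⟩
      · rcases Finset.mem_insert.1 hK with rfl | hK
        · exact hx _ hpY (hLp x hxK)
        · exact hx K (Finset.mem_of_mem_erase hK) hxK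
      · have hK'x := hx K' (Finset.mem_insert_of_mem (Finset.mem_erase.2 ⟨hne, hK'⟩))
        by_cases e : K = L.leftQuotient w
        · exact fun hxK => hK'x (hpmin K' hK' x (e ▸ hxK))
        · exact hx K (Finset.mem_insert_of_mem (Finset.mem_erase.2 ⟨e, hK⟩))

open Classical in
/-- The language coded by a set `X` of quotients, when only the least one of the quotients that
contain no word of the language is relevant: if `X` has at least two elements and a least one `p`,
then `p` is that quotient; otherwise it is `L`. -/
noncomputable def decodeTop (L : Language α) (X : Finset (Language α)) : Language α :=
  if h : 2 ≤ X.card ∧ ∃ p ∈ X, ∀ K ∈ X, p ≤ K then separated L (X.erase h.2.choose) {h.2.choose}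
  else separated L X {L}

open Classical in
theorem decodeTop_insert {X : Finset (Language α)} {p : Language α} (hp : p ∉ X)
    (hX : X.Nonempty) (hmin : ∀ K ∈ X, p ≤ K) :
    decodeTop L (insert p X) = separated L X {p} := by
  have hmin' : ∀ K ∈ insert p X, p ≤ K := by
    simpa using hmin
  have h : 2 ≤ (insert p X).card ∧ ∃ p' ∈ insert p X, ∀ K ∈ insert p X, p' ≤ K := by
    refine ⟨?_, p, Finset.mem_insert_self _ _, hmin'⟩
    rw [Finset.card_insert_of_notMem hp]
    have := hX.card_pos
    omega
  have e : h.2.choose = p :=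
    le_antisymm (h.2.choose_spec.2 p (Finset.mem_insert_self _ _))
      (hmin' _ h.2.choose_spec.1)
  rw [decodeTop, dif_pos h, e, Finset.erase_insert hp]

-- Only one quotient p has to be avoided, so the code must fit both X and p into one nonempty set of
-- quotients other than `L`. Since p lies below all of X and outside X, it can be inserted and
-- recovered as the least element.
open Classical in
theorem IsLeftIdeal.complexity_atomOf_le_of_card_add_one_eq (h : IsLeftIdeal L)
    {Q S : Finset (Language α)} (hQ : (Q : Set (Language α)) = quotients L)
    (hS : S ⊆ Q) (hL : L ∉ S) (h0 : S.Nonempty) (hcard : S.card + 1 = Q.card) :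
    complexity (atomOf L S) ≤
      ((1 + (disjointPairs (Q.erase L) S.card (Q.card - S.card - 1)).card : ℕ) : ℕ∞) := by
  have hQ' : ∀ K, K ∈ Q ↔ K ∈ quotients L := fun K => by rw [← hQ, Finset.mem_coe]
  have hLQ : L ∈ Q := (hQ' L).2 self_mem_quotients
  have hSeq : Q \ S = {L} := by
    refine (Finset.eq_of_subset_of_card_le (Finset.singleton_subset_iff.2
      (Finset.mem_sdiff.2 ⟨hLQ, hL⟩)) ?_).symm
    rw [Finset.card_sdiff_of_subset hS, Finset.card_singleton]
    omega
  refine complexity_le_card_add_one _ (fun p => decodeTop L p.1) ?_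
  intro w hw hne
  replace hw := words_mono (letters_atomOf_subset _) hw
  rw [leftQuotient_atomOf hQ hS hw, hSeq, Finset.image_singleton] at hne ⊢
  set X := S.image (·.leftQuotient w) with hX
  obtain ⟨x₀, -, hx₀, hy₀⟩ := hne
  replace hy₀ := hy₀ _ (Finset.mem_singleton_self _)
  have himage : X ⊆ Q := fun K hK => by
    obtain ⟨J, hJ, rfl⟩ := Finset.mem_image.1 hK
    exact (hQ' _).2 (leftQuotient_mem_quotients ((hQ' J).1 (hS hJ)) hw)
  have hLp : ∀ x ∈ L, x ∈ L.leftQuotient w := fun x hx => h.append_mem hw hx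
  have hpmin : ∀ K ∈ X, L.leftQuotient w ≤ K := fun K hK => by
    obtain ⟨J, hJ, rfl⟩ := Finset.mem_image.1 hK
    exact fun x hx => h.leftQuotient_subset ((hQ' J).1 (hS hJ)) hx
  have hLX : L ∉ X := fun hLX => hy₀ (hLp _ (hx₀ L hLX))
  have hpX : L.leftQuotient w ∉ X := fun hp => hy₀ (hx₀ _ hp)
  have hXT : X ⊆ Q.erase L := fun K hK =>
    Finset.mem_erase.2 ⟨fun e => hLX (e ▸ hK), himage hK⟩
  have hXne : X.Nonempty := h0.image _
  have hT : (Q.erase L).card = S.card := by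
    rw [Finset.card_erase_of_mem hLQ]
    omega
  have hmem : ∀ Z ⊆ Q.erase L, Z.Nonempty →
      (Z, ∅) ∈ disjointPairs (Q.erase L) S.card (Q.card - S.card - 1) := fun Z hZ hZne =>
    mem_disjointPairs.2 ⟨⟨hZ, Finset.empty_subset _⟩, Finset.disjoint_empty_right _,
      ⟨hZne.card_pos, hT ▸ Finset.card_le_card hZ⟩, by simp⟩
  -- If p = `L`, then X alone is stored, but a least element q of X could be mistaken for p. In that
  -- case {q} is stored: the intersection of X is q itself, and a singleton is decoded with `L`.
  by_cases hp : L.leftQuotient w = L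
  · rw [hp]
    by_cases hleast : ∃ q ∈ X, ∀ K ∈ X, q ≤ K
    · obtain ⟨q, hq, hqmin⟩ := hleast
      refine ⟨({q}, ∅), hmem _ (Finset.singleton_subset_iff.2 (hXT hq))
        (Finset.singleton_nonempty q), ?_⟩
      dsimp only
      rw [decodeTop, dif_neg (by simp)]
      ext x
      rw [mem_separated, mem_separated]
      refine and_congr_right fun _ => and_congr_left fun _ => ⟨fun hx K hK => ?_,
        fun hx K hK => ?_⟩
      · rw [Finset.mem_singleton.1 hK]
        exact hx q hq
      · exact hqmin K hK (hx q (Finset.mem_singleton_self q))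
    · refine ⟨(X, ∅), hmem X hXT hXne, ?_⟩
      dsimp only
      rw [decodeTop, dif_neg fun h => hleast h.2]
  · refine ⟨(insert (L.leftQuotient w) X, ∅), hmem _ (Finset.insert_subset_iff.2
      ⟨Finset.mem_erase.2 ⟨hp, (hQ' _).2 ⟨w, hw, rfl⟩⟩, hXT⟩) (Finset.insert_nonempty _ _), ?_⟩
    exact (decodeTop_insert hpX hXne hpmin).symm

theorem IsLeftIdeal.complexity_atomOf_le (h : IsLeftIdeal L) (hn : complexity L = n)
    {S : Set (Language α)} (hS : S ⊆ quotients L) (hA : atomOf L S ∈ atoms L) :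
    complexity (atomOf L S) ≤ (atomBound n S.ncard : ℕ∞) := by
  classical
  obtain ⟨Q, hQ⟩ := (Set.finite_of_encard_eq_coe hn).exists_finset_coe
  lift S to Finset (Language α) using (Set.finite_of_encard_eq_coe hn).subset hS
  have hQn : Q.card = n := by
    rw [complexity, ← hQ, Set.encard_coe_eq_coe_finsetCard] at hn
    exact_mod_cast hn
  have hSQ : S ⊆ Q := by
    rw [← hQ] at hS
    exact_mod_cast hS
  rw [Set.ncard_coe_finset]
  have hLQ : L ∈ Q := by
    rw [← Finset.mem_coe, hQ]
    exact self_mem_quotients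
  by_cases hSn : S.card = n
  · rw [Finset.eq_of_subset_of_card_le hSQ (by omega), hQ, h.atomOf_quotients, hn, hQn,
      atomBound, if_pos rfl]
  have hle := Finset.card_le_card hSQ
  rcases S.eq_empty_or_nonempty with rfl | h0
  · rw [Finset.card_empty, atomBound, if_neg (by simpa using hSn), if_pos rfl, Finset.coe_empty,
      ← hQn]
    exact h.complexity_atomOf_empty_le hQ
  have hL : L ∉ S := fun hLS => hSn <| by
    have := h.eq_quotients_of_self_mem hS hA hLS
    rw [← hQ] at this
    rw [Finset.coe_injective this, hQn]
  rw [atomBound_eq_card (T := Q.erase L) (by rw [Finset.card_erase_of_mem hLQ, hQn])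
    h0.card_pos.ne' (by omega), ← hQn]
  rcases Nat.lt_or_ge (S.card + 1) Q.card with h2 | h2
  · exact h.complexity_atomOf_le_of_card_add_two_le hQ hSQ hL h0 (by omega)
  · exact h.complexity_atomOf_le_of_card_add_one_eq hQ hSQ hL h0 (by omega)

end AtomUpperBound

/-! ### Transformations induced by words -/

section Realized

variable {β σ : Type*}

/-- The transformation `f` of the states is induced by a word over `Λ`. -/
def Realized (A : DFA β σ) (Λ : Set β) (f : σ → σ) : Prop :=
  ∃ w : List β, (∀ l ∈ w, l ∈ Λ) ∧ ∀ q, A.evalFrom q w = f q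

variable {A : DFA β σ} {Λ : Set β} {f g : σ → σ}

theorem realized_id : Realized A Λ id := ⟨[], by simp, fun _ => rfl⟩

theorem Realized.comp (hf : Realized A Λ f) (hg : Realized A Λ g) : Realized A Λ (g ∘ f) := by
  obtain ⟨u, hu, hfu⟩ := hf
  obtain ⟨v, hv, hgv⟩ := hg
  refine ⟨u ++ v, fun l hl => (List.mem_append.1 hl).elim (hu l) (hv l), fun q => ?_⟩
  rw [DFA.evalFrom_of_append, hfu, hgv, Function.comp_apply]

theorem realized_step {l : β} (hl : l ∈ Λ) (h : ∀ q, A.step q l = f q) : Realized A Λ f :=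
  ⟨[l], by simpa using hl, fun q => by rw [DFA.evalFrom_singleton, h]⟩

theorem Realized.iterate (hf : Realized A Λ f) (k : ℕ) : Realized A Λ f^[k] := by
  induction k with
  | zero => exact realized_id
  | succ k ih => exact hf.comp ih

theorem Realized.mono {Λ' : Set β} (h : Realized A Λ f) (hΛ : Λ ⊆ Λ') : Realized A Λ' f :=
  h.imp fun _ hw => ⟨fun l hl => hΛ (hw.1 l hl), hw.2⟩

end Realized

/-! ### The letters of E_n as maps, in particular the rotation a -/

section Transition

variable {n : ℕ} (hn : 4 ≤ n)

/-- The initial state `0`. -/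
def zeroState : Fin n := ⟨0, by omega⟩

/-- The state `1`. -/
def oneState : Fin n := ⟨1, by omega⟩

theorem zeroState_ne_oneState : zeroState hn ≠ oneState hn := by
  simp [zeroState, oneState]

variable {hn}

theorem ne_zeroState_iff {q : Fin n} : q ≠ zeroState hn ↔ 1 ≤ q.val := by
  rw [Ne, Fin.ext_iff]
  exact Nat.one_le_iff_ne_zero.symm

theorem transition_e (q : Fin n) : transition n hn q .e = oneState hn := rfl

theorem transition_zeroState {i : Input} (hi : i ≠ .e) :
    transition n hn (zeroState hn) i = zeroState hn := by
  cases i with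
  | a => simp [transition, zeroState]
  | b =>
    simp only [transition, zeroState]
    rw [Equiv.swap_apply_of_ne_of_ne] <;> simp
  | c => simp [transition, zeroState, show 0 ≠ n - 1 by omega]
  | d => simp [transition, zeroState, show 0 ≠ n - 1 by omega]
  | e => exact absurd rfl hi

theorem transition_d_of_ne {q : Fin n} (hq : q.val ≠ n - 1) : transition n hn q .d = q := by
  simp [transition, hq]

theorem transition_d_of_eq {q : Fin n} (hq : q.val = n - 1) :
    transition n hn q .d = zeroState hn := by
  simp [transition, hq, zeroState]

theorem transition_c_of_ne {q : Fin n} (hq : q.val ≠ n - 1) : transition n hn q .c = q := by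
  simp [transition, hq]

theorem transition_c_of_eq {q : Fin n} (hq : q.val = n - 1) :
    transition n hn q .c = oneState hn := by
  simp [transition, hq, oneState]

theorem transition_a_val {q : Fin n} (hq : 1 ≤ q.val) :
    (transition n hn q .a).val = 1 + (q.val - 1 + 1) % (n - 1) := by
  have hlt := q.isLt
  simp only [transition]
  rw [if_neg (by omega)]
  split_ifs with h
  · simp only
    rw [Nat.mod_eq_of_lt (by omega)]
    omega
  · have : q.val - 1 + 1 = n - 1 := by omega
    simp [this]

theorem transition_a_iterate_zeroState (k : ℕ) :
    (transition n hn · .a)^[k] (zeroState hn) = zeroState hn :=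
  Function.iterate_fixed (transition_zeroState (by simp)) k

theorem transition_a_iterate_val {q : Fin n} (hq : 1 ≤ q.val) (k : ℕ) :
    ((transition n hn · .a)^[k] q).val = 1 + (q.val - 1 + k) % (n - 1) := by
  have hlt := q.isLt
  induction k with
  | zero =>
    rw [Function.iterate_zero, id, Nat.add_zero, Nat.mod_eq_of_lt (by omega)]
    omega
  | succ k ih =>
    rw [Function.iterate_succ_apply', transition_a_val (by omega), ih, Nat.add_sub_cancel_left,
      Nat.mod_add_mod, add_assoc]

theorem transition_a_iterate_ne_zeroState {q : Fin n} (hq : q ≠ zeroState hn) (k : ℕ) :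
    (transition n hn · .a)^[k] q ≠ zeroState hn := by
  rw [ne_zeroState_iff] at hq ⊢
  rw [transition_a_iterate_val hq]
  omega

theorem transition_a_iterate_period (q : Fin n) :
    (transition n hn · .a)^[n - 1] q = q := by
  by_cases hq : q = zeroState hn
  · rw [hq, transition_a_iterate_zeroState]
  · rw [← Ne, ne_zeroState_iff] at hq
    have := q.isLt
    rw [Fin.ext_iff, transition_a_iterate_val hq, Nat.add_mod_right, Nat.mod_eq_of_lt (by omega)]
    omega

theorem exists_transition_a_iterate_eq {p q : Fin n} (hp : p ≠ zeroState hn)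
    (hq : q ≠ zeroState hn) : ∃ k, (transition n hn · .a)^[k] p = q := by
  rw [ne_zeroState_iff] at hp hq
  have h1 := p.isLt
  have h2 := q.isLt
  refine ⟨q.val + (n - 1 - p.val), ?_⟩
  rw [Fin.ext_iff, transition_a_iterate_val hp,
    show p.val - 1 + (q.val + (n - 1 - p.val)) = q.val - 1 + (n - 1) by omega, Nat.add_mod_right,
    Nat.mod_eq_of_lt (by omega)]
  omega

end Transition

/-! ### E_n with renamed letters: quotients, reverse, star, minimality -/

section Relabeling

variable {n : ℕ} (hn : 4 ≤ n) {β : Type*} (ρ : β → Option Input)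

/-- The automaton `E_n` over another alphabet: a letter `l` acts as the letter `ρ l`, and as the
identity if `ρ l` is undefined. -/
def relabeledDFA : DFA β (Fin n) where
  step q l := (ρ l).elim q (transition n hn q)
  start := zeroState hn
  accept := {q | 1 ≤ q.val}

/-- The words over the domain of `ρ` that `relabeledDFA` accepts from `q`. -/
def stateLanguage (q : Fin n) : Language β :=
  {v | (∀ l ∈ v, (ρ l).isSome) ∧ (relabeledDFA hn ρ).evalFrom q v ≠ zeroState hn}

variable {hn ρ}

theorem mem_stateLanguage {q : Fin n} {v : List β} : v ∈ stateLanguage hn ρ q ↔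
    (∀ l ∈ v, (ρ l).isSome) ∧ (relabeledDFA hn ρ).evalFrom q v ≠ zeroState hn := Iff.rfl

theorem relabeledDFA_step {l : β} {i : Input} (h : ρ l = some i) (q : Fin n) :
    (relabeledDFA hn ρ).step q l = transition n hn q i := by
  simp [relabeledDFA, h]

theorem M_eq_stateLanguage : M n hn = stateLanguage hn some (zeroState hn) := by
  ext v
  rw [mem_stateLanguage, ne_zeroState_iff]
  simp only [Option.isSome_some, implies_true, true_and]
  rfl

theorem evalFrom_relabeledDFA {w : List Input} {v : List β} (h : v.map ρ = w.map some)
    (q : Fin n) : (relabeledDFA hn ρ).evalFrom q v = (E n hn).evalFrom q w := by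
  induction v generalizing w q with
  | nil =>
    cases w with
    | nil => rfl
    | cons i w => simp at h
  | cons l v ih =>
    cases w with
    | nil => simp at h
    | cons i w =>
      simp only [List.map_cons, List.cons.injEq] at h
      rw [DFA.evalFrom_cons, DFA.evalFrom_cons, relabeledDFA_step h.1]
      exact ih h.2 _

theorem map_eq_map_some_iff {α β : Type*} {π : α → Option β} {ρ : β → Option α}
    (hπ : ∀ i l, π i = some l ↔ ρ l = some i) {w : List α} {v : List β} :
    w.map π = v.map some ↔ v.map ρ = w.map some := by
  induction v generalizing w with
  | nil => simp
  | cons l v ih => cases w <;> simp [ih, hπ]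

/-- The maps `π` and `ρ` are mutually inverse partial injections, so renaming and deleting letters
amounts to running E_n on the `ρ`-images. -/
theorem dialect_eq_stateLanguage {π : Input → Option β}
    (hπ : ∀ i l, π i = some l ↔ ρ l = some i) :
    dialect π (M n hn) = stateLanguage hn ρ (zeroState hn) := by
  ext v
  rw [mem_stateLanguage, ne_zeroState_iff]
  constructor
  · rintro ⟨w, hw, h⟩
    rw [map_eq_map_some_iff hπ] at h
    refine ⟨fun l hl => ?_, ?_⟩
    · have : ρ l ∈ w.map some := h ▸ List.mem_map_of_mem hl
      obtain ⟨i, -, e⟩ := List.mem_map.1 this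
      rw [← e]
      rfl
    · rw [evalFrom_relabeledDFA h]
      exact hw
  · rintro ⟨h1, h2⟩
    obtain ⟨w, hw⟩ : ∃ w : List Input, v.map ρ = w.map some := by
      clear h2
      induction v with
      | nil => exact ⟨[], rfl⟩
      | cons l v ih =>
        obtain ⟨w, hw⟩ := ih fun m hm => h1 m (by simp [hm])
        obtain ⟨i, hi⟩ := Option.isSome_iff_exists.1 (h1 l (by simp))
        exact ⟨i :: w, by simp [hw, hi]⟩
    rw [evalFrom_relabeledDFA hw] at h2
    exact ⟨w, h2, (map_eq_map_some_iff hπ).2 hw⟩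

variable {la ld le : β}

theorem letters_stateLanguage (he : ρ le = some .e) (q : Fin n) :
    letters (stateLanguage hn ρ q) = {l | (ρ l).isSome} := by
  ext l
  constructor
  · rintro ⟨w, hw, hl⟩
    exact hw.1 l hl
  · intro hl
    refine ⟨[l, le], ⟨?_, ?_⟩, by simp⟩
    · intro m hm
      rcases List.mem_pair.1 hm with rfl | rfl
      · exact hl
      · simp [he]
    · rw [DFA.evalFrom_cons, DFA.evalFrom_singleton, relabeledDFA_step he, transition_e]
      exact (zeroState_ne_oneState hn).symm

theorem mem_words_stateLanguage (he : ρ le = some .e) {q : Fin n} {w : List β} :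
    w ∈ words (stateLanguage hn ρ q) ↔ ∀ l ∈ w, (ρ l).isSome := by
  rw [mem_words_iff, letters_stateLanguage he]
  rfl

theorem leftQuotient_stateLanguage {q : Fin n} {w : List β} (hw : ∀ l ∈ w, (ρ l).isSome) :
    (stateLanguage hn ρ q).leftQuotient w =
      stateLanguage hn ρ ((relabeledDFA hn ρ).evalFrom q w) := by
  ext v
  rw [Language.mem_leftQuotient, mem_stateLanguage, mem_stateLanguage, DFA.evalFrom_of_append]
  refine and_congr_left fun _ => ⟨fun h l hl => h l (List.mem_append_right _ hl), fun h l hl => ?_⟩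
  exact (List.mem_append.1 hl).elim (hw l) (h l)

/-- A word fixes the state `0` or it induces a constant map. -/
theorem evalFrom_zeroState_or_const (w : List β) :
    (relabeledDFA hn ρ).evalFrom (zeroState hn) w = zeroState hn ∨
      ∀ p q, (relabeledDFA hn ρ).evalFrom p w = (relabeledDFA hn ρ).evalFrom q w := by
  induction w with
  | nil => exact .inl rfl
  | cons l w ih =>
    simp only [DFA.evalFrom_cons]
    rcases h : ρ l with _ | i
    · simpa [relabeledDFA, h] using ih
    · simp only [relabeledDFA_step h]
      by_cases hi : i = .e
      · subst hi
        exact .inr fun _ _ => rfl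
      · rw [transition_zeroState hi]
        exact ih.imp_right fun h _ _ => h _ _

/-- An accepted word does not fix 0, so it induces a constant map and is accepted from every state.
-/
theorem isLeftIdeal_stateLanguage (he : ρ le = some .e) :
    IsLeftIdeal (stateLanguage hn ρ (zeroState hn)) := by
  refine isLeftIdeal_of_append_mem ⟨[le], ⟨by simp [he], ?_⟩⟩ ?_
  · rw [DFA.evalFrom_singleton, relabeledDFA_step he, transition_e]
    exact (zeroState_ne_oneState hn).symm
  · intro u hu x hx
    rw [mem_words_stateLanguage he] at hu
    rw [← Language.mem_leftQuotient, leftQuotient_stateLanguage hu]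
    refine ⟨hx.1, ?_⟩
    rcases evalFrom_zeroState_or_const (hn := hn) (ρ := ρ) x with h | h
    · exact absurd h hx.2
    · rw [h _ (zeroState hn)]
      exact hx.2

theorem realized_transition {Λ : Set β} {l : β} {i : Input} (h : ρ l = some i) (hl : l ∈ Λ) :
    Realized (relabeledDFA hn ρ) Λ (transition n hn · i) :=
  realized_step hl (relabeledDFA_step h)

/-- A rotation, then `d`, then a rotation back: a single state is sent to `0`. -/
theorem realized_update_zeroState (ha : ρ la = some .a) (hd : ρ ld = some .d) {r : Fin n}
    (hr : r ≠ zeroState hn) :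
    Realized (relabeledDFA hn ρ) {la, ld} (Function.update id r (zeroState hn)) := by
  have hA : Realized (relabeledDFA hn ρ) {la, ld} (transition n hn · .a) :=
    realized_transition ha (by simp)
  have hD : Realized (relabeledDFA hn ρ) {la, ld} (transition n hn · .d) :=
    realized_transition hd (by simp)
  convert ((hA.iterate (n - 1 - r.val)).comp hD).comp (hA.iterate r.val) using 1
  funext q
  simp only [Function.comp_apply]
  have hr' := hr
  rw [ne_zeroState_iff] at hr'
  have hrlt := r.isLt
  have hqlt := q.isLt
  by_cases hq0 : q = zeroState hn
  · rw [hq0, Function.update_of_ne hr.symm, transition_a_iterate_zeroState,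
      transition_zeroState (by simp), transition_a_iterate_zeroState, id]
  have hq' := ne_zeroState_iff.1 hq0
  by_cases hq : q = r
  · subst hq
    rw [Function.update_self, transition_d_of_eq, transition_a_iterate_zeroState]
    rw [transition_a_iterate_val hq', show q.val - 1 + (n - 1 - q.val) = n - 2 by omega,
      Nat.mod_eq_of_lt (by omega)]
    omega
  · rw [Function.update_of_ne hq, transition_d_of_ne, ← Function.iterate_add_apply,
      show r.val + (n - 1 - r.val) = n - 1 by omega, transition_a_iterate_period, id]
    rw [transition_a_iterate_val hq']
    rw [Fin.ext_iff] at hq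
    rcases Nat.lt_or_ge (q.val - 1 + (n - 1 - r.val)) (n - 1) with h | h
    · rw [Nat.mod_eq_of_lt h]
      omega
    · rw [Nat.mod_eq_sub_mod h, Nat.mod_eq_of_lt (by omega)]
      omega

open Classical in
theorem realized_restrict (ha : ρ la = some .a) (hd : ρ ld = some .d) (T : Finset (Fin n)) :
    Realized (relabeledDFA hn ρ) {la, ld} (fun q => if q ∈ T then zeroState hn else q) := by
  induction T using Finset.induction_on with
  | empty => exact realized_id
  | insert r T hr ih =>
    by_cases hr0 : r = zeroState hn
    · convert ih using 1
      funext q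
      by_cases hq : q = r
      · subst hq
        simp [hr0]
      · simp [hq]
    · convert ih.comp (realized_update_zeroState ha hd hr0) using 1
      funext q
      by_cases hqT : q ∈ T
      · simp [hqT, Function.update_of_ne (Ne.symm hr0)]
      · by_cases hq : q = r
        · subst hq
          simp [hqT]
        · simp [hq, hqT]

/-- Words over `a`, `d` distinguish the states. -/
theorem exists_evalFrom_eq_zeroState (ha : ρ la = some .a) (hd : ρ ld = some .d) {p q : Fin n}
    (hpq : p ≠ q) : ∃ w, (∀ l ∈ w, l ∈ ({la, ld} : Set β)) ∧
      ¬ ((relabeledDFA hn ρ).evalFrom p w = zeroState hn ↔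
        (relabeledDFA hn ρ).evalFrom q w = zeroState hn) := by
  by_cases hp : p = zeroState hn
  · refine ⟨[], by simp, ?_⟩
    simp [hp, hp ▸ hpq.symm]
  by_cases hq : q = zeroState hn
  · refine ⟨[], by simp, ?_⟩
    simp [hp, hq]
  obtain ⟨w, hw, h⟩ := realized_update_zeroState (hn := hn) ha hd hp
  refine ⟨w, hw, ?_⟩
  rw [h, h, Function.update_self, Function.update_of_ne hpq.symm]
  simpa using hq

theorem isSome_of_mem_pair (ha : ρ la = some .a) (hd : ρ ld = some .d) {l : β}
    (hl : l ∈ ({la, ld} : Set β)) : (ρ l).isSome := by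
  rcases hl with rfl | rfl
  · simp [ha]
  · simp [hd]

/-- The letter e resets to state 1, from where a reaches the nonzero states and a, d reach 0. The
word is nonempty, as the star needs. -/
theorem exists_evalFrom_eq (ha : ρ la = some .a) (hd : ρ ld = some .d) (he : ρ le = some .e)
    (p q : Fin n) : ∃ w ≠ [], (∀ l ∈ w, (ρ l).isSome) ∧ (relabeledDFA hn ρ).evalFrom p w = q := by
  have hone := (zeroState_ne_oneState hn).symm
  obtain ⟨u, hu, hfu⟩ : Realized (relabeledDFA hn ρ) {la, ld} (if q = zeroState hn then
      Function.update id (oneState hn) (zeroState hn) else (transition n hn · .a)^[q.val - 1]) := by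
    split_ifs
    · exact realized_update_zeroState ha hd hone
    · exact (realized_transition ha (by simp)).iterate _
  refine ⟨le :: u, by simp, ?_, ?_⟩
  · intro l hl
    rcases List.mem_cons.1 hl with rfl | hl
    · simp [he]
    · exact isSome_of_mem_pair ha hd (hu l hl)
  · rw [DFA.evalFrom_cons, relabeledDFA_step he, transition_e, hfu]
    split_ifs with hq
    · rw [Function.update_self, hq]
    · have hq' := (ne_zeroState_iff (hn := hn)).1 hq
      have := q.isLt
      rw [Fin.ext_iff, transition_a_iterate_val (ne_zeroState_iff.1 hone)]
      simp only [oneState]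
      rw [Nat.mod_eq_of_lt (by omega)]
      omega

theorem stateLanguage_injective (ha : ρ la = some .a) (hd : ρ ld = some .d) :
    Function.Injective (stateLanguage hn ρ) := by
  intro p q h
  by_contra hpq
  obtain ⟨w, hw, hne⟩ := exists_evalFrom_eq_zeroState (hn := hn) ha hd hpq
  have hw' : ∀ l ∈ w, (ρ l).isSome := fun l hl => isSome_of_mem_pair ha hd (hw l hl)
  have : w ∈ stateLanguage hn ρ p ↔ w ∈ stateLanguage hn ρ q := by rw [h]
  rw [mem_stateLanguage, mem_stateLanguage] at this
  exact hne (not_iff_not.1 ⟨fun h => (this.1 ⟨hw', h⟩).2, fun h => (this.2 ⟨hw', h⟩).2⟩)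

theorem quotients_stateLanguage (ha : ρ la = some .a) (hd : ρ ld = some .d) (he : ρ le = some .e)
    (q : Fin n) : quotients (stateLanguage hn ρ q) = Set.range (stateLanguage hn ρ) := by
  ext K
  constructor
  · rintro ⟨w, hw, rfl⟩
    rw [mem_words_stateLanguage he] at hw
    exact ⟨_, (leftQuotient_stateLanguage hw).symm⟩
  · rintro ⟨p, rfl⟩
    obtain ⟨w, -, hw, rfl⟩ := exists_evalFrom_eq (hn := hn) ha hd he q p
    exact ⟨w, (mem_words_stateLanguage he).2 hw, (leftQuotient_stateLanguage hw).symm⟩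

theorem complexity_stateLanguage (ha : ρ la = some .a) (hd : ρ ld = some .d)
    (he : ρ le = some .e) (q : Fin n) : complexity (stateLanguage hn ρ q) = n := by
  rw [complexity, quotients_stateLanguage ha hd he, ← Set.image_univ,
    (stateLanguage_injective ha hd).encard_image, Set.encard_univ]
  simp

theorem complexity_quotient_stateLanguage (ha : ρ la = some .a) (hd : ρ ld = some .d)
    (he : ρ le = some .e) {q : Fin n} {K : Language β}
    (hK : K ∈ quotients (stateLanguage hn ρ q)) : complexity K = n := by
  rw [quotients_stateLanguage ha hd he] at hK
  obtain ⟨p, rfl⟩ := hK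
  exact complexity_stateLanguage ha hd he p

theorem encard_containingSets_stateLanguage (ha : ρ la = some .a) (hd : ρ ld = some .d)
    (he : ρ le = some .e) : (containingSets (stateLanguage hn ρ (zeroState hn))).encard =
      ((2 ^ (n - 1) + 1 : ℕ) : ℕ∞) := by
  classical
  have hinj := stateLanguage_injective (hn := hn) ha hd
  have hset : ∀ w : List β, (∀ l ∈ w, (ρ l).isSome) →
      {K | K ∈ quotients (stateLanguage hn ρ (zeroState hn)) ∧ w ∈ K} =
      stateLanguage hn ρ '' {q | (relabeledDFA hn ρ).evalFrom q w ≠ zeroState hn} := by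
    intro w hw
    rw [quotients_stateLanguage ha hd he]
    ext K
    constructor
    · rintro ⟨⟨q, rfl⟩, h⟩
      exact ⟨q, h.2, rfl⟩
    · rintro ⟨q, hq, rfl⟩
      exact ⟨⟨q, rfl⟩, hw, hq⟩
  have himage : containingSets (stateLanguage hn ρ (zeroState hn)) =
      Set.image (stateLanguage hn ρ) '' insert Set.univ (𝒫 {zeroState hn}ᶜ) := by
    ext S
    constructor
    · rintro ⟨w, hw, rfl⟩
      rw [mem_words_stateLanguage he] at hw
      refine ⟨_, ?_, (hset w hw).symm⟩
      rcases evalFrom_zeroState_or_const (hn := hn) (ρ := ρ) w with h | h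
      · right
        rintro q hq rfl
        exact hq h
      · by_cases h0 : (relabeledDFA hn ρ).evalFrom (zeroState hn) w = zeroState hn
        · right
          rintro q hq rfl
          exact hq h0
        · left
          ext q
          simp [h q (zeroState hn), h0]
    · rintro ⟨T, hT, rfl⟩
      rcases hT with rfl | hT
      · refine ⟨[le], (mem_words_stateLanguage he).2 (by simp [he]), ?_⟩
        rw [hset _ (by simp [he])]
        congr 1
        ext q
        simp [relabeledDFA_step he, transition_e, (zeroState_ne_oneState hn).symm]
      · obtain ⟨w, hw, h⟩ := realized_restrict (hn := hn) ha hd (Tᶜ.toFinset)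
        have hw' : ∀ l ∈ w, (ρ l).isSome := fun l hl => isSome_of_mem_pair ha hd (hw l hl)
        refine ⟨w, (mem_words_stateLanguage he).2 hw', ?_⟩
        rw [hset w hw']
        congr 1
        ext q
        by_cases hq : q ∈ T
        · simpa [h, hq] using hT hq
        · simp [h, hq]
  have hnot : Set.univ ∉ 𝒫 ({zeroState hn}ᶜ : Set (Fin n)) :=
    fun h => h (Set.mem_univ (zeroState hn)) rfl
  rw [himage, hinj.image_injective.encard_image, Set.encard_insert_of_notMem hnot,
    ← Set.Finite.cast_ncard_eq (Set.toFinite _), Set.ncard_powerset, Set.ncard_compl,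
    Nat.card_eq_fintype_card, Fintype.card_fin, Set.ncard_singleton]
  push_cast
  rfl

theorem complexity_kstar_stateLanguage (ha : ρ la = some .a) (hd : ρ ld = some .d)
    (he : ρ le = some .e) : complexity (stateLanguage hn ρ (zeroState hn))∗ =
      ((n + 1 : ℕ) : ℕ∞) := by
  have hL := isLeftIdeal_stateLanguage (hn := hn) he
  set L := stateLanguage hn ρ (zeroState hn) with hLdef
  have hq : quotients L∗ = insert L∗ (quotients L) := by
    ext K
    constructor
    · rintro ⟨w, hw, rfl⟩
      rcases eq_or_ne w [] with rfl | hw0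
      · exact .inl rfl
      · rw [hL.words_kstar] at hw
        exact .inr ⟨w, hw, hL.leftQuotient_kstar hw0⟩
    · rintro (rfl | hK)
      · exact self_mem_quotients
      · rw [hLdef, quotients_stateLanguage ha hd he] at hK
        obtain ⟨q, rfl⟩ := hK
        obtain ⟨w, hw0, hw, rfl⟩ := exists_evalFrom_eq (hn := hn) ha hd he (zeroState hn) q
        refine ⟨w, ?_, ?_⟩
        · rw [hL.words_kstar]
          exact (mem_words_stateLanguage he).2 hw
        · rw [hL.leftQuotient_kstar hw0]
          exact (leftQuotient_stateLanguage hw).symm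
  -- Containing the empty word forces q ≠ 0, so the one-letter word a is accepted from q. It is not
  -- accepted from 0, hence is not in the star.
  have hnot : L∗ ∉ quotients L := by
    rw [hLdef, quotients_stateLanguage ha hd he, ← hLdef]
    rintro ⟨q, hq⟩
    have hnil : [] ∈ stateLanguage hn ρ q := hq ▸ Language.nil_mem_kstar L
    have hla : [la] ∈ stateLanguage hn ρ q := by
      refine ⟨by simp [ha], ?_⟩
      rw [DFA.evalFrom_singleton, relabeledDFA_step ha]
      exact transition_a_iterate_ne_zeroState hnil.2 1
    rw [hq, hL.mem_kstar_iff] at hla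
    rcases hla with h | h
    · simp at h
    · refine h.2 ?_
      rw [DFA.evalFrom_singleton, relabeledDFA_step ha, transition_zeroState (by simp)]
  have := complexity_stateLanguage (hn := hn) ha hd he (zeroState hn)
  rw [complexity] at this
  rw [complexity, hq, Set.encard_insert_of_notMem hnot, hLdef, this]
  push_cast
  rfl

theorem isMinimal_E : IsMinimal (E n hn) := by
  have hE : ∀ q w, (relabeledDFA hn some).evalFrom q w = (E n hn).evalFrom q w :=
    fun q w => evalFrom_relabeledDFA rfl q
  refine ⟨fun q => ?_, fun p q h => ?_⟩
  · obtain ⟨w, -, -, hw⟩ := exists_evalFrom_eq (hn := hn) (ρ := some) (la := .a) (ld := .d)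
      (le := .e) rfl rfl rfl (zeroState hn) q
    exact ⟨w, (hE _ _).symm.trans hw⟩
  · refine stateLanguage_injective (hn := hn) (ρ := some) (la := .a) (ld := .d) rfl rfl ?_
    ext w
    have : w ∈ (E n hn).acceptsFrom p ↔ w ∈ (E n hn).acceptsFrom q := by rw [h]
    rw [mem_stateLanguage, mem_stateLanguage, hE, hE, ne_zeroState_iff, ne_zeroState_iff]
    exact and_congr_right fun _ => this

end Relabeling

/-! ### The letters other than e induce all maps fixing 0 -/

section FullTransformation

variable {n : ℕ} {hn : 4 ≤ n}

theorem transition_a_iterate_injective (k : ℕ) :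
    Function.Injective ((transition n hn · .a)^[k]) := by
  refine Function.Injective.iterate (Function.LeftInverse.injective
    (g := (transition n hn · .a)^[n - 2]) fun q => ?_) k
  rw [← Function.iterate_succ_apply (transition n hn · .a), show (n - 2).succ = n - 1 by omega,
    transition_a_iterate_period]

variable {Λ : Set Input}

theorem realized_swap_succ (hΛ : ∀ l, l ≠ Input.e → l ∈ Λ)
    {j : ℕ} (h1 : 1 ≤ j) (h2 : j + 1 < n) :
    Realized (relabeledDFA hn some) Λ
      (Equiv.swap (⟨j, by omega⟩ : Fin n) ⟨j + 1, h2⟩) := by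
  have hA : Realized (relabeledDFA hn some) Λ (transition n hn · .a) :=
    realized_transition rfl (hΛ _ (by simp))
  have hB : Realized (relabeledDFA hn some) Λ (transition n hn · .b) :=
    realized_transition rfl (hΛ _ (by simp))
  -- The transposition (1, 2) is conjugated by a rotation: n-j steps bring j to 1, and j-1 more
  -- complete the period n-1.
  convert ((hA.iterate (n - j)).comp hB).comp (hA.iterate (j - 1)) using 1
  funext q
  simp only [Function.comp_apply]
  rw [show ∀ r, transition n hn r .b = Equiv.swap ⟨1, by omega⟩ ⟨2, by omega⟩ r from fun _ => rfl,
    ← (transition_a_iterate_injective (j - 1)).swap_apply, ← Function.iterate_add_apply,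
    show j - 1 + (n - j) = n - 1 by omega, transition_a_iterate_period]
  congr 2
  · rw [Fin.ext_iff, transition_a_iterate_val (by simp)]
    rw [Nat.mod_eq_of_lt (by simp only; omega)]
    simp only
    omega
  · rw [Fin.ext_iff, transition_a_iterate_val (by simp)]
    rw [Nat.mod_eq_of_lt (by simp only; omega)]
    simp only
    omega

theorem realized_swap_one (hΛ : ∀ l, l ≠ Input.e → l ∈ Λ)
    {j : ℕ} (h1 : 2 ≤ j) (h2 : j < n) :
    Realized (relabeledDFA hn some) Λ (Equiv.swap (oneState hn) ⟨j, h2⟩) := by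
  induction j, h1 using Nat.le_induction with
  | base => exact realized_swap_succ hΛ le_rfl h2
  | succ j hj ih =>
    have hs := realized_swap_succ (hn := hn) hΛ (j := j) (by omega) h2
    convert (hs.comp (ih (by omega))).comp hs using 1
    have : Equiv.swap (oneState hn) (⟨j + 1, h2⟩ : Fin n) =
        Equiv.swap ⟨j, by omega⟩ ⟨j + 1, h2⟩ * Equiv.swap (oneState hn) ⟨j, by omega⟩ *
          Equiv.swap ⟨j, by omega⟩ ⟨j + 1, h2⟩ := by
      rw [Equiv.swap_mul_swap_mul_swap, Equiv.swap_comm]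
      · simp [oneState, Fin.ext_iff]; omega
      · simp [oneState, Fin.ext_iff]; omega
    rw [this]
    rfl

/-- Transpositions with 1 suffice, by (p q) = (1 p)(1 q)(1 p). -/
theorem realized_swap (hΛ : ∀ l, l ≠ Input.e → l ∈ Λ)
    {p q : Fin n} (hp : p ≠ zeroState hn) (hq : q ≠ zeroState hn) :
    Realized (relabeledDFA hn some) Λ (Equiv.swap p q) := by
  have key : ∀ r : Fin n, r ≠ zeroState hn →
      Realized (relabeledDFA hn some) Λ (Equiv.swap (oneState hn) r) := by
    intro r hr
    rw [ne_zeroState_iff] at hr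
    rcases Nat.lt_or_ge r.val 2 with h | h
    · have : oneState hn = r := Fin.ext (by simp only [oneState]; omega)
      rw [← this, Equiv.swap_self]
      exact realized_id
    · exact realized_swap_one hΛ h r.isLt
  by_cases hpq : p = q
  · subst hpq
    rw [Equiv.swap_self]
    exact realized_id
  by_cases hq1 : oneState hn = q
  · subst hq1
    rw [Equiv.swap_comm]
    exact key p hp
  convert ((key p hp).comp (key q hq)).comp (key p hp) using 1
  have : Equiv.swap p q = Equiv.swap (oneState hn) p * Equiv.swap (oneState hn) q *
      Equiv.swap (oneState hn) p := by
    rw [Equiv.swap_comm (oneState hn) q,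
      Equiv.swap_mul_swap_mul_swap (Ne.symm hq1) (Ne.symm hpq)]
  rw [this]
  rfl

theorem realized_perm (hΛ : ∀ l, l ≠ Input.e → l ∈ Λ)
    (f : Equiv.Perm (Fin n)) (hf : f (zeroState hn) = zeroState hn) :
    Realized (relabeledDFA hn some) Λ f := by
  have key : ∀ g : Equiv.Perm {q : Fin n // q ≠ zeroState hn},
      Realized (relabeledDFA hn some) Λ (Equiv.Perm.ofSubtype g) := by
    intro g
    induction g using Equiv.Perm.swap_induction_on with
    | one => rw [map_one]; exact realized_id
    | swap_mul g x y _ ih =>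
      rw [map_mul, Equiv.Perm.ofSubtype_swap_eq]
      exact ih.comp (realized_swap hΛ x.2 y.2)
  have h1 : ∀ q, f q ≠ zeroState hn ↔ q ≠ zeroState hn := fun q => by
    rw [Ne, Ne, ← f.injective.eq_iff (a := q), hf]
  have h2 := key (f.subtypePerm h1)
  rwa [Equiv.Perm.ofSubtype_subtypePerm h1 (by rintro q hq rfl; exact hq hf)] at h2

theorem realized_update_of_realized_swap (hΛ : ∀ l, l ≠ Input.e → l ∈ Λ)
    {p q i j : Fin n} (hi : i ≠ zeroState hn)
    (hj : j ≠ zeroState hn)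
    (h : Realized (relabeledDFA hn some) Λ (Function.update id p q)) :
    Realized (relabeledDFA hn some) Λ
      (Function.update id (Equiv.swap i j p) (Equiv.swap i j q)) := by
  convert ((realized_swap hΛ hi hj).comp h).comp (realized_swap hΛ hi hj) using 1
  funext r
  simp only [Function.comp_apply]
  by_cases hr : r = Equiv.swap i j p
  · subst hr
    simp
  · have : Equiv.swap i j r ≠ p := by
      rintro rfl
      simp at hr
    rw [Function.update_of_ne hr, Function.update_of_ne this]
    simp

/-- Reassigning the value of a single state. -/
theorem realized_update (hΛ : ∀ l, l ≠ Input.e → l ∈ Λ)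
    {p q : Fin n} (hp : p ≠ zeroState hn) :
    Realized (relabeledDFA hn some) Λ (Function.update id p q) := by
  by_cases hpq : p = q
  · subst hpq
    rw [show Function.update id p p = id from Function.update_eq_self p id]
    exact realized_id
  by_cases hq : q = zeroState hn
  · subst hq
    exact (realized_update_zeroState (ρ := some) (la := .a) (ld := .d) rfl rfl hp).mono
      (by rintro l (rfl | rfl) <;> exact hΛ _ (by simp))
  set last : Fin n := ⟨n - 1, by omega⟩ with hlast
  have hlast0 : last ≠ zeroState hn := by
    rw [ne_zeroState_iff]
    simp only [hlast]
    omega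
  have hone0 := (zeroState_ne_oneState hn).symm
  have hlast1 : last ≠ oneState hn := by
    rw [Ne, Fin.ext_iff]
    simp only [hlast, oneState]
    omega
  have hc : Realized (relabeledDFA hn some) Λ (Function.update id last (oneState hn)) := by
    convert realized_transition (hn := hn) (ρ := some) (l := Input.c) rfl
      (hΛ _ (by simp)) using 1
    funext r
    by_cases hr : r = last
    · rw [hr, Function.update_self, transition_c_of_eq rfl]
    · rw [Function.update_of_ne hr, transition_c_of_ne fun h => hr (Fin.ext h), id]
  have hq' : Equiv.swap p last q ≠ zeroState hn := by
    rw [Equiv.swap_apply_def]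
    split_ifs <;> assumption
  have hq'' : last ≠ Equiv.swap p last q := by
    intro h
    have := congrArg (Equiv.swap p last) h
    rw [Equiv.swap_apply_right, Equiv.swap_apply_self] at this
    exact hpq this
  -- The letter c sends n-1 to 1. The first conjugation moves the target 1 to the mirror image of
  -- `q` under (p, n-1); the second moves the source n-1 to `p` and that image back to `q`.
  have h1 := realized_update_of_realized_swap hΛ hone0 hq' hc
  rw [Equiv.swap_apply_of_ne_of_ne hlast1 hq'', Equiv.swap_apply_left] at h1
  have h2 := realized_update_of_realized_swap hΛ hp hlast0 h1
  rwa [Equiv.swap_apply_right, Equiv.swap_apply_self] at h2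

/-- Induction on the number of missing values. A non-injective map takes a value twice, at some
nonzero `p`, and misses some `r`. Redirecting `p` to `r` enlarges the image, and afterwards `r` is
sent to the old value of `p`. -/
theorem realized_of_zeroState_fixed (hΛ : ∀ l, l ≠ Input.e → l ∈ Λ)
    (f : Fin n → Fin n)
    (hf : f (zeroState hn) = zeroState hn) : Realized (relabeledDFA hn some) Λ f := by
  classical
  induction hk : (Finset.univ.image f)ᶜ.card using Nat.strong_induction_on generalizing f with
  | _ k ih =>
    by_cases hinj : Function.Injective f
    · exact realized_perm hΛ (Equiv.ofBijective f (Finite.injective_iff_bijective.1 hinj)) hf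
    · obtain ⟨p, p', hpp', hne⟩ : ∃ p p', f p = f p' ∧ p ≠ p' := by
        simpa [Function.Injective] using hinj
      wlog hp : p ≠ zeroState hn generalizing p p'
      · exact this p' p hpp'.symm hne.symm fun h => hne ((not_not.1 hp).trans h.symm)
      obtain ⟨r, hr⟩ : ∃ r, ∀ q, f q ≠ r := by
        have : ¬ Function.Surjective f := fun h => hinj (Finite.injective_iff_surjective.2 h)
        simpa [Function.Surjective] using this
      have hr0 : r ≠ zeroState hn := fun h => hr _ (hf.trans h.symm)
      have himage : Finset.univ.image (Function.update f p r) =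
          insert r (Finset.univ.image f) := by
        ext s
        simp only [Finset.mem_image, Finset.mem_univ, true_and, Finset.mem_insert]
        constructor
        · rintro ⟨q, rfl⟩
          by_cases hq : q = p
          · subst hq
            simp
          · exact .inr ⟨q, by rw [Function.update_of_ne hq]⟩
        · rintro (rfl | ⟨q, rfl⟩)
          · exact ⟨p, Function.update_self ..⟩
          · by_cases hq : q = p
            · exact ⟨p', by rw [Function.update_of_ne hne.symm, hq, hpp']⟩
            · exact ⟨q, Function.update_of_ne hq ..⟩
      have hlt : (Finset.univ.image (Function.update f p r))ᶜ.card < k := by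
        rw [← hk, himage]
        refine Finset.card_lt_card (Finset.compl_ssubset_compl.2 (Finset.ssubset_insert ?_))
        simpa using hr
      have h1 := ih _ hlt (Function.update f p r)
        (by rw [Function.update_of_ne hp.symm, hf]) rfl
      convert h1.comp (realized_update hΛ (q := f p) hr0) using 1
      funext q
      simp only [Function.comp_apply]
      by_cases hq : q = p
      · subst hq
        simp
      · rw [Function.update_of_ne hq, Function.update_of_ne (hr q), id]

end FullTransformation

/-! ### The syntactic semigroup of M_n -/

section SyntacticSemigroupWitness

variable {n : ℕ} {hn : 4 ≤ n}

theorem words_M : words (M n hn) = Set.univ := by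
  ext w
  rw [M_eq_stateLanguage]
  exact ⟨fun _ => trivial, fun _ => (mem_words_stateLanguage (le := .e) rfl).2 (by simp)⟩

theorem card_syntacticSemigroup_M :
    ENat.card (SyntacticSemigroup (M n hn)) = ((n ^ (n - 1) + n - 1 : ℕ) : ℕ∞) := by
  have hM := M_eq_stateLanguage (hn := hn)
  have hinj := stateLanguage_injective (hn := hn) (ρ := some) (la := .a) (ld := .d) rfl rfl
  have hquot : ∀ q, stateLanguage hn some q ∈ quotients (M n hn) := fun q => by
    rw [hM, quotients_stateLanguage (la := .a) (ld := .d) (le := .e) rfl rfl rfl]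
    exact ⟨q, rfl⟩
  let s : Fin n ≃ quotients (M n hn) := Equiv.ofBijective (fun q => ⟨_, hquot q⟩) <| by
    refine ⟨fun p q h => hinj (congrArg Subtype.val h), ?_⟩
    rintro ⟨K, hK⟩
    have hK' := hK
    rw [hM, quotients_stateLanguage (la := .a) (ld := .d) (le := .e) rfl rfl rfl] at hK'
    obtain ⟨q, rfl⟩ := hK'
    exact ⟨q, rfl⟩
  let c : (Fin n → Fin n) → quotients (M n hn) → quotients (M n hn) :=
    fun f => s ∘ f ∘ s.symm
  have hc : Function.Injective c := fun f g h => by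
    funext q
    simpa [c] using congrFun h (s q)
  have hmap : ∀ w : NonemptyWord (M n hn),
      quotientMap w = c fun q => (relabeledDFA hn some).evalFrom q w.1 := by
    intro w
    funext K
    obtain ⟨q, rfl⟩ := s.surjective K
    simp only [c, Function.comp_apply, Equiv.symm_apply_apply]
    exact Subtype.ext (leftQuotient_stateLanguage (by simp))
  have hone := (zeroState_ne_oneState hn).symm
  have hrange : Set.range (quotientMap : NonemptyWord (M n hn) → _) =
      c '' ({f | f (zeroState hn) = zeroState hn} ∪
        Function.const (Fin n) '' {zeroState hn}ᶜ) := by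
    ext t
    constructor
    · rintro ⟨w, rfl⟩
      refine ⟨_, ?_, (hmap w).symm⟩
      by_cases h0 : (relabeledDFA hn some).evalFrom (zeroState hn) w.1 = zeroState hn
      · exact .inl h0
      · rcases evalFrom_zeroState_or_const (hn := hn) (ρ := some) w.1 with h | h
        · exact absurd h h0
        · exact .inr ⟨_, h0, funext fun q => h _ _⟩
    · rintro ⟨f, hf, rfl⟩
      suffices ∃ w : List Input, w ≠ [] ∧ ∀ q, (relabeledDFA hn some).evalFrom q w = f q by
        obtain ⟨w, hw0, hw⟩ := this
        refine ⟨⟨w, hw0, by rw [words_M]; trivial⟩, ?_⟩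
        rw [hmap]
        congr 1
        exact funext hw
      rcases hf with hf | ⟨q, hq, rfl⟩
      · obtain ⟨w, -, hw⟩ := realized_of_zeroState_fixed (hn := hn) (Λ := Set.univ) (by simp) f hf
        -- The prefix bb acts as the identity and makes the word nonempty.
        refine ⟨.b :: .b :: w, by simp, fun q => ?_⟩
        rw [DFA.evalFrom_cons, DFA.evalFrom_cons, relabeledDFA_step rfl, relabeledDFA_step rfl, hw]
        simp [transition]
      · obtain ⟨k, hk⟩ := exists_transition_a_iterate_eq hone hq
        obtain ⟨w, -, hw⟩ := (realized_transition (hn := hn) (ρ := some) (Λ := Set.univ)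
          (l := Input.a) rfl trivial).iterate k
        refine ⟨.e :: w, by simp, fun p => ?_⟩
        rw [DFA.evalFrom_cons, relabeledDFA_step rfl, transition_e, hw, hk]
        rfl
  rw [card_syntacticSemigroup, hrange, hc.encard_image,
    ← Set.Finite.cast_ncard_eq (Set.toFinite _),
    ncard_fixing_or_const _ (by rw [Fintype.card_fin]; omega), Fintype.card_fin]

end SyntacticSemigroupWitness

/-! ### The atoms of M_n -/

section AtomsOfWitness

theorem exists_map_onto {γ : Type*} {T X : Finset γ} (d : γ) (h : X.card ≤ T.card) :
    ∃ f : γ → γ, (∀ q ∈ T, f q = d ∨ f q ∈ X) ∧ ∀ x ∈ X, ∃ q ∈ T, f q = x := by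
  classical
  obtain ⟨U, hU, hcard⟩ := Finset.exists_subset_card_eq h
  let e := Finset.equivOfCardEq hcard
  refine ⟨fun q => if hq : q ∈ U then e ⟨q, hq⟩ else d, fun q _ => ?_, fun x hx => ?_⟩
  · dsimp only
    split_ifs with hq
    · exact .inr (e ⟨q, hq⟩).2
    · exact .inl rfl
  · refine ⟨e.symm ⟨x, hx⟩, hU (e.symm ⟨x, hx⟩).2, ?_⟩
    simp

theorem card_le_complexity {α ι : Type*} {A : Language α} (F : Finset ι) (enc : ι → Language α)
    (hq : ∀ i ∈ F, enc i ∈ quotients A) (hinj : Set.InjOn enc F) :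
    (F.card : ℕ∞) ≤ complexity A := by
  rw [← Set.encard_coe_eq_coe_finsetCard, ← hinj.encard_image]
  refine Set.encard_le_encard ?_
  rintro _ ⟨i, hi, rfl⟩
  exact hq i hi

theorem card_add_one_le_complexity {α ι : Type*} {A : Language α} (F : Finset ι)
    (enc : ι → Language α) (hq : ∀ i ∈ F, enc i ∈ quotients A) (hinj : Set.InjOn enc F)
    (h0 : 0 ∈ quotients A) (hne : ∀ i ∈ F, ∃ x, x ∈ enc i) :
    ((1 + F.card : ℕ) : ℕ∞) ≤ complexity A := by
  have hnot : (0 : Language α) ∉ enc '' F := by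
    rintro ⟨i, hi, e⟩
    obtain ⟨x, hx⟩ := hne i hi
    rw [e] at hx
    exact Language.notMem_zero x hx
  have : ((1 + F.card : ℕ) : ℕ∞) = (insert 0 (enc '' F)).encard := by
    rw [Set.encard_insert_of_notMem hnot, hinj.encard_image, Set.encard_coe_eq_coe_finsetCard,
      add_comm]
    push_cast
    rfl
  rw [this]
  refine Set.encard_le_encard (Set.insert_subset h0 ?_)
  rintro _ ⟨i, hi, rfl⟩
  exact hq i hi

variable {n : ℕ} {hn : 4 ≤ n}

/-- The words that move all states of `X` to final states and all states of `Y`, as well as `0`, to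
`0`. -/
def transporters (hn : 4 ≤ n) (X Y : Finset (Fin n)) : Language Input :=
  {x | (∀ q ∈ X, (relabeledDFA hn some).evalFrom q x ≠ zeroState hn) ∧
    (relabeledDFA hn some).evalFrom (zeroState hn) x = zeroState hn ∧
    ∀ q ∈ Y, (relabeledDFA hn some).evalFrom q x = zeroState hn}

theorem mem_transporters {X Y : Finset (Fin n)} {x : List Input} : x ∈ transporters hn X Y ↔
    (∀ q ∈ X, (relabeledDFA hn some).evalFrom q x ≠ zeroState hn) ∧
    (relabeledDFA hn some).evalFrom (zeroState hn) x = zeroState hn ∧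
    ∀ q ∈ Y, (relabeledDFA hn some).evalFrom q x = zeroState hn := Iff.rfl

/-- Every characteristic function of a set of states without `0` is induced by a word. -/
theorem exists_word_char (T : Finset (Fin n)) (hT : zeroState hn ∉ T) :
    ∃ w : List Input, (∀ l ∈ w, l ≠ Input.e) ∧ ∀ q, (relabeledDFA hn some).evalFrom q w =
      if q ∈ T then oneState hn else zeroState hn :=
  realized_of_zeroState_fixed (Λ := {l | l ≠ Input.e}) (fun _ h => h)
    (fun q => if q ∈ T then oneState hn else zeroState hn) (by simp [hT])

/-- Two characteristic functions recover the pair: that of X detects any further element of the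
first set, and that of the complement of Y ∪ {0} any further element of the second. -/
theorem transporters_injOn : Set.InjOn
    (fun p : Finset (Fin n) × Finset (Fin n) => transporters hn p.1 p.2)
    {p | p.1 ⊆ Finset.univ.erase (zeroState hn) ∧ p.2 ⊆ Finset.univ.erase (zeroState hn) ∧
      Disjoint p.1 p.2} := by
  have hne := zeroState_ne_oneState hn
  have key : ∀ X Y X' Y' : Finset (Fin n), X' ⊆ Finset.univ.erase (zeroState hn) →
      Y ⊆ Finset.univ.erase (zeroState hn) → Disjoint X' Y' →
      transporters hn X Y = transporters hn X' Y' → X ⊆ X' ∧ Y ⊆ Y' := by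
    intro X Y X' Y' hX' hY hdisj h
    constructor
    · intro p hp
      by_contra hpX'
      have h0 : zeroState hn ∉ X' := fun h0 => by simpa using hX' h0
      obtain ⟨w, -, hw⟩ := exists_word_char X' h0
      have hmem : w ∈ transporters hn X' Y' := by
        refine ⟨fun q hq => ?_, ?_, fun q hq => ?_⟩
        · rw [hw, if_pos hq]
          exact hne.symm
        · rw [hw, if_neg h0]
        · rw [hw, if_neg (Finset.disjoint_right.1 hdisj hq)]
      rw [← h] at hmem
      exact hmem.1 p hp (by rw [hw, if_neg hpX'])
    · intro p hp
      by_contra hpY'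
      have hp0 : p ≠ zeroState hn := by simpa using hY hp
      obtain ⟨w, -, hw⟩ := exists_word_char (insert (zeroState hn) Y')ᶜ (by simp)
      have hmem : w ∈ transporters hn X' Y' := by
        refine ⟨fun q hq => ?_, ?_, fun q hq => ?_⟩
        · have hq0 : q ≠ zeroState hn := by simpa using hX' hq
          rw [hw, if_pos (by simpa [hq0] using Finset.disjoint_left.1 hdisj hq)]
          exact hne.symm
        · rw [hw, if_neg (by simp)]
        · rw [hw, if_neg (by simp [hq])]
      rw [← h] at hmem
      have h1 := hmem.2.2 p hp
      rw [hw, if_pos (by simp [hp0, hpY'])] at h1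
      exact hne h1.symm
  rintro ⟨X, Y⟩ ⟨hX, hY, hd⟩ ⟨X', Y'⟩ ⟨hX', hY', hd'⟩ h
  obtain ⟨h1, h2⟩ := key X Y X' Y' hX' hY hd' h
  obtain ⟨h3, h4⟩ := key X' Y' X Y hX hY' hd h.symm
  rw [Prod.mk.injEq]
  exact ⟨h1.antisymm h3, h2.antisymm h4⟩

/-- The words that move exactly the states of `T` to final states. -/
def atomOfStates (hn : 4 ≤ n) (T : Finset (Fin n)) : Language Input :=
  {x | ∀ q, (relabeledDFA hn some).evalFrom q x ≠ zeroState hn ↔ q ∈ T}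

theorem mem_atomOfStates {T : Finset (Fin n)} {x : List Input} : x ∈ atomOfStates hn T ↔
    ∀ q, (relabeledDFA hn some).evalFrom q x ≠ zeroState hn ↔ q ∈ T := Iff.rfl

theorem letters_atomOfStates_empty : letters (atomOfStates hn ∅) = Set.univ := by
  refine Set.eq_univ_of_forall fun l => ?_
  obtain ⟨w, -, hw⟩ := exists_word_char (hn := hn) ∅ (by simp)
  refine ⟨l :: w, fun q => ?_, by simp⟩
  rw [DFA.evalFrom_cons, hw]
  simp

/-- After a word that sends `T` to 1 and the rest to 0, any letter but e keeps 1 nonzero and 0 at 0.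
-/
theorem mem_letters_atomOfStates {T : Finset (Fin n)} (hT : zeroState hn ∉ T) {l : Input}
    (hl : l ≠ .e) : l ∈ letters (atomOfStates hn T) := by
  obtain ⟨w, -, hw⟩ := exists_word_char T hT
  refine ⟨w ++ [l], fun q => ?_, by simp⟩
  rw [DFA.evalFrom_of_append, DFA.evalFrom_singleton, relabeledDFA_step rfl, hw]
  have hone : transition n hn (oneState hn) l ≠ zeroState hn := by
    have h1 : (oneState hn).val ≠ n - 1 := by simp only [oneState]; omega
    have hne := (zeroState_ne_oneState hn).symm
    cases l with
    | a => exact transition_a_iterate_ne_zeroState hne 1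
    | b => simp [transition, oneState, zeroState]
    | c => rwa [transition_c_of_ne h1]
    | d => rwa [transition_d_of_ne h1]
    | e => exact hne
  split_ifs with h
  · simp [h, hone]
  · simp [h, transition_zeroState hl]

theorem le_complexity_atomOfStates_empty :
    ((2 ^ (n - 1) : ℕ) : ℕ∞) ≤ complexity (atomOfStates hn ∅) := by
  classical
  have hcard : (2 ^ (n - 1) : ℕ) = (Finset.univ.erase (zeroState hn)).powerset.card := by
    rw [Finset.card_powerset, Finset.card_erase_of_mem (Finset.mem_univ _), Finset.card_univ,
      Fintype.card_fin]
  rw [hcard]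
  refine card_le_complexity _ (fun Y => transporters hn ∅ Y) ?_ ?_
  · intro Y hY
    obtain ⟨w, -, hw⟩ := realized_of_zeroState_fixed (hn := hn) (Λ := Set.univ) (by simp)
      (fun q => if q ∈ Y then q else zeroState hn) (by simp)
    refine ⟨w, fun l _ => by rw [letters_atomOfStates_empty]; trivial, ?_⟩
    ext x
    symm
    rw [Language.mem_leftQuotient, mem_atomOfStates, mem_transporters]
    simp only [DFA.evalFrom_of_append, hw, Finset.notMem_empty, iff_false, not_not, false_imp_iff,
      implies_true, true_and]
    constructor
    · intro h
      refine ⟨?_, fun q hq => by simpa [hq] using h q⟩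
      simpa using h (zeroState hn)
    · rintro ⟨h1, h2⟩ q
      split_ifs with hq
      · exact h2 q hq
      · exact h1
  · intro Y hY Y' hY' h
    rw [Finset.mem_coe, Finset.mem_powerset] at hY hY'
    have := transporters_injOn (hn := hn) (x₁ := (∅, Y)) (x₂ := (∅, Y'))
      ⟨by simp, hY, by simp⟩ ⟨by simp, hY', by simp⟩ h
    exact (Prod.mk.inj this).2

/-- Some map fixing 0 sends `T` onto X and the complement of `T` onto Y ∪ {0}, which is possible
exactly because of the size restrictions. Words without e are used because their letters are known
to occur in the atom. -/
theorem le_complexity_atomOfStates {T : Finset (Fin n)} (hT : zeroState hn ∉ T)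
    (hne : T.Nonempty) :
    ((1 + (disjointPairs (Finset.univ.erase (zeroState hn)) T.card (n - T.card - 1)).card : ℕ) :
      ℕ∞) ≤ complexity (atomOfStates hn T) := by
  classical
  have hwords : ∀ w : List Input, (∀ l ∈ w, l ≠ Input.e) → w ∈ words (atomOfStates hn T) :=
    fun w hw l hl => mem_letters_atomOfStates hT (hw l hl)
  refine card_add_one_le_complexity _ (fun p => transporters hn p.1 p.2) ?_ ?_ ?_ ?_
  · rintro ⟨X, Y⟩ hp
    rw [mem_disjointPairs] at hp
    obtain ⟨⟨hX, hY⟩, hdisj, ⟨hX1, hXs⟩, hYt⟩ := hp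
    dsimp only at hX hY hdisj hX1 hXs hYt ⊢
    obtain ⟨x₀, hx₀⟩ := Finset.card_pos.1 hX1
    obtain ⟨f, hf1, hf2⟩ := exists_map_onto x₀ hXs
    have hTc : (Tᶜ.erase (zeroState hn)).card = n - T.card - 1 := by
      rw [Finset.card_erase_of_mem (by simpa using hT), Finset.card_compl, Fintype.card_fin]
    obtain ⟨g, hg1, hg2⟩ := exists_map_onto (zeroState hn) (hTc ▸ hYt)
    let t : Fin n → Fin n := fun q =>
      if q ∈ T then f q else if q = zeroState hn then zeroState hn else g q
    obtain ⟨w, hwe, hw⟩ := realized_of_zeroState_fixed (hn := hn) (Λ := {l | l ≠ Input.e})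
      (fun _ h => h) t (by simp [t, hT])
    refine ⟨w, hwords w hwe, ?_⟩
    ext x
    symm
    rw [Language.mem_leftQuotient, mem_atomOfStates, mem_transporters]
    simp only [DFA.evalFrom_of_append, hw]
    constructor
    · intro h
      have h' : ∀ q, q ∉ T → (relabeledDFA hn some).evalFrom (t q) x = zeroState hn :=
        fun q hq => by_contra fun h0 => hq ((h q).1 h0)
      refine ⟨fun q hq => ?_, by simpa [t, hT] using h' _ hT, fun q hq => ?_⟩
      · obtain ⟨r, hr, rfl⟩ := hf2 q hq
        simpa [t, hr] using (h r).2 hr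
      · obtain ⟨r, hr, rfl⟩ := hg2 q hq
        rw [Finset.mem_erase, Finset.mem_compl] at hr
        simpa [t, hr.1, hr.2] using h' r hr.2
    · rintro ⟨h1, h2, h3⟩ q
      by_cases hq : q ∈ T
      · simp only [t, hq, if_true, iff_true]
        refine h1 _ ?_
        rcases hf1 q hq with h | h
        · rwa [h]
        · exact h
      · simp only [t, hq, if_false, iff_false, not_not]
        split_ifs with hq0
        · exact h2
        · rcases hg1 q (by simp [hq, hq0]) with h | h
          · rwa [h]
          · exact h3 _ h
  · refine transporters_injOn.mono ?_
    intro p hp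
    rw [Finset.mem_coe, mem_disjointPairs] at hp
    exact ⟨hp.1.1, hp.1.2, hp.2.1⟩
  -- The empty quotient arises from the map to 0, which merges a state of `T` with the state 0
  -- outside `T`.
  · obtain ⟨w, hwe, hw⟩ := exists_word_char (hn := hn) ∅ (by simp)
    refine ⟨w, hwords w hwe, ?_⟩
    obtain ⟨q, hq⟩ := hne
    ext x
    rw [Language.mem_leftQuotient, mem_atomOfStates]
    simp only [Language.notMem_zero, false_iff, DFA.evalFrom_of_append, hw, Finset.notMem_empty,
      if_false]
    intro h
    exact hT ((h (zeroState hn)).1 ((h q).2 hq))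
  · rintro ⟨X, Y⟩ hp
    rw [mem_disjointPairs] at hp
    have h0 : zeroState hn ∉ X := fun h0 => by simpa using hp.1.1 h0
    obtain ⟨w, -, hw⟩ := exists_word_char X h0
    refine ⟨w, fun q hq => ?_, ?_, fun q hq => ?_⟩
    · rw [hw, if_pos hq]
      exact (zeroState_ne_oneState hn).symm
    · rw [hw, if_neg h0]
    · rw [hw, if_neg (Finset.disjoint_right.1 hp.2.1 hq)]

theorem isLeftIdeal_M : IsLeftIdeal (M n hn) := by
  rw [M_eq_stateLanguage]
  exact isLeftIdeal_stateLanguage (le := .e) rfl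

theorem complexity_M : complexity (M n hn) = n := by
  rw [M_eq_stateLanguage]
  exact complexity_stateLanguage (la := .a) (ld := .d) (le := .e) rfl rfl rfl _

theorem quotients_M : quotients (M n hn) = Set.range (stateLanguage hn some) := by
  rw [M_eq_stateLanguage]
  exact quotients_stateLanguage (la := .a) (ld := .d) (le := .e) rfl rfl rfl _

theorem complexity_atomOf_M {S : Set (Language Input)} (hS : S ⊆ quotients (M n hn))
    (hA : atomOf (M n hn) S ∈ atoms (M n hn)) :
    complexity (atomOf (M n hn) S) = (atomBound n S.ncard : ℕ∞) := by
  classical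
  refine (isLeftIdeal_M.complexity_atomOf_le complexity_M hS hA).antisymm ?_
  have hinj := stateLanguage_injective (hn := hn) (ρ := some) (la := .a) (ld := .d) rfl rfl
  by_cases hzero : M n hn ∈ S
  · have hSeq := isLeftIdeal_M.eq_quotients_of_self_mem hS hA hzero
    have hcard : S.ncard = n := by
      have h := complexity_M (hn := hn)
      rw [complexity, ← hSeq] at h
      rw [Set.ncard_def, h, ENat.toNat_natCast]
    rw [hcard, hSeq, isLeftIdeal_M.atomOf_quotients, complexity_M, atomBound, if_pos rfl]
  let T : Finset (Fin n) := Finset.univ.filter fun q => stateLanguage hn some q ∈ S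
  have hT : ∀ q, q ∈ T ↔ stateLanguage hn some q ∈ S := fun q => by simp [T]
  have hST : S = stateLanguage hn some '' T := by
    ext K
    constructor
    · intro hK
      have hK' := hS hK
      rw [quotients_M] at hK'
      obtain ⟨q, rfl⟩ := hK'
      exact ⟨q, (hT q).2 hK, rfl⟩
    · rintro ⟨q, hq, rfl⟩
      exact (hT q).1 hq
  have hT0 : zeroState hn ∉ T := by
    rw [hT, ← M_eq_stateLanguage]
    exact hzero
  have hcard : S.ncard = T.card := by
    rw [hST, Set.ncard_image_of_injective _ hinj, Set.ncard_coe_finset]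
  have hatom : atomOf (M n hn) S = atomOfStates hn T := by
    ext x
    rw [mem_atomOf, mem_atomOfStates, quotients_M, words_M]
    simp only [Set.forall_mem_range, ← hT, mem_stateLanguage]
    simp only [Option.isSome_some, implies_true, true_and]
    exact and_iff_right trivial
  rw [hcard, hatom]
  rcases T.eq_empty_or_nonempty with hTe | hne
  · rw [hTe, Finset.card_empty, atomBound, if_neg (by omega), if_pos rfl]
    exact le_complexity_atomOfStates_empty
  · have hlt : T.card < n := by
      have := Finset.card_lt_univ_of_notMem hT0
      rwa [Fintype.card_fin] at this
    rw [atomBound_eq_card (T := Finset.univ.erase (zeroState hn)) _ hne.card_pos.ne' hlt]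
    · exact le_complexity_atomOfStates hT0 hne
    · rw [Finset.card_erase_of_mem (Finset.mem_univ _), Finset.card_univ, Fintype.card_fin]

end AtomsOfWitness

/-! ### Runs with a sink, for operands over different alphabets -/

section PartialRun

variable {n : ℕ} (hn : 4 ≤ n) {β : Type*} (ρ : β → Option Input)

/-- The run of the partial automaton over the domain of `ρ`, where `none` is the sink state. -/
def partialRun (s : Option (Fin n)) (w : List β) : Option (Fin n) :=
  w.foldl (fun s l => s.bind fun q => (ρ l).map (transition n hn q)) s

/-- A state is final if it is neither `0` nor the sink state. -/
def IsFinal (s : Option (Fin n)) : Prop := ∃ q, s = some q ∧ q ≠ zeroState hn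

variable {hn ρ}

@[simp] theorem isFinal_some {q : Fin n} : IsFinal hn (some q) ↔ q ≠ zeroState hn := by
  simp [IsFinal]

@[simp] theorem not_isFinal_none : ¬ IsFinal hn none := by
  simp [IsFinal]

@[simp] theorem partialRun_none (w : List β) : partialRun hn ρ none w = none := by
  induction w with
  | nil => rfl
  | cons l w ih => exact ih

@[simp] theorem partialRun_nil (s : Option (Fin n)) : partialRun hn ρ s [] = s := rfl

theorem partialRun_cons_none {l : β} (h : ρ l = none) (s : Option (Fin n)) (w : List β) :
    partialRun hn ρ s (l :: w) = none := by
  change partialRun hn ρ (s.bind fun q => (ρ l).map (transition n hn q)) w = none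
  cases s <;> simp [h]

theorem partialRun_cons_some {l : β} {i : Input} (h : ρ l = some i) (q : Fin n) (w : List β) :
    partialRun hn ρ (some q) (l :: w) = partialRun hn ρ (some (transition n hn q i)) w := by
  change partialRun hn ρ ((some q).bind fun q => (ρ l).map (transition n hn q)) w = _
  simp [h]

theorem partialRun_some {w : List β} (h : ∀ l ∈ w, (ρ l).isSome) (q : Fin n) :
    partialRun hn ρ (some q) w = some ((relabeledDFA hn ρ).evalFrom q w) := by
  induction w generalizing q with
  | nil => rfl
  | cons l w ih =>
    obtain ⟨i, hi⟩ := Option.isSome_iff_exists.1 (h l (by simp))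
    rw [partialRun_cons_some hi, DFA.evalFrom_cons, relabeledDFA_step hi]
    exact ih (fun m hm => h m (by simp [hm])) _

theorem partialRun_eq_none {w : List β} (h : ¬ ∀ l ∈ w, (ρ l).isSome) (s : Option (Fin n)) :
    partialRun hn ρ s w = none := by
  induction w generalizing s with
  | nil => simp at h
  | cons l w ih =>
    rcases hl : ρ l with _ | i
    · exact partialRun_cons_none hl s w
    · cases s with
      | none => exact partialRun_none _
      | some q =>
        rw [partialRun_cons_some hl]
        exact ih (fun h' => h (by simp [hl]; exact h')) _

theorem mem_stateLanguage_iff_isFinal {q : Fin n} {w : List β} :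
    w ∈ stateLanguage hn ρ q ↔ IsFinal hn (partialRun hn ρ (some q) w) := by
  rw [mem_stateLanguage]
  by_cases h : ∀ l ∈ w, (ρ l).isSome
  · rw [partialRun_some h, isFinal_some]
    exact and_iff_right h
  · rw [partialRun_eq_none h]
    exact iff_of_false (fun h' => h h'.1) not_isFinal_none

end PartialRun

/-! ### The product automaton of two dialects -/

section Product

variable {m n : ℕ} {hm : 4 ≤ m} {hn : 4 ≤ n} {β : Type*} {ρ ρ' : β → Option Input}

/-- The complexity of a boolean combination is the number of states of the accessible and reduced
part of the product automaton. -/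
theorem complexity_of_op {op : Prop → Prop → Prop} {L : Language β}
    (hL : ∀ v, v ∈ L ↔ op (v ∈ stateLanguage hm ρ (zeroState hm))
      (v ∈ stateLanguage hn ρ' (zeroState hn)))
    (R : Set (Option (Fin m) × Option (Fin n)))
    (hmaps : ∀ w ∈ words L, (partialRun hm ρ (some (zeroState hm)) w,
      partialRun hn ρ' (some (zeroState hn)) w) ∈ R)
    (hreach : ∀ s t, (s, t) ∈ R → ∃ w ∈ words L, partialRun hm ρ (some (zeroState hm)) w = s ∧
      partialRun hn ρ' (some (zeroState hn)) w = t)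
    (hdist : ∀ s t, (s, t) ∈ R → ∀ s' t', (s', t') ∈ R → (s ≠ s' ∨ s = s' ∧ t ≠ t') →
      ∃ v ∈ words L,
        ¬ (op (IsFinal hm (partialRun hm ρ s v)) (IsFinal hn (partialRun hn ρ' t v)) ↔
          op (IsFinal hm (partialRun hm ρ s' v)) (IsFinal hn (partialRun hn ρ' t' v)))) :
    complexity L = R.encard := by
  let A : DFA β (Option (Fin m) × Option (Fin n)) :=
    { step := fun x l => (partialRun hm ρ x.1 [l], partialRun hn ρ' x.2 [l])
      start := (some (zeroState hm), some (zeroState hn))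
      accept := {x | op (IsFinal hm x.1) (IsFinal hn x.2)} }
  have hA : ∀ w x, A.evalFrom x w = (partialRun hm ρ x.1 w, partialRun hn ρ' x.2 w) := by
    intro w
    induction w with
    | nil => exact fun x => rfl
    | cons l w ih =>
      intro x
      rw [DFA.evalFrom_cons, ih]
      rfl
  refine complexity_eq_encard A R ?_ ?_ ?_ ?_
  · intro w _
    rw [hL, mem_stateLanguage_iff_isFinal, mem_stateLanguage_iff_isFinal, DFA.eval, hA]
    rfl
  · intro w hw
    rw [DFA.eval, hA]
    exact hmaps w hw
  · rintro ⟨s, t⟩ hx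
    obtain ⟨w, hw, rfl, rfl⟩ := hreach s t hx
    exact ⟨w, hw, hA _ _⟩
  · rintro ⟨s, t⟩ hx ⟨s', t'⟩ hy h
    by_contra hne
    obtain ⟨v, hv, hsep⟩ := hdist s t hx s' t' hy (by
      by_cases hs : s = s'
      · exact .inr ⟨hs, fun ht => hne (by rw [hs, ht])⟩
      · exact .inl hs)
    have := h v hv
    rw [hA, hA] at this
    exact hsep this

/-- The letters `la, lb, ld, le` act as `a, b, d, e` through `ρ` and as `a, e, d, b` through
`ρ'`. -/
structure IsDialectPair (ρ ρ' : β → Option Input) (la lb ld le : β) : Prop where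
  a_left : ρ la = some .a
  b_left : ρ lb = some .b
  d_left : ρ ld = some .d
  e_left : ρ le = some .e
  a_right : ρ' la = some .a
  b_right : ρ' lb = some .e
  d_right : ρ' ld = some .d
  e_right : ρ' le = some .b

variable {la lb ld le : β}

theorem IsDialectPair.symm (h : IsDialectPair ρ ρ' la lb ld le) :
    IsDialectPair ρ' ρ la le ld lb :=
  ⟨h.a_right, h.e_right, h.d_right, h.b_right, h.a_left, h.e_left, h.d_left, h.b_left⟩

variable (ρ ρ') in
/-- The words over the common domain of `ρ` and `ρ'`. -/
def IsCommon (w : List β) : Prop := ∀ l ∈ w, (ρ l).isSome ∧ (ρ' l).isSome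

theorem IsCommon.symm {w : List β} (h : IsCommon ρ ρ' w) : IsCommon ρ' ρ w :=
  fun l hl => (h l hl).symm

theorem IsCommon.append {u v : List β} (hu : IsCommon ρ ρ' u) (hv : IsCommon ρ ρ' v) :
    IsCommon ρ ρ' (u ++ v) := fun l hl => (List.mem_append.1 hl).elim (hu l) (hv l)

theorem isCommon_nil : IsCommon ρ ρ' [] := by simp [IsCommon]

theorem IsCommon.cons {l : β} {w : List β} (hl : (ρ l).isSome) (hl' : (ρ' l).isSome)
    (hw : IsCommon ρ ρ' w) : IsCommon ρ ρ' (l :: w) := by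
  intro k hk
  rcases List.mem_cons.1 hk with rfl | hk
  · exact ⟨hl, hl'⟩
  · exact hw k hk

theorem IsCommon.left {w : List β} (h : IsCommon ρ ρ' w) : ∀ l ∈ w, (ρ l).isSome :=
  fun l hl => (h l hl).1

theorem IsCommon.right {w : List β} (h : IsCommon ρ ρ' w) : ∀ l ∈ w, (ρ' l).isSome :=
  fun l hl => (h l hl).2

theorem evalFrom_replicate {n : ℕ} {hn : 4 ≤ n} {ρ : β → Option Input} (h : ρ la = some .a) (k : ℕ)
    (q : Fin n) : (relabeledDFA hn ρ).evalFrom q (List.replicate k la) =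
      (transition n hn · .a)^[k] q := by
  induction k generalizing q with
  | zero => rfl
  | succ k ih =>
    rw [List.replicate_succ, DFA.evalFrom_cons, relabeledDFA_step h, ih,
      Function.iterate_succ_apply]

theorem transition_b_involutive (q : Fin n) :
    transition n hn (transition n hn q .b) .b = q := by
  simp [transition]

theorem transition_b_ne_zeroState {q : Fin n} (hq : q ≠ zeroState hn) :
    transition n hn q .b ≠ zeroState hn := by
  intro h
  have := congrArg (transition n hn · .b) h
  simp only [transition_b_involutive, transition_zeroState (hn := hn) (i := .b) (by simp)] at this
  exact hq this

theorem exists_transition_a_iterate_preimage {q : Fin n} (hq : q ≠ zeroState hn) (k : ℕ) :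
    ∃ s, s ≠ zeroState hn ∧ (transition n hn · .a)^[k] s = q := by
  refine ⟨(transition n hn · .a)^[(n - 2) * k] q, transition_a_iterate_ne_zeroState hq _, ?_⟩
  rw [← Function.iterate_add_apply, show k + (n - 2) * k = (n - 1) * k by
    obtain ⟨j, rfl⟩ : ∃ j, n = j + 2 := ⟨n - 2, by omega⟩
    simp only [Nat.add_sub_cancel, show j + 2 - 1 = j + 1 by omega]
    ring, Function.iterate_mul]
  exact Function.iterate_fixed (transition_a_iterate_period q) k

namespace IsDialectPair

theorem isCommon_replicate (h : IsDialectPair ρ ρ' la lb ld le) (k : ℕ) :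
    IsCommon ρ ρ' (List.replicate k la) := by
  intro l hl
  rw [List.eq_of_mem_replicate hl, h.a_left, h.a_right]
  simp

/-- The second automaton can be brought to a known state, while a nonzero state of the first one
stays nonzero. -/
theorem exists_word_of_ne (h : IsDialectPair ρ ρ' la lb ld le)
    {p : Fin m} (hp : p ≠ zeroState hm) (c : Prop) :
    ∃ w, IsCommon ρ ρ' w ∧
      (relabeledDFA hm ρ).evalFrom (zeroState hm) w = zeroState hm ∧
      (relabeledDFA hm ρ).evalFrom p w ≠ zeroState hm ∧
      ∀ q, ((relabeledDFA hn ρ').evalFrom q w ≠ zeroState hn ↔ c) := by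
  have hlb : IsCommon ρ ρ' [lb] := isCommon_nil.cons (by simp [h.b_left]) (by simp [h.b_right])
  have hld : IsCommon ρ ρ' [ld] := isCommon_nil.cons (by simp [h.d_left]) (by simp [h.d_right])
  have hone := (zeroState_ne_oneState hn).symm
  have hone' := (zeroState_ne_oneState hm).symm
  by_cases hc : c
  · refine ⟨[lb], hlb, ?_, ?_, fun q => ?_⟩
    · rw [DFA.evalFrom_singleton, relabeledDFA_step h.b_left, transition_zeroState (by simp)]
    · rw [DFA.evalFrom_singleton, relabeledDFA_step h.b_left]
      exact transition_b_ne_zeroState hp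
    · rw [DFA.evalFrom_singleton, relabeledDFA_step h.b_right, transition_e]
      exact iff_of_true hone hc
  -- The word is a^j b a^(n-2) d. The second automaton is reset to 1 by `lb`, rotated to n-1 and
  -- sent to 0 by d. The choice of j and `s` puts the first automaton at 1 when d is read, where d
  -- is harmless.
  · obtain ⟨s, hs, hs1⟩ := exists_transition_a_iterate_preimage (hn := hm) hone' (n - 2)
    obtain ⟨j, hj⟩ := exists_transition_a_iterate_eq hp (transition_b_ne_zeroState hs)
    refine ⟨((List.replicate j la ++ [lb]) ++ List.replicate (n - 2) la) ++ [ld],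
      (((h.isCommon_replicate j).append hlb).append (h.isCommon_replicate _)).append hld,
      ?_, ?_, fun q => ?_⟩
    · rw [DFA.evalFrom_of_append, DFA.evalFrom_of_append, DFA.evalFrom_of_append,
        evalFrom_replicate h.a_left, evalFrom_replicate h.a_left, DFA.evalFrom_singleton,
        DFA.evalFrom_singleton, relabeledDFA_step h.b_left, relabeledDFA_step h.d_left,
        transition_a_iterate_zeroState, transition_zeroState (by simp),
        transition_a_iterate_zeroState, transition_zeroState (by simp)]
    · rw [DFA.evalFrom_of_append, DFA.evalFrom_of_append, DFA.evalFrom_of_append,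
        evalFrom_replicate h.a_left, evalFrom_replicate h.a_left, DFA.evalFrom_singleton,
        DFA.evalFrom_singleton, relabeledDFA_step h.b_left, relabeledDFA_step h.d_left,
        hj, transition_b_involutive, hs1, transition_d_of_ne (by simp only [oneState]; omega)]
      exact hone'
    · rw [DFA.evalFrom_of_append, DFA.evalFrom_of_append, DFA.evalFrom_of_append,
        evalFrom_replicate h.a_right, evalFrom_replicate h.a_right, DFA.evalFrom_singleton,
        DFA.evalFrom_singleton, relabeledDFA_step h.b_right, relabeledDFA_step h.d_right,
        transition_e, transition_d_of_eq]
      · exact iff_of_false (by simp) hc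
      · rw [transition_a_iterate_val (ne_zeroState_iff.1 hone)]
        simp only [oneState]
        rw [Nat.mod_eq_of_lt (by omega)]
        omega

/-- A word over a, d sends exactly one of the two states to 0; `exists_word_of_ne` then fixes the
second automaton and preserves this difference. -/
theorem exists_word_separating (h : IsDialectPair ρ ρ' la lb ld le)
    {p p' : Fin m} (hp : p ≠ p') (c : Prop) :
    ∃ w, IsCommon ρ ρ' w ∧
      ¬ ((relabeledDFA hm ρ).evalFrom p w ≠ zeroState hm ↔
        (relabeledDFA hm ρ).evalFrom p' w ≠ zeroState hm) ∧
      ∀ q, ((relabeledDFA hn ρ').evalFrom q w ≠ zeroState hn ↔ c) := by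
  obtain ⟨u, hu, hsep⟩ := exists_evalFrom_eq_zeroState (hn := hm) h.a_left h.d_left hp
  have hu' : IsCommon ρ ρ' u := fun l hl =>
    ⟨isSome_of_mem_pair h.a_left h.d_left (hu l hl),
      isSome_of_mem_pair h.a_right h.d_right (hu l hl)⟩
  by_cases h0 : (relabeledDFA hm ρ).evalFrom p u = zeroState hm
  · obtain ⟨v, hv, hv0, hv1, hvc⟩ := h.exists_word_of_ne (hn := hn) (hm := hm)
      (p := (relabeledDFA hm ρ).evalFrom p' u) (fun h1 => hsep (by simp [h0, h1])) c
    refine ⟨u ++ v, hu'.append hv, ?_, fun q => ?_⟩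
    · rw [DFA.evalFrom_of_append, DFA.evalFrom_of_append, h0, hv0]
      simpa using hv1
    · rw [DFA.evalFrom_of_append]
      exact hvc _
  · obtain ⟨v, hv, hv0, hv1, hvc⟩ := h.exists_word_of_ne (hn := hn) (hm := hm) h0 c
    have h1 : (relabeledDFA hm ρ).evalFrom p' u = zeroState hm := by
      by_contra h1
      exact hsep (by simp [h0, h1])
    refine ⟨u ++ v, hu'.append hv, ?_, fun q => ?_⟩
    · rw [DFA.evalFrom_of_append, DFA.evalFrom_of_append, h1, hv0]
      simpa using hv1
    · rw [DFA.evalFrom_of_append]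
      exact hvc _

theorem exists_word_left (h : IsDialectPair ρ ρ' la lb ld le) {p : Fin m} (hp : p ≠ zeroState hm) :
    ∃ w, IsCommon ρ ρ' w ∧ (relabeledDFA hm ρ).evalFrom (zeroState hm) w = p ∧
      (relabeledDFA hn ρ').evalFrom (zeroState hn) w = zeroState hn := by
  obtain ⟨i, hi⟩ := exists_transition_a_iterate_eq (zeroState_ne_oneState hm).symm hp
  refine ⟨le :: List.replicate i la, (h.isCommon_replicate i).cons (by simp [h.e_left])
    (by simp [h.e_right]), ?_, ?_⟩
  · rw [DFA.evalFrom_cons, relabeledDFA_step h.e_left, transition_e,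
      evalFrom_replicate h.a_left, hi]
  · rw [DFA.evalFrom_cons, relabeledDFA_step h.e_right, transition_zeroState (by simp),
      evalFrom_replicate h.a_right, transition_a_iterate_zeroState]

/-- Along an axis one resets one component while the other stays at 0. If both targets are nonzero,
reach a suitable (r, 0), let `lb` reset the second component to 1, and rotate both; r is chosen by
undoing b and the rotation. -/
theorem exists_word_eq (h : IsDialectPair ρ ρ' la lb ld le) (p : Fin m) (q : Fin n) :
    ∃ w, IsCommon ρ ρ' w ∧ (relabeledDFA hm ρ).evalFrom (zeroState hm) w = p ∧
      (relabeledDFA hn ρ').evalFrom (zeroState hn) w = q := by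
  by_cases hp : p = zeroState hm
  · by_cases hq : q = zeroState hn
    · exact ⟨[], isCommon_nil, hp.symm, hq.symm⟩
    · obtain ⟨w, hw, h1, h2⟩ := h.symm.exists_word_left (hm := hn) (hn := hm) hq
      exact ⟨w, hw.symm, h2.trans hp.symm, h1⟩
  · by_cases hq : q = zeroState hn
    · obtain ⟨w, hw, h1, h2⟩ := h.exists_word_left (hm := hm) (hn := hn) hp
      exact ⟨w, hw, h1, h2.trans hq.symm⟩
    · obtain ⟨j, hj⟩ := exists_transition_a_iterate_eq (zeroState_ne_oneState hn).symm hq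
      obtain ⟨s, hs, hsp⟩ := exists_transition_a_iterate_preimage hp j
      obtain ⟨w, hw, h1, h2⟩ := h.exists_word_left (hm := hm) (hn := hn)
        (transition_b_ne_zeroState hs)
      refine ⟨w ++ lb :: List.replicate j la, hw.append ((h.isCommon_replicate j).cons
        (by simp [h.b_left]) (by simp [h.b_right])), ?_, ?_⟩
      · rw [DFA.evalFrom_of_append, h1, DFA.evalFrom_cons, relabeledDFA_step h.b_left,
          transition_b_involutive, evalFrom_replicate h.a_left, hsp]
      · rw [DFA.evalFrom_of_append, DFA.evalFrom_cons, relabeledDFA_step h.b_right, transition_e,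
          evalFrom_replicate h.a_right, hj]

end IsDialectPair

theorem not_op_iff_left {op : Prop → Prop → Prop} {x y c z z' : Prop}
    (hop : ¬ (op True c ↔ op False c)) (hxy : ¬ (x ↔ y)) (hz : z ↔ c) (hz' : z' ↔ c) :
    ¬ (op x z ↔ op y z') := by
  rw [propext hz, propext hz']
  by_cases hx : x <;> by_cases hy : y <;> simp_all [Iff.comm]

theorem not_op_iff_right {op : Prop → Prop → Prop} {x y c z z' : Prop}
    (hop : ¬ (op c True ↔ op c False)) (hxy : ¬ (x ↔ y)) (hz : z ↔ c) (hz' : z' ↔ c) :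
    ¬ (op z x ↔ op z' y) :=
  not_op_iff_left (op := fun a b => op b a) hop hxy hz hz'

end Product

/-! ### Complexity of the boolean combinations -/

section BooleanWitness

variable {m n : ℕ} {hm : 4 ≤ m} {hn : 4 ≤ n} {β : Type*} {ρ ρ' : β → Option Input}
  {la lb ld le lc lf : β}

theorem transition_c_ne_zeroState_iff {q : Fin n} :
    transition n hn q .c ≠ zeroState hn ↔ q ≠ zeroState hn := by
  by_cases hq : q.val = n - 1
  · rw [transition_c_of_eq hq]
    refine iff_of_true (zeroState_ne_oneState hn).symm ?_
    rw [ne_zeroState_iff]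
    omega
  · rw [transition_c_of_ne hq]

/-- On common letters no run enters a sink. The two conditions on `op` say that each argument
matters for some value `c` of the other, and the other component can be frozen at that value. -/
theorem complexity_op_eq_mul (h : IsDialectPair ρ ρ' la lb ld le) {op : Prop → Prop → Prop}
    {L : Language β} (hL : ∀ v, v ∈ L ↔ op (v ∈ stateLanguage hm ρ (zeroState hm))
      (v ∈ stateLanguage hn ρ' (zeroState hn)))
    (hsub : ∀ v ∈ L, IsCommon ρ ρ' v) (hmem : ∃ c, op True c)
    (hop : ∃ c, ¬ (op True c ↔ op False c)) (hop' : ∃ c, ¬ (op c True ↔ op c False)) :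
    complexity L = ((m * n : ℕ) : ℕ∞) := by
  have hwords : ∀ w, w ∈ words L ↔ IsCommon ρ ρ' w := by
    have hletters : ∀ l, l ∈ letters L ↔ (ρ l).isSome ∧ (ρ' l).isSome := by
      intro l
      constructor
      · rintro ⟨w, hw, hl⟩
        exact hsub w hw l hl
      · rintro ⟨hl, hl'⟩
        obtain ⟨c, hc⟩ := hmem
        obtain ⟨w, hw, -, hw1, hwc⟩ := h.exists_word_of_ne (hm := hm) (hn := hn)
          (zeroState_ne_oneState hm).symm c
        have hcommon : IsCommon ρ ρ' (l :: le :: w) :=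
          (hw.cons (by simp [h.e_left]) (by simp [h.e_right])).cons hl hl'
        refine ⟨l :: le :: w, ?_, by simp⟩
        rw [hL, mem_stateLanguage, mem_stateLanguage]
        have e1 : ((∀ l' ∈ l :: le :: w, (ρ l').isSome) ∧
            (relabeledDFA hm ρ).evalFrom (zeroState hm) (l :: le :: w) ≠ zeroState hm) = True := by
          refine eq_true ⟨hcommon.left, ?_⟩
          rwa [DFA.evalFrom_cons, DFA.evalFrom_cons, relabeledDFA_step h.e_left, transition_e]
        have e2 : ((∀ l' ∈ l :: le :: w, (ρ' l').isSome) ∧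
            (relabeledDFA hn ρ').evalFrom (zeroState hn) (l :: le :: w) ≠ zeroState hn) = c := by
          refine propext ((and_iff_right hcommon.right).trans ?_)
          rw [DFA.evalFrom_cons, DFA.evalFrom_cons]
          exact hwc _
        rwa [e1, e2]
    intro w
    rw [mem_words_iff]
    exact forall₂_congr fun l _ => hletters l
  rw [complexity_of_op hL (Set.range fun x : Fin m × Fin n => (some x.1, some x.2))]
  · rw [← Set.image_univ, Function.Injective.encard_image, Set.encard_univ]
    · simp
    · rintro ⟨p, q⟩ ⟨p', q'⟩ heq
      simpa using heq
  · intro w hw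
    rw [hwords] at hw
    rw [partialRun_some hw.left, partialRun_some hw.right]
    exact ⟨(_, _), rfl⟩
  · rintro _ _ ⟨⟨p, q⟩, heq⟩
    obtain ⟨rfl, rfl⟩ := Prod.mk.inj heq
    obtain ⟨w, hw, h1, h2⟩ := h.exists_word_eq (hm := hm) (hn := hn) p q
    refine ⟨w, (hwords w).2 hw, ?_, ?_⟩
    · rw [partialRun_some hw.left, h1]
    · rw [partialRun_some hw.right, h2]
  · rintro _ _ ⟨⟨p, q⟩, heq⟩ _ _ ⟨⟨p', q'⟩, heq'⟩ hne
    obtain ⟨rfl, rfl⟩ := Prod.mk.inj heq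
    obtain ⟨rfl, rfl⟩ := Prod.mk.inj heq'
    rcases hne with hp | ⟨-, hq⟩
    · obtain ⟨c, hc⟩ := hop
      obtain ⟨w, hw, hsep, hwc⟩ := h.exists_word_separating (hm := hm) (hn := hn)
        (p := p) (p' := p') (fun e => hp (congrArg some e)) c
      refine ⟨w, (hwords w).2 hw, ?_⟩
      rw [partialRun_some hw.left, partialRun_some hw.right, partialRun_some hw.left,
        partialRun_some hw.right]
      simp only [isFinal_some]
      exact not_op_iff_left hc hsep (hwc _) (hwc _)
    · obtain ⟨c, hc⟩ := hop'
      obtain ⟨w, hw, hsep, hwc⟩ := h.symm.exists_word_separating (hm := hn) (hn := hm)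
        (p := q) (p' := q') (fun e => hq (congrArg some e)) c
      refine ⟨w, (hwords w).2 hw.symm, ?_⟩
      rw [partialRun_some hw.left, partialRun_some hw.right, partialRun_some hw.left,
        partialRun_some hw.right]
      simp only [isFinal_some]
      exact not_op_iff_right hc hsep (hwc _) (hwc _)

/-- The private letter c sends the second component to its sink and leaves acceptance in the first
unchanged. A sink in the first component is separated from a state by e followed by c. -/
theorem exists_word_separating_sink (h : IsDialectPair ρ ρ' la lb ld le) (hc : ρ lc = some .c)
    (hc' : ρ' lc = none) {s s' : Option (Fin m)} (hs : s ≠ s') :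
    ∃ v, (∀ l ∈ v, (ρ l).isSome) ∧
      ¬ (IsFinal hm (partialRun hm ρ s v) ↔ IsFinal hm (partialRun hm ρ s' v)) ∧
      ∀ t, partialRun hn ρ' t v = none := by
  have hlc : ¬ (ρ' lc).isSome := by simp [hc']
  have hsink : ∀ p : Fin m, partialRun hm ρ (some p) [le, lc] = some (oneState hm) := by
    intro p
    rw [partialRun_cons_some h.e_left, partialRun_cons_some hc, transition_e, partialRun_nil,
      transition_c_of_ne (by simp only [oneState]; omega)]
  have hone := (zeroState_ne_oneState hm).symm
  have hdom : ∀ l ∈ [le, lc], (ρ l).isSome := by simp [h.e_left, hc]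
  have hnone : ∀ t, partialRun hn ρ' t [le, lc] = none :=
    partialRun_eq_none (by simp [hc'])
  rcases s with _ | p <;> rcases s' with _ | p'
  · exact absurd rfl hs
  · refine ⟨[le, lc], hdom, ?_, hnone⟩
    simpa [hsink] using hone
  · refine ⟨[le, lc], hdom, ?_, hnone⟩
    simpa [hsink] using hone
  · obtain ⟨w, hw, hsep, -⟩ := h.exists_word_separating (hm := hm) (hn := hn)
      (p := p) (p' := p') (fun e => hs (congrArg some e)) True
    have hdom' : ∀ l ∈ w ++ [lc], (ρ l).isSome := by
      intro l hl
      rcases List.mem_append.1 hl with hl | hl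
      · exact hw.left l hl
      · rw [List.mem_singleton.1 hl, hc]
        rfl
    refine ⟨w ++ [lc], hdom', ?_, partialRun_eq_none fun h' => hlc (h' lc (by simp))⟩
    rw [partialRun_some hdom', partialRun_some hdom', isFinal_some, isFinal_some,
      DFA.evalFrom_of_append, DFA.evalFrom_of_append, DFA.evalFrom_singleton,
      DFA.evalFrom_singleton, relabeledDFA_step hc, relabeledDFA_step hc,
      transition_c_ne_zeroState_iff, transition_c_ne_zeroState_iff]
    exact hsep

theorem exists_word_eq_sink (h : IsDialectPair ρ ρ' la lb ld le) (hc : ρ lc = some .c)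
    (hc' : ρ' lc = none) (p : Fin m) :
    ∃ v, (∀ l ∈ v, (ρ l).isSome) ∧ partialRun hm ρ (some (zeroState hm)) v = some p ∧
      partialRun hn ρ' (some (zeroState hn)) v = none := by
  obtain ⟨w, hw, h1, -⟩ := h.exists_word_eq (hm := hm) (hn := hn) p (zeroState hn)
  refine ⟨lc :: w, ?_, ?_, partialRun_cons_none hc' _ _⟩
  · intro l hl
    rcases List.mem_cons.1 hl with rfl | hl
    · simp [hc]
    · exact hw.left l hl
  · rw [partialRun_cons_some hc, transition_zeroState (by simp), partialRun_some hw.left, h1]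

/-- Such a word witnesses that the letter `l` belongs to the alphabet of the union, the symmetric
difference and the difference. -/
theorem isFinal_partialRun_sink (h : IsDialectPair ρ ρ' la lb ld le) (hc : ρ lc = some .c)
    (hc' : ρ' lc = none) {l : β} (hl : (ρ l).isSome) :
    IsFinal hm (partialRun hm ρ (some (zeroState hm)) [l, le, lc]) ∧
      ¬ IsFinal hn (partialRun hn ρ' (some (zeroState hn)) [l, le, lc]) := by
  constructor
  · obtain ⟨i, hi⟩ := Option.isSome_iff_exists.1 hl
    rw [partialRun_cons_some hi, partialRun_cons_some h.e_left, partialRun_cons_some hc,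
      transition_e, partialRun_nil, isFinal_some, transition_c_ne_zeroState_iff]
    exact (zeroState_ne_oneState hm).symm
  · rw [partialRun_eq_none (by simp [hc'])]
    exact not_isFinal_none

theorem complexity_op_eq_succ_mul_succ (h : IsDialectPair ρ ρ' la lb ld le)
    (hc : ρ lc = some .c) (hc' : ρ' lc = none) (hf : ρ lf = none) (hf' : ρ' lf = some .c)
    (hall : ∀ l, (ρ l).isSome ∨ (ρ' l).isSome) {op : Prop → Prop → Prop}
    {L : Language β} (hL : ∀ v, v ∈ L ↔ op (v ∈ stateLanguage hm ρ (zeroState hm))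
      (v ∈ stateLanguage hn ρ' (zeroState hn)))
    (h1 : op True False) (h2 : op False True) (h3 : ¬ op False False) :
    complexity L = (((m + 1) * (n + 1) : ℕ) : ℕ∞) := by
  have hwords : ∀ w, w ∈ words L := by
    intro w l _
    rcases hall l with hl | hl
    · obtain ⟨e1, e2⟩ := isFinal_partialRun_sink (hm := hm) (hn := hn) h hc hc' hl
      refine ⟨[l, le, lc], ?_, by simp⟩
      rwa [hL, mem_stateLanguage_iff_isFinal, mem_stateLanguage_iff_isFinal, eq_true e1,
        eq_false e2]
    · obtain ⟨e1, e2⟩ := isFinal_partialRun_sink (hm := hn) (hn := hm) h.symm hf' hf hl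
      refine ⟨[l, lb, lf], ?_, by simp⟩
      rwa [hL, mem_stateLanguage_iff_isFinal, mem_stateLanguage_iff_isFinal, eq_true e1,
        eq_false e2]
  rw [complexity_of_op hL Set.univ (fun _ _ => trivial)]
  · rw [Set.encard_univ]
    simp
  · rintro (_ | p) (_ | q) -
    · refine ⟨[lc, lf], hwords _, ?_, partialRun_cons_none hc' _ _⟩
      rw [partialRun_cons_some hc, partialRun_cons_none hf]
    · obtain ⟨v, -, hv, hv'⟩ := exists_word_eq_sink (hm := hn) (hn := hm) h.symm hf' hf q
      exact ⟨v, hwords v, hv', hv⟩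
    · obtain ⟨v, -, hv, hv'⟩ := exists_word_eq_sink (hm := hm) (hn := hn) h hc hc' p
      exact ⟨v, hwords v, hv, hv'⟩
    · obtain ⟨w, hw, e1, e2⟩ := h.exists_word_eq (hm := hm) (hn := hn) p q
      refine ⟨w, hwords w, ?_, ?_⟩
      · rw [partialRun_some hw.left, e1]
      · rw [partialRun_some hw.right, e2]
  · rintro s t - s' t' - (hs | ⟨-, ht⟩)
    · obtain ⟨v, -, hsep, hv⟩ := exists_word_separating_sink (hm := hm) (hn := hn) h hc hc' hs
      refine ⟨v, hwords v, not_op_iff_left (c := False) (by simp [h1, h3]) hsep ?_ ?_⟩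
      · simp [hv]
      · simp [hv]
    · obtain ⟨v, -, hsep, hv⟩ :=
        exists_word_separating_sink (hm := hn) (hn := hm) h.symm hf' hf ht
      refine ⟨v, hwords v, not_op_iff_right (c := False) (by simp [h2, h3]) hsep ?_ ?_⟩
      · simp [hv]
      · simp [hv]

theorem complexity_sdiff_eq (h : IsDialectPair ρ ρ' la lb ld le) (hc : ρ lc = some .c)
    (hc' : ρ' lc = none) :
    complexity (stateLanguage hm ρ (zeroState hm) \ stateLanguage hn ρ' (zeroState hn)) =
      ((m * n + m : ℕ) : ℕ∞) := by
  have hwords : ∀ w, w ∈ words (stateLanguage hm ρ (zeroState hm) \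
      stateLanguage hn ρ' (zeroState hn)) ↔ ∀ l ∈ w, (ρ l).isSome := by
    intro w
    rw [mem_words_iff]
    refine forall₂_congr fun l _ => ⟨?_, fun hl => ?_⟩
    · rintro ⟨v, hv, hl⟩
      exact (mem_sdiff_iff.1 hv).1.1 l hl
    · obtain ⟨e1, e2⟩ := isFinal_partialRun_sink (hm := hm) (hn := hn) h hc hc' hl
      exact ⟨[l, le, lc], mem_sdiff_iff.2 ⟨mem_stateLanguage_iff_isFinal.2 e1,
        fun h' => e2 (mem_stateLanguage_iff_isFinal.1 h')⟩, by simp⟩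
  rw [complexity_of_op (op := fun x y => x ∧ ¬ y) (fun _ => mem_sdiff_iff)
    (Set.range fun x : Fin m × Option (Fin n) => (some x.1, x.2))]
  · rw [← Set.image_univ, Function.Injective.encard_image, Set.encard_univ]
    · simp [mul_add]
    · rintro ⟨p, q⟩ ⟨p', q'⟩ heq
      simpa using heq
  · intro w hw
    rw [hwords] at hw
    rw [partialRun_some hw]
    exact ⟨(_, _), rfl⟩
  · rintro _ _ ⟨⟨p, t⟩, heq⟩
    obtain ⟨rfl, rfl⟩ := Prod.mk.inj heq
    rcases t with _ | q
    · obtain ⟨v, hv, hv1, hv2⟩ := exists_word_eq_sink (hm := hm) (hn := hn) h hc hc' p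
      exact ⟨v, (hwords v).2 hv, hv1, hv2⟩
    · obtain ⟨w, hw, e1, e2⟩ := h.exists_word_eq (hm := hm) (hn := hn) p q
      refine ⟨w, (hwords w).2 hw.left, ?_, ?_⟩
      · rw [partialRun_some hw.left, e1]
      · rw [partialRun_some hw.right, e2]
  · rintro s t hst s' t' - (hs | ⟨rfl, ht⟩)
    · obtain ⟨v, hv, hsep, hv'⟩ := exists_word_separating_sink (hm := hm) (hn := hn) h hc hc' hs
      refine ⟨v, (hwords v).2 hv, ?_⟩
      simpa [hv'] using hsep
    · obtain ⟨⟨p, t⟩, heq⟩ := hst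
      obtain ⟨rfl, rfl⟩ := Prod.mk.inj heq
      -- With the first component accepting, this word separates the sink from all states of the
      -- second: b and e in either order leave any state at a nonzero one.
      have hbe : ∀ l ∈ [lb, le], (ρ l).isSome := by simp [h.b_left, h.e_left]
      have hp : IsFinal hm (partialRun hm ρ (some p) [lb, le]) := by
        rw [partialRun_cons_some h.b_left, partialRun_cons_some h.e_left, transition_e,
          partialRun_nil, isFinal_some]
        exact (zeroState_ne_oneState hm).symm
      have hq : ∀ q : Fin n, IsFinal hn (partialRun hn ρ' (some q) [lb, le]) := by
        intro q
        rw [partialRun_cons_some h.b_right, partialRun_cons_some h.e_right, transition_e,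
          partialRun_nil, isFinal_some]
        exact transition_b_ne_zeroState (zeroState_ne_oneState hn).symm
      rcases t with _ | q <;> rcases t' with _ | q'
      · exact absurd rfl ht
      · exact ⟨[lb, le], (hwords _).2 hbe, by simp [hp, hq]⟩
      · exact ⟨[lb, le], (hwords _).2 hbe, by simp [hp, hq]⟩
      · obtain ⟨w, hw, hsep, hwc⟩ := h.symm.exists_word_separating (hm := hn) (hn := hm)
          (p := q) (p' := q') (fun e => ht (congrArg some e)) True
        refine ⟨w, (hwords w).2 hw.right, not_op_iff_right (c := True) (by simp) ?_ ?_ ?_⟩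
        · rw [partialRun_some hw.left, partialRun_some hw.left, isFinal_some, isFinal_some]
          exact fun h' => hsep (not_iff_not.1 h')
        · rw [partialRun_some hw.right, isFinal_some]
          exact hwc p
        · rw [partialRun_some hw.right, isFinal_some]
          exact hwc p

end BooleanWitness

/-! ### The concrete dialects -/

section Dialects

variable {m n : ℕ} {hm : 4 ≤ m} {hn : 4 ≤ n}

/-- The letters of `M_n(a, -, -, d, e)`. -/
def lettersMade : Letter → Option Input
  | .a => some .a
  | .d => some .d
  | .e => some .e
  | _ => none

/-- The letters of `M_n(a, b, -, d, e)`. -/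
def lettersMabde : Letter → Option Input
  | .a => some .a
  | .b => some .b
  | .d => some .d
  | .e => some .e
  | _ => none

/-- The letters of `M_n(a, e, -, d, b)`. -/
def lettersMaedb : Letter → Option Input
  | .a => some .a
  | .b => some .e
  | .d => some .d
  | .e => some .b
  | _ => none

/-- The letters of `M_n(a, b, c, d, e)`. -/
def lettersMabcde : Letter → Option Input
  | .a => some .a
  | .b => some .b
  | .c => some .c
  | .d => some .d
  | .e => some .e
  | .f => none

/-- The letters of `M_n(a, e, f, d, b)`. -/
def lettersMaefdb : Letter → Option Input
  | .a => some .a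
  | .b => some .e
  | .c => none
  | .d => some .d
  | .e => some .b
  | .f => some .c

theorem Made_eq : Made n hn = stateLanguage hn lettersMade (zeroState hn) :=
  dialect_eq_stateLanguage fun i l => by cases i <;> cases l <;> simp [lettersMade]

theorem Mabde_eq : Mabde n hn = stateLanguage hn lettersMabde (zeroState hn) :=
  dialect_eq_stateLanguage fun i l => by cases i <;> cases l <;> simp [lettersMabde]

theorem Maedb_eq : Maedb n hn = stateLanguage hn lettersMaedb (zeroState hn) :=
  dialect_eq_stateLanguage fun i l => by cases i <;> cases l <;> simp [lettersMaedb]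

theorem Mabcde_eq : Mabcde n hn = stateLanguage hn lettersMabcde (zeroState hn) :=
  dialect_eq_stateLanguage fun i l => by cases i <;> cases l <;> simp [lettersMabcde]

theorem Maefdb_eq : Maefdb n hn = stateLanguage hn lettersMaefdb (zeroState hn) :=
  dialect_eq_stateLanguage fun i l => by cases i <;> cases l <;> simp [lettersMaefdb]

theorem isDialectPair_restricted : IsDialectPair lettersMabde lettersMaedb .a .b .d .e :=
  ⟨rfl, rfl, rfl, rfl, rfl, rfl, rfl, rfl⟩

theorem isDialectPair_unrestricted : IsDialectPair lettersMabcde lettersMaefdb .a .b .d .e :=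
  ⟨rfl, rfl, rfl, rfl, rfl, rfl, rfl, rfl⟩

theorem isSome_lettersMabde_iff (l : Letter) :
    (lettersMabde l).isSome ↔ (lettersMaedb l).isSome := by
  cases l <;> simp [lettersMabde, lettersMaedb]

theorem isLeftIdeal_and_complexity_dialects (L : Language Letter)
    (hL : L ∈ [Made n hn, Mabde n hn, Maedb n hn, Mabcde n hn, Maefdb n hn]) :
    IsLeftIdeal L ∧ complexity L = n := by
  have key : ∀ {ρ : Letter → Option Input} {la ld le : Letter}, ρ la = some .a → ρ ld = some .d →
      ρ le = some .e → IsLeftIdeal (stateLanguage hn ρ (zeroState hn)) ∧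
        complexity (stateLanguage hn ρ (zeroState hn)) = n :=
    fun ha hd he => ⟨isLeftIdeal_stateLanguage he, complexity_stateLanguage ha hd he _⟩
  simp only [List.mem_cons, List.not_mem_nil, or_false] at hL
  rcases hL with rfl | rfl | rfl | rfl | rfl
  · rw [Made_eq]
    exact key (la := .a) (ld := .d) (le := .e) rfl rfl rfl
  · rw [Mabde_eq]
    exact key (la := .a) (ld := .d) (le := .e) rfl rfl rfl
  · rw [Maedb_eq]
    exact key (la := .a) (ld := .d) (le := .b) rfl rfl rfl
  · rw [Mabcde_eq]
    exact key (la := .a) (ld := .d) (le := .e) rfl rfl rfl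
  · rw [Maefdb_eq]
    exact key (la := .a) (ld := .d) (le := .b) rfl rfl rfl

theorem letters_Mabde_eq : letters (Mabde m hm) = letters (Maedb n hn) := by
  rw [Mabde_eq, Maedb_eq, letters_stateLanguage (le := .e) rfl,
    letters_stateLanguage (le := .b) rfl]
  exact Set.ext isSome_lettersMabde_iff

theorem isCommon_of_mem_restricted {w : List Letter}
    (hw : w ∈ stateLanguage hm lettersMabde (zeroState hm) ∨
      w ∈ stateLanguage hn lettersMaedb (zeroState hn)) :
    IsCommon lettersMabde lettersMaedb w := by
  rcases hw with hw | hw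
  · exact fun l hl => ⟨hw.1 l hl, (isSome_lettersMabde_iff l).1 (hw.1 l hl)⟩
  · exact fun l hl => ⟨(isSome_lettersMabde_iff l).2 (hw.1 l hl), hw.1 l hl⟩

theorem complexity_restricted_boolean :
    complexity (Mabde m hm ⊔ Maedb n hn) = ((m * n : ℕ) : ℕ∞) ∧
    complexity (Mabde m hm ∆ Maedb n hn) = ((m * n : ℕ) : ℕ∞) ∧
    complexity (Mabde m hm \ Maedb n hn) = ((m * n : ℕ) : ℕ∞) ∧
    complexity (Mabde m hm ⊓ Maedb n hn) = ((m * n : ℕ) : ℕ∞) := by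
  have h := isDialectPair_restricted
  rw [Mabde_eq, Maedb_eq]
  refine ⟨?_, ?_, ?_, ?_⟩
  · exact complexity_op_eq_mul h (op := fun x y => x ∨ y) (fun _ => mem_sup_iff)
      (fun v hv => isCommon_of_mem_restricted hv) ⟨True, by simp⟩ ⟨False, by simp⟩
      ⟨False, by simp⟩
  · exact complexity_op_eq_mul h (op := fun x y => x ∧ ¬ y ∨ y ∧ ¬ x) (fun _ => mem_symmDiff_iff)
      (fun v hv => isCommon_of_mem_restricted (hv.imp And.left And.left)) ⟨False, by simp⟩
      ⟨False, by simp⟩ ⟨False, by simp⟩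
  · exact complexity_op_eq_mul h (op := fun x y => x ∧ ¬ y) (fun _ => mem_sdiff_iff)
      (fun v hv => isCommon_of_mem_restricted (hn := hn) (.inl hv.1)) ⟨False, by simp⟩
      ⟨False, by simp⟩ ⟨True, by simp⟩
  · exact complexity_op_eq_mul h (op := fun x y => x ∧ y) (fun _ => mem_inf_iff)
      (fun v hv => isCommon_of_mem_restricted (hn := hn) (.inl hv.1)) ⟨True, by simp⟩
      ⟨True, by simp⟩ ⟨True, by simp⟩

theorem complexity_unrestricted_boolean :
    complexity (Mabcde m hm ⊔ Maefdb n hn) = (((m + 1) * (n + 1) : ℕ) : ℕ∞) ∧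
    complexity (Mabcde m hm ∆ Maefdb n hn) = (((m + 1) * (n + 1) : ℕ) : ℕ∞) ∧
    complexity (Mabcde m hm \ Maefdb n hn) = ((m * n + m : ℕ) : ℕ∞) ∧
    complexity (Mabcde m hm ⊓ Maefdb n hn) = ((m * n : ℕ) : ℕ∞) := by
  have h := isDialectPair_unrestricted
  have hall : ∀ l, (lettersMabcde l).isSome ∨ (lettersMaefdb l).isSome := by
    intro l
    cases l <;> simp [lettersMabcde, lettersMaefdb]
  rw [Mabcde_eq, Maefdb_eq]
  refine ⟨?_, ?_, ?_, ?_⟩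
  · exact complexity_op_eq_succ_mul_succ h (lc := .c) (lf := .f) rfl rfl rfl rfl hall
      (op := fun x y => x ∨ y) (fun _ => mem_sup_iff) (by simp) (by simp) (by simp)
  · exact complexity_op_eq_succ_mul_succ h (lc := .c) (lf := .f) rfl rfl rfl rfl hall
      (op := fun x y => x ∧ ¬ y ∨ y ∧ ¬ x) (fun _ => mem_symmDiff_iff) (by simp) (by simp)
      (by simp)
  · exact complexity_sdiff_eq h (lc := .c) rfl rfl
  · exact complexity_op_eq_mul h (op := fun x y => x ∧ y) (fun _ => mem_inf_iff)
      (fun v hv l hl => ⟨hv.1.1 l hl, hv.2.1 l hl⟩) ⟨True, by simp⟩ ⟨True, by simp⟩ ⟨True, by simp⟩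

end Dialects

end SuffixConvex

open SuffixConvex in
theorem theorem2 :
    -- `E_n` is minimal, and `M_n` and its dialects used below are left ideals of complexity `n`
    (∀ (n : ℕ) (hn : 4 ≤ n),
      IsMinimal (E n hn) ∧
      (IsLeftIdeal (M n hn) ∧ complexity (M n hn) = n) ∧
      (∀ L ∈ [Made n hn, Mabde n hn, Maedb n hn, Mabcde n hn, Maefdb n hn],
        IsLeftIdeal L ∧ complexity L = n)) ∧
    -- the values reached by the stream
    (∀ (n : ℕ) (hn : 4 ≤ n),
      ENat.card (SyntacticSemigroup (M n hn)) = ((n ^ (n - 1) + n - 1 : ℕ) : ℕ∞) ∧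
      (∀ K ∈ quotients (Made n hn), complexity K = n) ∧
      complexity (Made n hn).reverse = ((2 ^ (n - 1) + 1 : ℕ) : ℕ∞) ∧
      (atoms (Made n hn)).encard = ((2 ^ (n - 1) + 1 : ℕ) : ℕ∞) ∧
      (∀ S ⊆ quotients (M n hn), atomOf (M n hn) S ∈ atoms (M n hn) →
        complexity (atomOf (M n hn) S) = (atomBound n S.ncard : ℕ∞)) ∧
      complexity (Made n hn)∗ = ((n + 1 : ℕ) : ℕ∞)) ∧
    -- boolean operations, restricted
    (∀ (m n : ℕ) (hm : 4 ≤ m) (hn : 4 ≤ n),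
      letters (Mabde m hm) = letters (Maedb n hn) ∧
      complexity (Mabde m hm ⊔ Maedb n hn) = ((m * n : ℕ) : ℕ∞) ∧
      complexity (Mabde m hm ∆ Maedb n hn) = ((m * n : ℕ) : ℕ∞) ∧
      complexity (Mabde m hm \ Maedb n hn) = ((m * n : ℕ) : ℕ∞) ∧
      complexity (Mabde m hm ⊓ Maedb n hn) = ((m * n : ℕ) : ℕ∞)) ∧
    -- boolean operations, unrestricted
    (∀ (m n : ℕ) (hm : 4 ≤ m) (hn : 4 ≤ n),
      complexity (Mabcde m hm ⊔ Maefdb n hn) = (((m + 1) * (n + 1) : ℕ) : ℕ∞) ∧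
      complexity (Mabcde m hm ∆ Maefdb n hn) = (((m + 1) * (n + 1) : ℕ) : ℕ∞) ∧
      complexity (Mabcde m hm \ Maefdb n hn) = ((m * n + m : ℕ) : ℕ∞) ∧
      complexity (Mabcde m hm ⊓ Maefdb n hn) = ((m * n : ℕ) : ℕ∞)) ∧
    -- these values are the largest possible for left ideals: unary measures
    (∀ (α : Type) [Finite α] (n : ℕ), 4 ≤ n → ∀ L : Language α,
      IsLeftIdeal L → complexity L = n →
        ENat.card (SyntacticSemigroup L) ≤ ((n ^ (n - 1) + n - 1 : ℕ) : ℕ∞) ∧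
        (∀ K ∈ quotients L, complexity K ≤ n) ∧
        complexity L.reverse ≤ ((2 ^ (n - 1) + 1 : ℕ) : ℕ∞) ∧
        (atoms L).encard ≤ ((2 ^ (n - 1) + 1 : ℕ) : ℕ∞) ∧
        (∀ S ⊆ quotients L, atomOf L S ∈ atoms L →
          complexity (atomOf L S) ≤ (atomBound n S.ncard : ℕ∞)) ∧
        complexity L∗ ≤ ((n + 1 : ℕ) : ℕ∞)) ∧
    -- these values are the largest possible for left ideals: boolean operations
    (∀ (α : Type) [Finite α] (m n : ℕ), 4 ≤ m → 4 ≤ n → ∀ L' L : Language α,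
      IsLeftIdeal L' → complexity L' = m → IsLeftIdeal L → complexity L = n →
        (letters L' = letters L →
          complexity (L' ⊔ L) ≤ ((m * n : ℕ) : ℕ∞) ∧
          complexity (L' ∆ L) ≤ ((m * n : ℕ) : ℕ∞) ∧
          complexity (L' \ L) ≤ ((m * n : ℕ) : ℕ∞) ∧
          complexity (L' ⊓ L) ≤ ((m * n : ℕ) : ℕ∞)) ∧
        complexity (L' ⊔ L) ≤ (((m + 1) * (n + 1) : ℕ) : ℕ∞) ∧
        complexity (L' ∆ L) ≤ (((m + 1) * (n + 1) : ℕ) : ℕ∞) ∧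
        complexity (L' \ L) ≤ ((m * n + m : ℕ) : ℕ∞) ∧
        complexity (L' ⊓ L) ≤ ((m * n : ℕ) : ℕ∞)) := by
  refine ⟨fun n hn => ⟨isMinimal_E, ⟨isLeftIdeal_M, complexity_M⟩,
    isLeftIdeal_and_complexity_dialects⟩, fun n hn => ⟨card_syntacticSemigroup_M, ?_, ?_, ?_,
    fun S hS hA => complexity_atomOf_M hS hA, ?_⟩,
    fun m n hm hn => ⟨letters_Mabde_eq, complexity_restricted_boolean⟩,
    fun m n hm hn => complexity_unrestricted_boolean,
    fun α _ n h4 L hL hn => ⟨hL.card_syntacticSemigroup_le hn h4,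
      fun K hK => hn ▸ complexity_quotient_le hK, ?_, ?_,
      fun S hS hA => hL.complexity_atomOf_le hn hS hA, hL.complexity_kstar_le hn⟩,
    fun α _ m n _ _ L' L _ hm _ hn => boolean_upper_bounds hm hn⟩
  · intro K hK
    rw [Made_eq] at hK
    exact complexity_quotient_stateLanguage (la := .a) (ld := .d) (le := .e) rfl rfl rfl hK
  · rw [complexity_reverse, Made_eq]
    exact encard_containingSets_stateLanguage (la := .a) (ld := .d) (le := .e) rfl rfl rfl
  · rw [encard_atoms, Made_eq]
    exact encard_containingSets_stateLanguage (la := .a) (ld := .d) (le := .e) rfl rfl rfl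
  · rw [Made_eq]
    exact complexity_kstar_stateLanguage (la := .a) (ld := .d) (le := .e) rfl rfl rfl
  · rw [complexity_reverse]
    exact hL.encard_containingSets_le hn
  · rw [encard_atoms]
    exact hL.encard_containingSets_le hn
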